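/- Let $d$ be a positive integer, and let $\mu$ be the normalized (probability) surface measure on the triangle manifold $$\mathcal I=\{(y,z)\in\mathbb R^d\times\mathbb R^d:\ |y|=|z|=|y-z|=1\}\subset\mathbb R^{2d}.$$ For $t>0$ let $$\mathcal T_t(f,g)(x)=\int_{\mathcal I} f(x-ty)\,g(x-tz)\,d\mu(y,z),$$ and for $E\subset[1,2]$ let $\mathcal T_E(f,g)(x)=\sup_{t\in E}|\mathcal T_t(f,g)(x)|$. For $s\ge 0$ let $\|f\|_{H^{-s}}=\|(1+|\xi|^2)^{-s/2}\hat f(\xi)\|_{L^2(\mathbb R^d)}$, where $\hat f(\xi)=\int f(x)e^{-2\pi i x\cdot\xi}\,dx$, extended to tempered distributions, and let $H^{-s}$ be the space of tempered distributions for which this is finite. **Theorem.** Let $E\subset[1,2]$ have upper Minkowski dimension $\beta=\limsup_{\delta\to0^+}\frac{\log N(E,\delta)}{\log(1/\delta)}$, where $N(E,\delta)$ is the minimal number of closed intervals of length $\delta$ needed to cover $E$. Assume that $d>4+\beta$, and let $s_1,s_2\ge 0$ with $$s_1+s_2<\frac{d-4-\beta}{2}.$$ Then there is a finite constant $C$,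 depending only on $d,E,s_1,s_2$, such that $$\|\mathcal T_E(f,g)\|_{L^2(\mathbb R^d)}\le C\,\|f\|_{H^{-s_1}}\|g\|_{H^{-s_2}}$$ for all $f,g\in L^2(\mathbb R^d)$; here, for almost every $x$, the integrals $\mathcal T_t(f,g)(x)$ converge absolutely for all $t\in E$ simultaneously, and $\mathcal T_E(f,g)$ is (almost everywhere equal to) a measurable function. The same estimate, with the same $C$, holds for all $f\in H^{-s_1}$ and $g\in H^{-s_2}$, where $\mathcal T_t$, $t\in E$, is extended by continuity: there are functions $\mathcal T_t(f,g)$ on $\mathbb R^d$ such that $\sup_{t\in E}|\mathcal T_t(f,g)|$ is measurable with $L^2$ norm at most $C\|f\|_{H^{-s_1}}\|g\|_{H^{-s_2}}$, and such that $\big\|\sup_{t\in E}|\mathcal T_t(\varphi_n,\psi_n)-\mathcal T_t(f,g)|\big\|_{L^2}\to0$ for all sequences of Schwartz functions with $\varphi_n\to f$ in $H^{-s_1}$ and $\psi_n\to g$ in $H^{-s_2}$. -/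

import Mathlib

open MeasureTheory Filter Topology
open scoped ENNReal SchwartzMap FourierTransform

noncomputable section

/-- `N(E, δ)`: the minimal number of closed intervals of length `δ` needed to cover `E ⊆ ℝ`
(used for bounded `E` and `δ > 0`, where finitely many intervals suffice). -/
def intervalCoveringNumber (E : Set ℝ) (δ : ℝ) : ℕ :=
  sInf {n : ℕ | ∃ c : Fin n → ℝ, E ⊆ ⋃ i, Set.Icc (c i) (c i + δ)}

/-- The upper Minkowski dimension `limsup_{δ → 0+} log N(E, δ) / log (1 / δ)` of a bounded set
`E ⊆ ℝ`. -/
def upperMinkowskiDim (E : Set ℝ) : EReal :=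
  limsup (fun δ : ℝ =>
    ((Real.log (intervalCoveringNumber E δ) / Real.log (1 / δ) : ℝ) : EReal)) (𝓝[>] 0)

/-- The triangle manifold `{(y, z) : |y| = |z| = |y - z| = 1}` in `ℝ^{2d} = ℝ^d × ℝ^d`; the product
carries the Euclidean (`L²`) distance. -/
def triangleManifold (d : ℕ) :
    Set (WithLp 2 (EuclideanSpace ℝ (Fin d) × EuclideanSpace ℝ (Fin d))) :=
  {p | ‖p.fst‖ = 1 ∧ ‖p.snd‖ = 1 ∧ ‖p.fst - p.snd‖ = 1}

/-- The normalized surface measure on the triangle manifold: the Hausdorff measure of dimension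
`2d - 3` (the dimension of the manifold) on `ℝ^{2d}`, restricted to the manifold and divided by its
total mass. -/
def triangleMeasure (d : ℕ) :
    Measure (WithLp 2 (EuclideanSpace ℝ (Fin d) × EuclideanSpace ℝ (Fin d))) :=
  (Measure.hausdorffMeasure (2 * (d : ℝ) - 3) (triangleManifold d))⁻¹ •
    (Measure.hausdorffMeasure (2 * (d : ℝ) - 3)).restrict (triangleManifold d)

/-- The triangle average `T_t(f, g)(x) = ∫ f(x - t y) g(x - t z) dμ(y, z)`. -/
def triangleAverage {d : ℕ} (f g : EuclideanSpace ℝ (Fin d) → ℂ) (t : ℝ)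
    (x : EuclideanSpace ℝ (Fin d)) : ℂ :=
  ∫ p, f (x - t • p.fst) * g (x - t • p.snd) ∂(triangleMeasure d)

/-- The maximal function `x ↦ sup_{t ∈ E} |F_t(x)|`, with values in `[0, ∞]`, of a family
`(F_t)` of functions on `ℝ^d`. -/
def maximalFunction {d : ℕ} (E : Set ℝ) (F : ℝ → EuclideanSpace ℝ (Fin d) → ℂ)
    (x : EuclideanSpace ℝ (Fin d)) : ℝ≥0∞ :=
  ⨆ t ∈ E, ‖F t x‖ₑ

/-- The triangle maximal operator `T_E(f, g)(x) = sup_{t ∈ E} |T_t(f, g)(x)|`. -/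
def triangleMaximal {d : ℕ} (E : Set ℝ) (f g : EuclideanSpace ℝ (Fin d) → ℂ) :
    EuclideanSpace ℝ (Fin d) → ℝ≥0∞ :=
  maximalFunction E (triangleAverage f g)

/-- The `H^σ` norm `‖(1 + |ξ|²)^{σ/2} û(ξ)‖_{L²}` of a tempered distribution `u` on `ℝ^d`: the
`L²` norm of the (unique) `h ∈ L²` that represents `(1 + |ξ|²)^{σ/2} û`, and `∞` if there is
none. -/
def sobolevENorm {d : ℕ} (σ : ℝ) (u : 𝓢'(EuclideanSpace ℝ (Fin d), ℂ)) : ℝ≥0∞ :=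
  ⨅ (h : Lp ℂ 2 (volume : Measure (EuclideanSpace ℝ (Fin d))))
    (_ : TemperedDistribution.smulLeftCLM ℂ
      (fun ξ : EuclideanSpace ℝ (Fin d) => (((1 + ‖ξ‖ ^ 2) ^ (σ / 2) : ℝ) : ℂ)) (𝓕 u) =
        (h : 𝓢'(EuclideanSpace ℝ (Fin d), ℂ))), ‖h‖ₑ

end

/-! On Schwartz functions the average of radius t is a bilinear Fourier multiplier operator with
symbol m(-2πt; ξ, η), where m(θ; ξ, η) = ∫ exp(iθ(ξ·y + η·z)) dμ(y, z) (`triangleAverage_schwartz`).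
By Plancherel and Cauchy–Schwarz, an operator with symbol k has squared L² norm at most sup_η ∫
|k(ξ, η)|² dξ · ‖f̂‖² ‖ĝ‖² (`lintegral_bilinearMultiplier_sq_le`). Hence no joint pointwise decay of
m is needed, only L² decay in ξ for fixed η, on the region |ξ| ≤ |η|; the other region follows by
exchanging the two vertices.

This decay comes from fibering the triangle manifold over its first vertex. The measure μ is
O(d)-invariant and O(d) acts transitively on the triangles, so up to a factor μ is the law of (g e,
g(e/2 + (√3/2) ω)), with g Haar distributed and ω invariantly distributed on the equator orthogonal
to e (`exists_isTriangleModel`). Integrating over ω first turns m(θ; ·, η) into the Fourier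
transform of a density b on the sphere. Two facts are combined: - ∫_{|ξ| ≤ ρ} |(b dσ)^|² = O(ρ
‖b‖²), which only uses that caps of radius 1/ρ have mass O(ρ^{1-d}) (`lintegral_extension_le`); -
‖b‖² = O(|η|^{-(d-2)}). Indeed |b|² is O((|η| sin α)^{-(d-2)}), α being the angle between η and g e,
by the Fourier decay of the equatorial measure (`IsEquatorial.fourier_decay`, from an energy
estimate for the Bessel equation), and the singularity sin^{-(d-2)} is integrable on the sphere
(`exists_lintegral_sq_le`).

So ∫_{|ξ| ≤ |η|} |m|² dξ = O(|η|^{-(d-3)}) for large η, and a derivative in θ costs a factor |η|².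
For |η| of size 2^n, cover E by O(2^{n(β+1/2)}) intervals of length 2^{-n}; on each, the supremum in
t is controlled by the mean squares of the function and of its derivative, without loss. The squared
norm of this piece is O(2^{n(β + 1/2 - (d-3) + 2(s₁+s₂))}), and the hypothesis makes the exponent
less than -n/2, so the pieces can be summed (`IsTriangleInvariant.exists_multiplier_maximal_le`).

The extension to H^{-s₁} × H^{-s₂} is a completion argument carried out in the norm of the maximal
function (`exists_extension`). For f, g ∈ L² it must still be identified with the actual integrals,
for almost every x and all t in the possibly uncountable set E at once. For this the estimate with
s₁ = s₂ = 0 is carried over by monotone approximation to nonnegative lower semicontinuous functions,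
which dominate L² functions at every point (`exists_majorant`). -/

/-- The Euclidean space `ℝ^d`. -/
abbrev Eu (d : ℕ) := EuclideanSpace ℝ (Fin d)

/-! ### Invariance of the triangle measure -/

/-- A finite measure on `ℝ^d × ℝ^d` that is carried by the triangle manifold and invariant under
the diagonal action of linear isometries. -/
structure IsTriangleInvariant {d : ℕ} (ν : Measure (Eu d × Eu d)) : Prop where
  finite : IsFiniteMeasure ν
  map_eq : ∀ u : Eu d ≃ₗᵢ[ℝ] Eu d, ν.map (Prod.map u u) = ν
  supp : ∀ᵐ p ∂ν, ‖p.1‖ = 1 ∧ ‖p.2‖ = 1 ∧ ‖p.1 - p.2‖ = 1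

/-- The inequality m⁻¹ * m ≤ 1 holds in [0, ∞] also for m = 0 and m = ∞, so the Hausdorff measure of
the manifold need not be known to be positive or finite. -/
instance isFiniteMeasure_triangleMeasure (d : ℕ) : IsFiniteMeasure (triangleMeasure d) := by
  constructor
  rw [triangleMeasure]
  simp only [Measure.smul_apply, Measure.restrict_apply_univ, smul_eq_mul]
  exact lt_of_le_of_lt (ENNReal.inv_mul_le_one _) ENNReal.one_lt_top

/-- The equivalence between the `L²` product and the product as measurable spaces. -/
noncomputable def pairEquiv (d : ℕ) : WithLp 2 (Eu d × Eu d) ≃ᵐ Eu d × Eu d :=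
  (WithLp.homeomorphProd 2 (Eu d) (Eu d)).toMeasurableEquiv

/-- The triangle measure as a measure on the product space. -/
noncomputable def pairMeasure (d : ℕ) : Measure (Eu d × Eu d) :=
  (triangleMeasure d).map (pairEquiv d)

lemma measurableSet_triangleManifold (d : ℕ) : MeasurableSet (triangleManifold d) := by
  have h1 : Continuous fun p : WithLp 2 (Eu d × Eu d) => p.fst := WithLp.prod_continuous_ofLp 2 _ _ |>.fst
  have h2 : Continuous fun p : WithLp 2 (Eu d × Eu d) => p.snd := WithLp.prod_continuous_ofLp 2 _ _ |>.snd
  refine IsClosed.measurableSet ?_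
  exact (isClosed_eq h1.norm continuous_const).inter
    ((isClosed_eq h2.norm continuous_const).inter (isClosed_eq (h1.sub h2).norm continuous_const))

/-- The diagonal action of a linear isometry is a surjective isometry of the L² product, so it
preserves Hausdorff measure, and it preserves the three lengths that define the manifold. -/
lemma isTriangleInvariant_pairMeasure (d : ℕ) :
    IsTriangleInvariant (pairMeasure d) where
  finite := by
    rw [pairMeasure]; infer_instance
  map_eq u := by
    have hiso : Isometry (WithLp.map 2 (Prod.map u u) :
        WithLp 2 (Eu d × Eu d) → WithLp 2 (Eu d × Eu d)) :=
      Isometry.withLpProdMap 2 u.isometry u.isometry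
    have hsurj : Function.Surjective (WithLp.map 2 (Prod.map u u) :
        WithLp 2 (Eu d × Eu d) → WithLp 2 (Eu d × Eu d)) := by
      intro p
      refine ⟨WithLp.toLp 2 (u.symm p.fst, u.symm p.snd), ?_⟩
      apply (WithLp.ofLp_injective 2)
      change (u (u.symm p.fst), u (u.symm p.snd)) = (p.fst, p.snd)
      simp
    have hpre : (WithLp.map 2 (Prod.map u u)) ⁻¹' (triangleManifold d) = triangleManifold d := by
      ext p
      simp only [triangleManifold, Set.mem_preimage, Set.mem_ofPred_eq]
      have e1 : (WithLp.map 2 (Prod.map u u) p).fst = u p.fst := rfl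
      have e2 : (WithLp.map 2 (Prod.map u u) p).snd = u p.snd := rfl
      rw [e1, e2, ← map_sub, u.norm_map, u.norm_map, u.norm_map]
    have hmeas : Measurable (WithLp.map 2 (Prod.map u u) :
        WithLp 2 (Eu d × Eu d) → WithLp 2 (Eu d × Eu d)) := hiso.continuous.measurable
    have key : (triangleMeasure d).map (WithLp.map 2 (Prod.map u u)) = triangleMeasure d := by
      rw [triangleMeasure, Measure.map_smul]
      congr 1
      nth_rw 1 [← hpre]
      rw [← Measure.restrict_map hmeas (measurableSet_triangleManifold d),
        hiso.map_hausdorffMeasure (Or.inr hsurj), hsurj.range_eq, Measure.restrict_univ]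
    have hm2 : Measurable (Prod.map u u : Eu d × Eu d → Eu d × Eu d) :=
      (u.continuous.prodMap u.continuous).measurable
    rw [pairMeasure, Measure.map_map hm2 (pairEquiv d).measurable]
    nth_rw 2 [← key]
    rw [Measure.map_map (pairEquiv d).measurable hmeas]
    rfl
  supp := by
    rw [pairMeasure, (pairEquiv d).measurableEmbedding.ae_map_iff]
    refine Measure.ae_smul_measure ?_ _
    filter_upwards [ae_restrict_mem (measurableSet_triangleManifold d)] with p hp
    exact hp

/-- This symmetry reduces the frequency region |η| < |ξ| to |ξ| ≤ |η|. -/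
lemma IsTriangleInvariant.swap {d : ℕ} {ν : Measure (Eu d × Eu d)} (h : IsTriangleInvariant ν) :
    IsTriangleInvariant (ν.map Prod.swap) where
  finite := by have := h.finite; infer_instance
  map_eq u := by
    have hm2 : Measurable (Prod.map u u : Eu d × Eu d → Eu d × Eu d) :=
      (u.continuous.prodMap u.continuous).measurable
    rw [Measure.map_map hm2 measurable_swap]
    nth_rw 2 [← h.map_eq u]
    rw [Measure.map_map measurable_swap hm2]
    rfl
  supp := by
    rw [show (Prod.swap : Eu d × Eu d → Eu d × Eu d) = MeasurableEquiv.prodComm from rfl,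
      MeasurableEquiv.prodComm.measurableEmbedding.ae_map_iff]
    filter_upwards [h.supp] with p hp
    refine ⟨hp.2.1, hp.1, ?_⟩
    rw [← hp.2.2, norm_sub_rev]; rfl

/-! ### Uniqueness of the invariant measure on triangles -/

/-- Every compact group carries a bi-invariant probability measure. -/
lemma exists_biinvariant_probabilityMeasure (G : Type*) [Group G] [TopologicalSpace G]
    [IsTopologicalGroup G] [CompactSpace G] [MeasurableSpace G] [BorelSpace G] :
    ∃ μ : Measure G, IsProbabilityMeasure μ ∧ μ.IsMulLeftInvariant ∧ μ.IsMulRightInvariant := by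
  let μ : Measure G := Measure.haarMeasure ⊤
  have h1 : IsProbabilityMeasure μ := ⟨by
    have := Measure.haarMeasure_self (K₀ := (⊤ : TopologicalSpace.PositiveCompacts G))
    simpa using this⟩
  -- A right translate of μ is again a left-invariant probability measure, hence a multiple of μ;
  -- comparing total masses shows that the factor is 1.
  refine ⟨μ, h1, inferInstance, ⟨fun g => ?_⟩⟩
  have hl : (μ.map (· * g)).IsMulLeftInvariant := by
    infer_instance
  have hp : IsProbabilityMeasure (μ.map (· * g)) :=
    Measure.isProbabilityMeasure_map (measurable_mul_const g).aemeasurable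
  have := Measure.isMulInvariant_eq_smul_of_compactSpace (μ.map (· * g)) μ
  have h2 := congrArg (fun m : Measure G => m Set.univ) this
  simp only [measure_univ, Measure.smul_apply] at h2
  rw [this]
  rw [ENNReal.smul_def, smul_eq_mul, mul_one] at h2
  rw [ENNReal.smul_def, ← h2, one_smul]

/-- The orthogonal group as a topological group. -/
noncomputable abbrev OrthGroup (d : ℕ) := unitary (Eu d →L[ℝ] Eu d)

instance continuousStar_euclidean (d : ℕ) : ContinuousStar (Eu d →L[ℝ] Eu d) :=
  ⟨(ContinuousLinearMap.adjoint (𝕜 := ℝ) (E := Eu d) (F := Eu d)).continuous⟩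

instance compactSpace_orthGroup (d : ℕ) : CompactSpace (OrthGroup d) := by
  refine isCompact_iff_compactSpace.mp ?_
  have : ProperSpace (Eu d →L[ℝ] Eu d) := FiniteDimensional.proper ℝ _
  refine Metric.isCompact_of_isClosed_isBounded isClosed_unitary ?_
  refine (Metric.isBounded_closedBall (x := (0 : Eu d →L[ℝ] Eu d)) (r := 1)).subset fun u hu => ?_
  rw [mem_closedBall_zero_iff]
  exact ContinuousLinearMap.opNorm_le_bound _ zero_le_one fun x => by
    rw [u.norm_map_of_mem_unitary hu, one_mul]

/-- A linear isometry as an element of the orthogonal group. -/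
noncomputable def LinearIsometryEquiv.toOrthGroup {d : ℕ} (u : Eu d ≃ₗᵢ[ℝ] Eu d) : OrthGroup d :=
  Unitary.linearIsometryEquiv.symm u

@[simp] lemma LinearIsometryEquiv.coe_toOrthGroup {d : ℕ} (u : Eu d ≃ₗᵢ[ℝ] Eu d) (x : Eu d) :
    (u.toOrthGroup : Eu d →L[ℝ] Eu d) x = u x := rfl

/-- An element of the orthogonal group as a linear isometry. -/
noncomputable def orthIsometry {d : ℕ} (g : OrthGroup d) : Eu d ≃ₗᵢ[ℝ] Eu d :=
  Unitary.linearIsometryEquiv g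

lemma continuous_orth_apply {d : ℕ} :
    Continuous fun q : OrthGroup d × Eu d => (q.1 : Eu d →L[ℝ] Eu d) q.2 :=
  (continuous_subtype_val.comp continuous_fst).clm_apply continuous_snd

lemma continuous_orth_apply_const {d : ℕ} (x : Eu d) :
    Continuous fun g : OrthGroup d => (g : Eu d →L[ℝ] Eu d) x :=
  continuous_subtype_val.clm_apply continuous_const

lemma coe_orth_mul {d : ℕ} (g h : OrthGroup d) (x : Eu d) :
    ((g * h : OrthGroup d) : Eu d →L[ℝ] Eu d) x = (g : Eu d →L[ℝ] Eu d) ((h : Eu d →L[ℝ] Eu d) x) :=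
  rfl

/-- Linear isometries act transitively on equilateral triangles. -/
lemma exists_isometry_triangle {d : ℕ} {y z y' z' : Eu d} (hy : ‖y‖ = 1) (hz : ‖z‖ = 1)
    (hyz : ‖y - z‖ = 1) (hy' : ‖y'‖ = 1) (hz' : ‖z'‖ = 1) (hyz' : ‖y' - z'‖ = 1) :
    ∃ u : Eu d ≃ₗᵢ[ℝ] Eu d, u y = y' ∧ u z = z' := by
  -- Two reflections suffice: r₁ moves y to y', and r₂ moves r₁ z to z'. The latter fixes y' because
  -- the side lengths force ⟪y', r₁ z⟫ = ⟪y', z'⟫.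
  let r₁ := (ℝ ∙ (y - y'))ᗮ.reflection
  have h₁ : r₁ y = y' := Submodule.reflection_sub (hy.trans hy'.symm)
  let r₂ := (ℝ ∙ (r₁ z - z'))ᗮ.reflection
  have h₂ : r₂ (r₁ z) = z' := Submodule.reflection_sub (by rw [r₁.norm_map, hz, hz'])
  have hin : inner ℝ y' (r₁ z) = inner ℝ y' z' := by
    have e1 : ‖y' - r₁ z‖ = 1 := by rw [← h₁, ← map_sub, r₁.norm_map, hyz]
    have e2 := norm_sub_sq_real y' (r₁ z)
    have e3 := norm_sub_sq_real y' z'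
    rw [e1, hy', r₁.norm_map, hz] at e2
    rw [hyz', hy', hz'] at e3
    linarith
  have h₃ : r₂ y' = y' := by
    apply Submodule.reflection_mem_subspace_eq_self
    rw [Submodule.mem_orthogonal_singleton_iff_inner_left, inner_sub_right, hin, sub_self]
  exact ⟨r₁.trans r₂, by simp [h₁, h₃], by simp [h₂]⟩

/-- By invariance ν s may be averaged over g. After exchanging the integrals, the inner integral
over g is the same for every triangle p: write p = (u y, u z) with an isometry u and absorb u by
right translation. -/
lemma IsTriangleInvariant.eq_smul_map {d : ℕ} {ν : Measure (Eu d × Eu d)}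
    (hν : IsTriangleInvariant ν) (μ : Measure (OrthGroup d)) [IsProbabilityMeasure μ]
    [μ.IsMulRightInvariant] {y z : Eu d} (hy : ‖y‖ = 1) (hz : ‖z‖ = 1) (hyz : ‖y - z‖ = 1) :
    ν = ν Set.univ • μ.map
      (fun g : OrthGroup d => ((g : Eu d →L[ℝ] Eu d) y, (g : Eu d →L[ℝ] Eu d) z)) := by
  have := hν.finite
  have hact : Continuous fun q : OrthGroup d × (Eu d × Eu d) =>
      ((q.1 : Eu d →L[ℝ] Eu d) q.2.1, (q.1 : Eu d →L[ℝ] Eu d) q.2.2) :=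
    (continuous_orth_apply.comp (continuous_fst.prodMk continuous_snd.fst)).prodMk
      (continuous_orth_apply.comp (continuous_fst.prodMk continuous_snd.snd))
  have horb : ∀ y z : Eu d, Continuous
      fun g : OrthGroup d => ((g : Eu d →L[ℝ] Eu d) y, (g : Eu d →L[ℝ] Eu d) z) := fun y z =>
    (continuous_orth_apply_const y).prodMk (continuous_orth_apply_const z)
  ext s hs
  have h1 : ∀ g : OrthGroup d, ν s = ∫⁻ p, s.indicator 1
      ((g : Eu d →L[ℝ] Eu d) p.1, (g : Eu d →L[ℝ] Eu d) p.2) ∂ν := by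
    intro g
    have hm2 : Measurable (Prod.map (orthIsometry g) (orthIsometry g) : Eu d × Eu d → Eu d × Eu d) :=
      ((orthIsometry g).continuous.prodMap (orthIsometry g).continuous).measurable
    conv_lhs => rw [← hν.map_eq (orthIsometry g), ← lintegral_indicator_one hs]
    rw [lintegral_map (measurable_one.indicator hs) hm2]
    rfl
  have h2 : ν s = ∫⁻ g, ∫⁻ p, s.indicator 1
      ((g : Eu d →L[ℝ] Eu d) p.1, (g : Eu d →L[ℝ] Eu d) p.2) ∂ν ∂μ := by
    rw [← lintegral_congr h1]; simp
  have hmeas : Measurable fun q : OrthGroup d × (Eu d × Eu d) => s.indicator (1 : Eu d × Eu d → ℝ≥0∞)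
      ((q.1 : Eu d →L[ℝ] Eu d) q.2.1, (q.1 : Eu d →L[ℝ] Eu d) q.2.2) :=
    (measurable_one.indicator hs).comp hact.measurable
  rw [lintegral_lintegral_swap hmeas.aemeasurable] at h2
  rw [h2, Measure.smul_apply, smul_eq_mul, mul_comm, ← lintegral_const]
  refine lintegral_congr_ae ?_
  filter_upwards [hν.supp] with p hp
  obtain ⟨u, hu1, hu2⟩ := exists_isometry_triangle hy hz hyz hp.1 hp.2.1 hp.2.2
  rw [← lintegral_indicator_one hs,
    lintegral_map (measurable_one.indicator hs) (horb y z).measurable]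
  conv_rhs => rw [← lintegral_mul_right_eq_self _ u.toOrthGroup]
  simp only [coe_orth_mul, LinearIsometryEquiv.coe_toOrthGroup, hu1, hu2]

/-- The stabilizer of a point in the orthogonal group. -/
noncomputable def orthStabilizer {d : ℕ} (y : Eu d) : Subgroup (OrthGroup d) where
  carrier := {g | (g : Eu d →L[ℝ] Eu d) y = y}
  mul_mem' {a b} ha hb := by
    change ((a * b : OrthGroup d) : Eu d →L[ℝ] Eu d) y = y
    rw [coe_orth_mul, show (b : Eu d →L[ℝ] Eu d) y = y from hb, show (a : Eu d →L[ℝ] Eu d) y = y from ha]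
  one_mem' := rfl
  inv_mem' {a} ha := by
    change ((a⁻¹ : OrthGroup d) : Eu d →L[ℝ] Eu d) y = y
    have h : (a : Eu d →L[ℝ] Eu d) y = y := ha
    conv_lhs => rw [← h]
    rw [← coe_orth_mul, inv_mul_cancel]
    rfl

lemma mem_orthStabilizer {d : ℕ} {y : Eu d} {g : OrthGroup d} :
    g ∈ orthStabilizer y ↔ (g : Eu d →L[ℝ] Eu d) y = y := Iff.rfl

instance compactSpace_orthStabilizer {d : ℕ} (y : Eu d) : CompactSpace (orthStabilizer y) :=
  isCompact_iff_compactSpace.mp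
    (isClosed_eq (continuous_orth_apply_const y) continuous_const).isCompact

/-- The coordinate unit vector. -/
noncomputable abbrev unitVec {d : ℕ} (i : Fin d) : Eu d := EuclideanSpace.single i (1 : ℝ)

/-- The data of a random rotation and of a random unit vector orthogonal to the `i₀`-th axis that
together describe all invariant measures on the triangle manifold. -/
structure IsTriangleModel {d : ℕ} (i₀ : Fin d) (μ : Measure (OrthGroup d)) (σ : Measure (Eu d)) :
    Prop where
  prob_left : IsProbabilityMeasure μ
  prob_right : IsProbabilityMeasure σ
  left_inv : μ.IsMulLeftInvariant
  supp : ∀ᵐ ω ∂σ, ‖ω‖ = 1 ∧ ω i₀ = 0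
  map_eq : ∀ u : Eu d ≃ₗᵢ[ℝ] Eu d, u (unitVec i₀) = unitVec i₀ → σ.map u = σ
  rep : ∀ ν : Measure (Eu d × Eu d), IsTriangleInvariant ν →
    ν = ν Set.univ • (μ.prod σ).map (fun q => ((q.1 : Eu d →L[ℝ] Eu d) (unitVec i₀),
      (q.1 : Eu d →L[ℝ] Eu d) ((1 / 2 : ℝ) • unitVec i₀ + (√3 / 2 : ℝ) • q.2)))

/-- Here ω is the image of a second coordinate vector e₁ under a Haar random element h of the
stabilizer of the axis e₀. The orbit formula for the triangle with vertices e₀ and e₀/2 + (√3/2) e₁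
does not change when g is replaced by g h, which fixes e₀ and turns e₁ into h e₁; averaging over h
gives the product form. -/
lemma exists_isTriangleModel {d : ℕ} {i₀ i₁ : Fin d} (hi : i₁ ≠ i₀) :
    ∃ (μ : Measure (OrthGroup d)) (σ : Measure (Eu d)), IsTriangleModel i₀ μ σ := by
  obtain ⟨μ, hμ, hμl, hμr⟩ := exists_biinvariant_probabilityMeasure (OrthGroup d)
  obtain ⟨κ, hκ, hκl, hκr⟩ := exists_biinvariant_probabilityMeasure (orthStabilizer (unitVec i₀))
  let w : orthStabilizer (unitVec i₀) → Eu d := fun h => (h.1 : Eu d →L[ℝ] Eu d) (unitVec i₁)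
  have hw : Continuous w := (continuous_orth_apply_const _).comp continuous_subtype_val
  have h10 : inner ℝ (unitVec i₀) (unitVec i₁) = 0 := by
    simp [EuclideanSpace.inner_single_left, hi.symm]
  refine ⟨μ, κ.map w, hμ, Measure.isProbabilityMeasure_map hw.aemeasurable, hμl, ?_, ?_, ?_⟩
  · rw [ae_map_iff hw.aemeasurable]
    · refine Eventually.of_forall fun h => ⟨?_, ?_⟩
      · change ‖(h.1 : Eu d →L[ℝ] Eu d) (unitVec i₁)‖ = 1
        rw [Unitary.norm_map]; simp
      · have h2 := Unitary.inner_map_map h.1 (unitVec i₀) (unitVec i₁)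
        rw [mem_orthStabilizer.mp h.2, h10] at h2
        simpa [EuclideanSpace.inner_single_left] using h2
    · refine IsClosed.measurableSet ?_
      exact (isClosed_eq continuous_norm continuous_const).inter
        (isClosed_eq (by fun_prop) continuous_const)
  · intro u hu
    rw [Measure.map_map u.continuous.measurable hw.measurable]
    have hm : u.toOrthGroup ∈ orthStabilizer (unitVec i₀) := hu
    conv_rhs => rw [← map_mul_left_eq_self κ ⟨_, hm⟩]
    rw [Measure.map_map hw.measurable (measurable_const_mul _)]
    rfl
  · intro ν hν
    have hz0 : ∀ w : Eu d, ‖w‖ = 1 → inner ℝ (unitVec i₀) w = 0 →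
        ‖(1 / 2 : ℝ) • unitVec i₀ + (√3 / 2 : ℝ) • w‖ = 1 ∧
        ‖unitVec i₀ - ((1 / 2 : ℝ) • unitVec i₀ + (√3 / 2 : ℝ) • w)‖ = 1 := by
      intro w hw hw0
      have h3 : √3 * √3 = 3 := Real.mul_self_sqrt (by norm_num)
      have e0 : ‖(unitVec i₀ : Eu d)‖ = 1 := by simp
      constructor
      · rw [← sq_eq_sq₀ (norm_nonneg _) zero_le_one, norm_add_sq_real, norm_smul, norm_smul,
          inner_smul_left, inner_smul_right, hw0, hw, e0]
        simp only [Real.norm_eq_abs, mul_pow, sq_abs]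
        nlinarith
      · rw [show unitVec i₀ - ((1 / 2 : ℝ) • unitVec i₀ + (√3 / 2 : ℝ) • w) =
          (1 / 2 : ℝ) • unitVec i₀ - (√3 / 2 : ℝ) • w by module]
        rw [← sq_eq_sq₀ (norm_nonneg _) zero_le_one, norm_sub_sq_real, norm_smul, norm_smul,
          inner_smul_left, inner_smul_right, hw0, hw, e0]
        simp only [Real.norm_eq_abs, mul_pow, sq_abs]
        nlinarith
    obtain ⟨ha, hb⟩ := hz0 (unitVec i₁) (by simp) h10
    have h := hν.eq_smul_map μ (y := unitVec i₀) (by simp) ha hb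
    conv_lhs => rw [h]
    congr 1
    have hF : Measurable fun q : OrthGroup d × Eu d => ((q.1 : Eu d →L[ℝ] Eu d) (unitVec i₀),
      (q.1 : Eu d →L[ℝ] Eu d) ((1 / 2 : ℝ) • unitVec i₀ + (√3 / 2 : ℝ) • q.2)) := by
      refine Continuous.measurable ?_
      exact ((continuous_orth_apply_const _).comp continuous_fst).prodMk
        (continuous_orth_apply.comp (continuous_fst.prodMk
          ((continuous_const (y := (1 / 2 : ℝ) • unitVec i₀)).add
            (continuous_snd.const_smul (√3 / 2 : ℝ)))))
    ext s hs
    rw [Measure.map_apply hF hs, Measure.prod_apply_symm (hF hs), lintegral_map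
      (measurable_measure_prodMk_right (hF hs)) hw.measurable]
    have key : ∀ h : orthStabilizer (unitVec i₀), μ ((fun x => (x, w h)) ⁻¹'
        ((fun q : OrthGroup d × Eu d => ((q.1 : Eu d →L[ℝ] Eu d) (unitVec i₀),
          (q.1 : Eu d →L[ℝ] Eu d) ((1 / 2 : ℝ) • unitVec i₀ + (√3 / 2 : ℝ) • q.2))) ⁻¹' s)) =
        μ.map (fun g : OrthGroup d => ((g : Eu d →L[ℝ] Eu d) (unitVec i₀),
          (g : Eu d →L[ℝ] Eu d) ((1 / 2 : ℝ) • unitVec i₀ + (√3 / 2 : ℝ) • unitVec i₁))) s := by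
      intro h
      rw [Measure.map_apply ((continuous_orth_apply_const _).prodMk
        (continuous_orth_apply_const _)).measurable hs]
      conv_rhs => rw [← measure_preimage_mul_right μ h.1]
      congr 1
      ext g
      simp only [Set.mem_preimage, coe_orth_mul, map_add, map_smul, mem_orthStabilizer.mp h.2, w]
    rw [lintegral_congr key]
    simp

/-! ### Equatorial measures: Bessel equation and Fourier decay -/

/-- A probability measure on the unit sphere of the hyperplane `x i₀ = 0` that is invariant under
the isometries fixing the `i₀`-th axis. -/
structure IsEquatorial {d : ℕ} (i₀ : Fin d) (σ : Measure (Eu d)) : Prop where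
  prob : IsProbabilityMeasure σ
  supp : ∀ᵐ ω ∂σ, ‖ω‖ = 1 ∧ ω i₀ = 0
  map_eq : ∀ u : Eu d ≃ₗᵢ[ℝ] Eu d, u (unitVec i₀) = unitVec i₀ → σ.map u = σ

lemma IsTriangleModel.isEquatorial {d : ℕ} {i₀ : Fin d} {μ : Measure (OrthGroup d)}
    {σ : Measure (Eu d)} (h : IsTriangleModel i₀ μ σ) : IsEquatorial i₀ σ :=
  ⟨h.prob_right, h.supp, h.map_eq⟩

namespace IsEquatorial

variable {d : ℕ} {i₀ i₁ : Fin d} {σ : Measure (Eu d)}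

lemma integral_comp_isometry (h : IsEquatorial i₀ σ) {X : Type*} [NormedAddCommGroup X]
    [NormedSpace ℝ X] (u : Eu d ≃ₗᵢ[ℝ] Eu d) (hu : u (unitVec i₀) = unitVec i₀) (F : Eu d → X) :
    ∫ ω, F (u ω) ∂σ = ∫ ω, F ω ∂σ := by
  conv_rhs => rw [← h.map_eq u hu]
  exact (integral_map_equiv u.toHomeomorph.toMeasurableEquiv F).symm

/-- The law of `⟪ζ, ω⟫` depends only on the length of `ζ`. -/
lemma integral_inner_congr (h : IsEquatorial i₀ σ) {X : Type*} [NormedAddCommGroup X]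
    [NormedSpace ℝ X] {ζ ζ' : Eu d} (hζ : ζ i₀ = 0) (hζ' : ζ' i₀ = 0) (hn : ‖ζ‖ = ‖ζ'‖)
    (F : ℝ → X) : ∫ ω, F (inner ℝ ζ ω) ∂σ = ∫ ω, F (inner ℝ ζ' ω) ∂σ := by
  let u := (ℝ ∙ (ζ' - ζ))ᗮ.reflection
  have hu : u ζ' = ζ := Submodule.reflection_sub hn.symm
  rw [← h.integral_comp_isometry u]
  · simp_rw [← hu, u.inner_map_map]
  · apply Submodule.reflection_mem_subspace_eq_self
    rw [Submodule.mem_orthogonal_singleton_iff_inner_left]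
    simp [EuclideanSpace.inner_single_left, hζ, hζ']

/-- The reflection along f preserves σ, since f is orthogonal to the axis; it fixes ⟪e, ω⟫ and
changes the sign of ⟪f, ω⟫. -/
lemma integral_inner_mul_inner_eq_zero (h : IsEquatorial i₀ σ) {e f : Eu d}
    (hf : f i₀ = 0) (hef : inner ℝ e f = 0) (F : ℝ → ℝ) :
    ∫ ω, inner ℝ f ω * F (inner ℝ e ω) ∂σ = 0 := by
  let u := (ℝ ∙ f)ᗮ.reflection
  have h1 : u f = -f := Submodule.reflection_orthogonalComplement_singleton_eq_neg f
  have h2 : u e = e := by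
    apply Submodule.reflection_mem_subspace_eq_self
    rwa [Submodule.mem_orthogonal_singleton_iff_inner_left]
  have h3 : u (unitVec i₀) = unitVec i₀ := by
    apply Submodule.reflection_mem_subspace_eq_self
    rw [Submodule.mem_orthogonal_singleton_iff_inner_left]
    simp [EuclideanSpace.inner_single_left, hf]
  have h4 := h.integral_comp_isometry u h3 fun ω => inner ℝ f ω * F (inner ℝ e ω)
  have h5 : ∀ ω, inner ℝ f (u ω) * F (inner ℝ e (u ω)) = -(inner ℝ f ω * F (inner ℝ e ω)) := by
    intro ω
    rw [show inner ℝ e (u ω) = inner ℝ e ω by rw [← u.inner_map_map e ω, h2],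
      show inner ℝ f (u ω) = -inner ℝ f ω by rw [← u.inner_map_map f ω, h1, inner_neg_left, neg_neg]]
    ring
  simp_rw [h5, integral_neg] at h4
  linarith

lemma ae_abs_le (h : IsEquatorial i₀ σ) : ∀ᵐ ω ∂σ, ∀ i, |ω i| ≤ 1 := by
  filter_upwards [h.supp] with ω hω i
  rw [← hω.1, ← Real.norm_eq_abs]
  exact PiLp.norm_apply_le ω i

lemma integrable_of_bound (h : IsEquatorial i₀ σ) {X : Type*} [NormedAddCommGroup X]
    {F : Eu d → X} (hF : Continuous F) [SecondCountableTopology X] (C : ℝ)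
    (hC : ∀ ω : Eu d, (∀ i, |ω i| ≤ 1) → ‖F ω‖ ≤ C) :
    Integrable F σ := by
  have := h.prob
  refine Integrable.of_bound hF.stronglyMeasurable.aestronglyMeasurable C ?_
  filter_upwards [h.ae_abs_le] with ω hω using hC ω hω

lemma hasDerivAt_integral (h : IsEquatorial i₀ σ) {F F' : ℝ → Eu d → ℝ}
    (hF : ∀ r, Continuous (F r)) (hF' : ∀ r, Continuous (F' r)) (C : ℝ → ℝ) (C' : ℝ)
    (hC : ∀ r, ∀ ω : Eu d, (∀ i, |ω i| ≤ 1) → |F r ω| ≤ C r)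
    (hC' : ∀ r, ∀ ω : Eu d, (∀ i, |ω i| ≤ 1) → |F' r ω| ≤ C')
    (hd : ∀ r ω, HasDerivAt (fun r => F r ω) (F' r ω) r) (r : ℝ) :
    HasDerivAt (fun r => ∫ ω, F r ω ∂σ) (∫ ω, F' r ω ∂σ) r := by
  have := h.prob
  refine (hasDerivAt_integral_of_dominated_loc_of_deriv_le (bound := fun _ => C')
    (Metric.ball_mem_nhds r one_pos)
    (Eventually.of_forall fun r => (hF r).stronglyMeasurable.aestronglyMeasurable)
    (h.integrable_of_bound (hF r) (C r) (hC r)) (hF' r).stronglyMeasurable.aestronglyMeasurable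
    ?_ (integrable_const _) (Eventually.of_forall fun ω r _ => hd r ω)).2
  filter_upwards [h.ae_abs_le] with ω hω r _ using hC' r ω hω

lemma hasDerivAt_integral_cos (h : IsEquatorial i₀ σ) (r : ℝ) :
    HasDerivAt (fun r => ∫ ω, Real.cos (r * ω i₁) ∂σ) (-∫ ω, ω i₁ * Real.sin (r * ω i₁) ∂σ) r := by
  rw [← integral_neg]
  refine h.hasDerivAt_integral (F := fun r ω => Real.cos (r * ω i₁))
    (F' := fun r ω => -(ω i₁ * Real.sin (r * ω i₁))) (by fun_prop) (by fun_prop) (fun _ => 1) 1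
    (fun r ω _ => Real.abs_cos_le_one _) (fun r ω hω => ?_) (fun r ω => ?_) r
  · rw [abs_neg, abs_mul]
    exact mul_le_one₀ (hω _) (abs_nonneg _) (Real.abs_sin_le_one _)
  · have := ((hasDerivAt_id r).mul_const (ω i₁)).cos
    simp only [id] at this
    convert! this using 1
    ring

lemma hasDerivAt_integral_sin (h : IsEquatorial i₀ σ) (r : ℝ) :
    HasDerivAt (fun r => ∫ ω, ω i₁ * Real.sin (r * ω i₁) ∂σ)
      (∫ ω, ω i₁ ^ 2 * Real.cos (r * ω i₁) ∂σ) r := by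
  refine h.hasDerivAt_integral (F := fun r ω => ω i₁ * Real.sin (r * ω i₁))
    (F' := fun r ω => ω i₁ ^ 2 * Real.cos (r * ω i₁)) (by fun_prop) (by fun_prop) (fun _ => 1) 1
    (fun r ω hω => ?_) (fun r ω hω => ?_) (fun r ω => ?_) r
  · rw [abs_mul]
    exact mul_le_one₀ (hω _) (abs_nonneg _) (Real.abs_sin_le_one _)
  · rw [abs_mul, abs_pow]
    exact mul_le_one₀ (pow_le_one₀ (abs_nonneg _) (hω _)) (abs_nonneg _) (Real.abs_cos_le_one _)
  · have := (((hasDerivAt_id r).mul_const (ω i₁)).sin).const_mul (ω i₁)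
    simp only [id] at this
    convert! this using 1
    ring

/-- An integration by parts on the sphere that uses only invariance: rotate the pair of i₁-th and
i-th unit vectors in its plane to e_θ, f_θ. The integral of ⟪f_θ, ω⟫ sin(r⟪e_θ, ω⟫) vanishes for
every θ, and its derivative at θ = 0 is the difference of the two sides. -/
lemma integral_sq_mul_cos (h : IsEquatorial i₀ σ) (hi : i₁ ≠ i₀) {i : Fin d} (h0 : i ≠ i₀)
    (h1 : i ≠ i₁) (r : ℝ) :
    r * ∫ ω, ω i ^ 2 * Real.cos (r * ω i₁) ∂σ = ∫ ω, ω i₁ * Real.sin (r * ω i₁) ∂σ := by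
  let G : ℝ → Eu d → ℝ := fun θ ω => (-Real.sin θ * ω i₁ + Real.cos θ * ω i) *
    Real.sin (r * (Real.cos θ * ω i₁ + Real.sin θ * ω i))
  let G' : ℝ → Eu d → ℝ := fun θ ω => (-Real.cos θ * ω i₁ + -Real.sin θ * ω i) *
    Real.sin (r * (Real.cos θ * ω i₁ + Real.sin θ * ω i)) +
    (-Real.sin θ * ω i₁ + Real.cos θ * ω i) *
    (Real.cos (r * (Real.cos θ * ω i₁ + Real.sin θ * ω i)) *
      (r * (-Real.sin θ * ω i₁ + Real.cos θ * ω i)))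
  have b : ∀ a c x y : ℝ, |a| ≤ 1 → |c| ≤ 1 → |x| ≤ 1 → |y| ≤ 1 → |a * x + c * y| ≤ 2 := by
    intro a c x y ha hc hx hy
    calc |a * x + c * y| ≤ |a * x| + |c * y| := abs_add_le _ _
      _ = |a| * |x| + |c| * |y| := by rw [abs_mul, abs_mul]
      _ ≤ 1 * 1 + 1 * 1 := by gcongr
      _ = 2 := by norm_num
  have hs : ∀ θ, |(-Real.sin θ)| ≤ 1 := fun θ => by rw [abs_neg]; exact Real.abs_sin_le_one θ
  have hc : ∀ θ, |(-Real.cos θ)| ≤ 1 := fun θ => by rw [abs_neg]; exact Real.abs_cos_le_one θ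
  have hG : ∀ θ, ∫ ω, G θ ω ∂σ = 0 := by
    intro θ
    have := h.integral_inner_mul_inner_eq_zero (σ := σ)
      (e := Real.cos θ • unitVec i₁ + Real.sin θ • unitVec i)
      (f := (-Real.sin θ) • unitVec i₁ + Real.cos θ • unitVec i) (by simp [h0.symm, hi.symm])
      (by
        simp only [inner_add_left, inner_add_right, inner_smul_left, inner_smul_right,
          EuclideanSpace.inner_single_left]
        simp [h1, h1.symm]; ring) (fun x => Real.sin (r * x))
    simpa [inner_add_left, inner_smul_left, EuclideanSpace.inner_single_left, G] using this
  have hd : HasDerivAt (fun θ => ∫ ω, G θ ω ∂σ) (∫ ω, G' 0 ω ∂σ) 0 := by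
    refine h.hasDerivAt_integral (F := G) (F' := G') (by intro; fun_prop) (by intro; fun_prop)
      (fun _ => 2) (2 + 2 * (|r| * 2)) (fun θ ω hω => ?_) (fun θ ω hω => ?_) (fun θ ω => ?_) 0
    · simp only [G]
      rw [abs_mul]
      calc _ ≤ 2 * (1 : ℝ) := mul_le_mul (b _ _ _ _ (hs θ) (Real.abs_cos_le_one θ) (hω _) (hω _))
            (Real.abs_sin_le_one _) (abs_nonneg _) (by norm_num)
        _ = 2 := by norm_num
    · simp only [G']
      have b1 := b _ _ _ _ (hs θ) (Real.abs_cos_le_one θ) (hω i₁) (hω i)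
      have b2 := b _ _ _ _ (hc θ) (hs θ) (hω i₁) (hω i)
      refine (abs_add_le _ _).trans (add_le_add ?_ ?_)
      · rw [abs_mul]
        calc _ ≤ 2 * (1 : ℝ) := mul_le_mul b2 (Real.abs_sin_le_one _) (abs_nonneg _) (by norm_num)
          _ = 2 := by norm_num
      · rw [abs_mul, abs_mul, abs_mul]
        have b3 := Real.abs_cos_le_one (r * (Real.cos θ * ω i₁ + Real.sin θ * ω i))
        calc _ ≤ 2 * (1 * (|r| * 2)) := by gcongr
          _ = _ := by ring
    · have e1 : HasDerivAt (fun θ => -Real.sin θ * ω i₁ + Real.cos θ * ω i)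
          (-Real.cos θ * ω i₁ + -Real.sin θ * ω i) θ :=
        ((Real.hasDerivAt_sin θ).neg.mul_const _).add ((Real.hasDerivAt_cos θ).mul_const _)
      have e2 : HasDerivAt (fun θ => Real.cos θ * ω i₁ + Real.sin θ * ω i)
          (-Real.sin θ * ω i₁ + Real.cos θ * ω i) θ :=
        ((Real.hasDerivAt_cos θ).mul_const _).add ((Real.hasDerivAt_sin θ).mul_const _)
      exact e1.mul (e2.const_mul r).sin
  have h0' : ∫ ω, G' 0 ω ∂σ = 0 := by
    refine hd.unique ?_
    simp_rw [hG]
    exact hasDerivAt_const _ _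
  have e : ∀ ω, G' 0 ω = r * (ω i ^ 2 * Real.cos (r * ω i₁)) - ω i₁ * Real.sin (r * ω i₁) := by
    intro ω; simp only [G', Real.cos_zero, Real.sin_zero]; ring_nf
  simp_rw [e] at h0'
  rw [integral_sub, integral_const_mul] at h0'
  · linarith
  · refine (h.integrable_of_bound (by fun_prop) 1 fun ω hω => ?_).const_mul _
    rw [Real.norm_eq_abs, abs_mul, abs_pow]
    exact mul_le_one₀ (pow_le_one₀ (abs_nonneg _) (hω _)) (abs_nonneg _) (Real.abs_cos_le_one _)
  · refine h.integrable_of_bound (by fun_prop) 1 fun ω hω => ?_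
    rw [Real.norm_eq_abs, abs_mul]
    exact mul_le_one₀ (hω _) (abs_nonneg _) (Real.abs_sin_le_one _)

/-- The Bessel differential equation satisfied by the Fourier transform of `σ`. -/
lemma bessel_ode (h : IsEquatorial i₀ σ) (hi : i₁ ≠ i₀) (r : ℝ) :
    r * ∫ ω, ω i₁ ^ 2 * Real.cos (r * ω i₁) ∂σ =
      r * (∫ ω, Real.cos (r * ω i₁) ∂σ) - ((d : ℝ) - 2) * ∫ ω, ω i₁ * Real.sin (r * ω i₁) ∂σ := by
  have hint : ∀ i, Integrable (fun ω : Eu d => ω i ^ 2 * Real.cos (r * ω i₁)) σ := fun i => by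
    refine h.integrable_of_bound (by fun_prop) 1 fun ω hω => ?_
    rw [Real.norm_eq_abs, abs_mul, abs_pow]
    exact mul_le_one₀ (pow_le_one₀ (abs_nonneg _) (hω _)) (abs_nonneg _) (Real.abs_cos_le_one _)
  -- On the support ∑ ωᵢ² = 1 and ω i₀ = 0. Besides i₁ this leaves d - 2 coordinates, whose
  -- integrals, multiplied by r, all equal the same sine integral.
  have hsum : ∑ i, ∫ ω, ω i ^ 2 * Real.cos (r * ω i₁) ∂σ = ∫ ω, Real.cos (r * ω i₁) ∂σ := by
    rw [← integral_finsetSum _ fun i _ => hint i]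
    refine integral_congr_ae ?_
    filter_upwards [h.supp] with ω hω
    have := EuclideanSpace.real_norm_sq_eq ω
    rw [hω.1] at this
    rw [← Finset.sum_mul, ← this]; ring
  have hz : ∫ ω, ω i₀ ^ 2 * Real.cos (r * ω i₁) ∂σ = 0 := by
    rw [← integral_zero (Eu d) ℝ]
    refine integral_congr_ae ?_
    filter_upwards [h.supp] with ω hω
    rw [hω.2]; ring
  have hrest : ∀ i ∈ (Finset.univ.erase i₀).erase i₁, r * ∫ ω, ω i ^ 2 * Real.cos (r * ω i₁) ∂σ =
      ∫ ω, ω i₁ * Real.sin (r * ω i₁) ∂σ := by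
    intro i hmem
    simp only [Finset.mem_erase, Finset.mem_univ, and_true] at hmem
    exact h.integral_sq_mul_cos hi hmem.2 hmem.1 r
  have hs2 := Finset.sum_congr rfl hrest
  rw [← Finset.mul_sum, Finset.sum_const] at hs2
  rw [← Finset.add_sum_erase _ _ (Finset.mem_univ i₀), hz, zero_add,
    ← Finset.add_sum_erase _ _ (Finset.mem_erase.mpr ⟨hi, Finset.mem_univ i₁⟩)] at hsum
  have hcard : ((((Finset.univ : Finset (Fin d)).erase i₀).erase i₁).card : ℝ) = (d : ℝ) - 2 := by
    rw [Finset.card_erase_of_mem (Finset.mem_erase.mpr ⟨hi, Finset.mem_univ i₁⟩),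
      Finset.card_erase_of_mem (Finset.mem_univ i₀), Finset.card_univ, Fintype.card_fin]
    have h2 : 2 ≤ d := by
      have a0 := i₀.2; have a1 := i₁.2
      have : (i₁ : ℕ) ≠ i₀ := fun e => hi (Fin.ext e)
      omega
    rw [Nat.sub_sub]; push_cast [Nat.cast_sub h2]; ring
  rw [nsmul_eq_mul, hcard] at hs2
  rw [← hsum, ← hs2]; ring

end IsEquatorial

/-- Decay of the solutions of the Bessel equation `r (j'' + j) = -m j'`, by an energy estimate. -/
lemma bessel_energy_bound (k : ℕ) {c s c₂ : ℝ → ℝ} (hc : ∀ r, HasDerivAt c (-s r) r)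
    (hs : ∀ r, HasDerivAt s (c₂ r) r) (hode : ∀ r, r * c₂ r = r * c r - (k + 2 : ℝ) * s r)
    (hc1 : ∀ r, |c r| ≤ 1) (hs1 : ∀ r, |s r| ≤ 1) :
    ∃ C : ℝ, 0 ≤ C ∧ ∀ r, 0 ≤ r → r ^ (k + 2) * (c r ^ 2 + s r ^ 2) ≤ C := by
  set m : ℝ := k + 2 with hm
  have hm2 : 2 ≤ m := by simp [hm]
  have hE : ∀ r, c r ^ 2 + s r ^ 2 ≤ 2 := fun r => by
    have h1 := (sq_le_one_iff_abs_le_one _).mpr (hc1 r)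
    have h2 := (sq_le_one_iff_abs_le_one _).mpr (hs1 r)
    linarith
  -- With m = k + 2 the derivative of r^m (c² + s²) is m r^{m-1} (c² - s²). Since (c s)' = c² - s² -
  -- m c s / r, the correction cancels this term and leaves H' = m r^k c s, smaller than the energy
  -- by a factor of order r⁻².
  let H : ℝ → ℝ := fun r => r ^ (k + 2) * (c r ^ 2 + s r ^ 2) - m * r ^ (k + 1) * (c r * s r)
  have hH : ∀ r, 0 < r → HasDerivAt H (m * r ^ k * (c r * s r)) r := by
    intro r hr
    have h1 := ((hasDerivAt_pow (k + 2) r).mul (((hc r).pow 2).add ((hs r).pow 2))).sub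
      (((hasDerivAt_pow (k + 1) r).const_mul m).mul ((hc r).mul (hs r)))
    convert! h1 using 1
    have hc2 : c₂ r = c r - m * s r / r := by
      field_simp
      linarith [hode r]
    simp only [Nat.cast_add, Nat.cast_one, Nat.cast_ofNat, Pi.add_apply, Pi.pow_apply,
      Nat.add_sub_cancel, Pi.mul_apply, show k + 2 - 1 = k + 1 from rfl, hc2]
    rw [show (k : ℝ) = m - 2 by rw [hm]; ring]
    field_simp
    ring
  -- The logarithmic derivative -m/r² of the extra factor absorbs H'. The sign needs (r + m) c s ≤ r
  -- (c² + s²), which holds as soon as r ≥ m.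
  let Q : ℝ → ℝ := fun r => H r * Real.exp (m / r)
  have hQ : ∀ r, 0 < r → HasDerivAt Q (m * r ^ k * (c r * s r) * Real.exp (m / r) +
      H r * (Real.exp (m / r) * (-m / r ^ 2))) r := by
    intro r hr
    have h2 : HasDerivAt (fun r : ℝ => m / r) (-m / r ^ 2) r := by
      have := (hasDerivAt_inv hr.ne').const_mul m
      convert! this using 1
      field_simp
    exact (hH r hr).mul h2.exp
  have hcs : ∀ r, |c r * s r| ≤ (c r ^ 2 + s r ^ 2) / 2 := fun r => by
    rw [abs_le]; constructor <;> nlinarith [sq_nonneg (c r + s r), sq_nonneg (c r - s r)]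
  have hanti : AntitoneOn Q (Set.Ici m) := by
    refine antitoneOn_of_deriv_nonpos (convex_Ici m) ?_ ?_ ?_
    · intro r hr
      exact (hQ r (by linarith [Set.mem_Ici.mp hr])).continuousAt.continuousWithinAt
    · intro r hr
      rw [interior_Ici] at hr
      exact (hQ r (by linarith [Set.mem_Ioi.mp hr])).differentiableAt.differentiableWithinAt
    · intro r hr
      rw [interior_Ici] at hr
      have hr1 : m < r := hr
      have hr0 : 0 < r := by linarith
      rw [(hQ r hr0).deriv]
      have e1 : m * r ^ k * (c r * s r) * Real.exp (m / r) +
          H r * (Real.exp (m / r) * (-m / r ^ 2)) =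
          Real.exp (m / r) * (m * r ^ k / r) *
            ((r + m) * (c r * s r) - r * (c r ^ 2 + s r ^ 2)) := by
        simp only [H]; field_simp; ring
      rw [e1]
      refine mul_nonpos_of_nonneg_of_nonpos (by positivity) ?_
      have h3 := (abs_le.mp (hcs r)).2
      nlinarith [sq_nonneg (c r), sq_nonneg (s r)]
  -- For r ≤ m the bound c² + s² ≤ 2 is enough; for r ≥ m half of r^m (c² + s²) is at most H r ≤ Q r
  -- ≤ Q m.
  refine ⟨m ^ (k + 2) * 2 + 2 * Q m, ?_, ?_⟩
  all_goals
    have hHlow : ∀ r, m ≤ r → r ^ (k + 2) * (c r ^ 2 + s r ^ 2) / 2 ≤ H r := by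
      intro r hr
      have h3 := (abs_le.mp (hcs r)).2
      have hr0 : 0 < r := by linarith
      simp only [H]
      have e2 : r ^ (k + 2) * (c r ^ 2 + s r ^ 2) - m * r ^ (k + 1) * (c r * s r) -
        r ^ (k + 2) * (c r ^ 2 + s r ^ 2) / 2 =
        r ^ (k + 1) * (r * ((c r ^ 2 + s r ^ 2) / 2) - m * (c r * s r)) := by ring
      have h4 : 0 ≤ r * ((c r ^ 2 + s r ^ 2) / 2) - m * (c r * s r) := by
        nlinarith [sq_nonneg (c r), sq_nonneg (s r)]
      have := mul_nonneg (pow_nonneg hr0.le (k + 1)) h4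
      linarith
    have hH0 : ∀ r, m ≤ r → 0 ≤ H r := fun r hr => le_trans (by
      have : 0 ≤ r := by linarith
      positivity) (hHlow r hr)
    have hQ0 : 0 ≤ Q m := mul_nonneg (hH0 m le_rfl) (Real.exp_nonneg _)
  · positivity
  · intro r hr
    rcases le_total m r with hmr | hmr
    · have h5 := hanti Set.self_mem_Ici (Set.mem_Ici.mpr hmr) hmr
      have h6 : H r ≤ Q r := by
        have : 1 ≤ Real.exp (m / r) := Real.one_le_exp (by positivity)
        simp only [Q]; nlinarith [hH0 r hmr]
      have h7 := hHlow r hmr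
      have : 0 ≤ m ^ (k + 2) * 2 := by positivity
      linarith
    · calc r ^ (k + 2) * (c r ^ 2 + s r ^ 2) ≤ m ^ (k + 2) * 2 := by
            gcongr; exact hE r
        _ ≤ _ := by linarith

namespace IsEquatorial

variable {d : ℕ} {i₀ i₁ : Fin d} {σ : Measure (Eu d)}

/-- Decay of the Fourier transform of an equatorial measure and of its radial derivative. -/
theorem fourier_decay (h : IsEquatorial i₀ σ) (hd : 4 ≤ d) :
    ∃ C : ℝ, 0 ≤ C ∧ ∀ ζ : Eu d, ζ i₀ = 0 →
      ‖∫ ω, Complex.exp (((inner ℝ ζ ω : ℝ) : ℂ) * Complex.I) ∂σ‖ ^ 2 * ‖ζ‖ ^ (d - 2) ≤ C ∧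
      ‖∫ ω, ((inner ℝ ζ ω : ℝ) : ℂ) * Complex.exp (((inner ℝ ζ ω : ℝ) : ℂ) * Complex.I) ∂σ‖ ^ 2 *
        ‖ζ‖ ^ (d - 2) ≤ C * ‖ζ‖ ^ 2 := by
  have := h.prob
  obtain ⟨k, rfl⟩ : ∃ k, d = k + 4 := ⟨d - 4, by omega⟩
  obtain ⟨i₁, hi⟩ : ∃ i₁ : Fin (k + 4), i₁ ≠ i₀ := exists_ne i₀
  have hbound : ∀ {F : Eu (k + 4) → ℝ}, (∀ ω : Eu (k + 4), (∀ i, |ω i| ≤ 1) → |F ω| ≤ 1) →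
      |∫ ω, F ω ∂σ| ≤ 1 := by
    intro F hF
    have := norm_integral_le_of_norm_le_const (μ := σ) (f := F) (C := 1) (by
      filter_upwards [h.ae_abs_le] with ω hω using hF ω hω)
    simpa using this
  have hb1 : ∀ r, |∫ ω, Real.cos (r * ω i₁) ∂σ| ≤ 1 := fun r =>
    hbound fun ω _ => Real.abs_cos_le_one _
  have hb2 : ∀ r, ∀ ω : Eu (k + 4), (∀ i, |ω i| ≤ 1) → |ω i₁ * Real.sin (r * ω i₁)| ≤ 1 := by
    intro r ω hω
    rw [abs_mul]
    exact mul_le_one₀ (hω _) (abs_nonneg _) (Real.abs_sin_le_one _)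
  obtain ⟨C, hC0, hC⟩ := bessel_energy_bound k (fun r => h.hasDerivAt_integral_cos (i₁ := i₁) r)
    (fun r => h.hasDerivAt_integral_sin r)
    (fun r => by
      have := h.bessel_ode hi r
      push_cast at this
      rw [this]; ring) hb1 (fun r => hbound (hb2 r))
  refine ⟨C, hC0, fun ζ hζ => ?_⟩
  set r := ‖ζ‖ with hr
  have hn : ‖ζ‖ = ‖r • (unitVec i₁ : Eu (k + 4))‖ := by rw [norm_smul]; simp [hr]
  have hn0 : (r • (unitVec i₁ : Eu (k + 4))) i₀ = 0 := by simp [hi.symm]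
  have hin : ∀ ω : Eu (k + 4), inner ℝ (r • (unitVec i₁ : Eu (k + 4))) ω = r * ω i₁ := fun ω => by
    simp [inner_smul_left, EuclideanSpace.inner_single_left]
  -- The law of ⟪ζ, ω⟫ is symmetric. Hence only the cosine survives in the transform and only the
  -- sine in its radial derivative, which are the functions c and s of the energy estimate.
  have hodd : ∀ F : ℝ → ℝ, (∀ x, F (-x) = -F x) → ∫ ω, F (r * ω i₁) ∂σ = 0 := by
    intro F hF
    have h1 := h.integral_inner_congr (ζ := r • unitVec i₁) (ζ' := -(r • unitVec i₁)) hn0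
      (by simpa using hn0) (by simp) F
    simp_rw [inner_neg_left, hin, hF, integral_neg] at h1
    linarith
  have hcos : Integrable (fun ω : Eu (k + 4) => Real.cos (r * ω i₁)) σ :=
    h.integrable_of_bound (by fun_prop) 1 fun ω _ => Real.abs_cos_le_one _
  have hsin : Integrable (fun ω : Eu (k + 4) => Real.sin (r * ω i₁)) σ :=
    h.integrable_of_bound (by fun_prop) 1 fun ω _ => Real.abs_sin_le_one _
  have hxcos : Integrable (fun ω : Eu (k + 4) => r * ω i₁ * Real.cos (r * ω i₁)) σ := by
    refine h.integrable_of_bound (by fun_prop) (|r| * 1) fun ω hω => ?_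
    rw [Real.norm_eq_abs, mul_assoc, abs_mul, abs_mul]
    gcongr
    exact mul_le_one₀ (hω _) (abs_nonneg _) (Real.abs_cos_le_one _)
  have hxsin : Integrable (fun ω : Eu (k + 4) => r * ω i₁ * Real.sin (r * ω i₁)) σ := by
    refine h.integrable_of_bound (by fun_prop) (|r| * 1) fun ω hω => ?_
    rw [Real.norm_eq_abs, mul_assoc, abs_mul]
    gcongr
    exact hb2 r ω hω
  have h1 : ∫ ω, Complex.exp (((inner ℝ ζ ω : ℝ) : ℂ) * Complex.I) ∂σ =
      ((∫ ω, Real.cos (r * ω i₁) ∂σ : ℝ) : ℂ) := by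
    rw [h.integral_inner_congr hζ hn0 hn (fun x => Complex.exp ((x : ℂ) * Complex.I))]
    simp_rw [hin]
    have e : ∀ ω : Eu (k + 4), Complex.exp (((r * ω i₁ : ℝ) : ℂ) * Complex.I) =
        ((Real.cos (r * ω i₁) : ℝ) : ℂ) + ((Real.sin (r * ω i₁) : ℝ) : ℂ) * Complex.I := fun ω => by
      rw [Complex.exp_mul_I, Complex.ofReal_cos, Complex.ofReal_sin]
    simp_rw [e]
    rw [integral_add hcos.ofReal (hsin.ofReal.mul_const _), integral_mul_const]
    rw [integral_complex_ofReal, integral_complex_ofReal, hodd Real.sin Real.sin_neg]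
    simp
  have h2 : ∫ ω, ((inner ℝ ζ ω : ℝ) : ℂ) * Complex.exp (((inner ℝ ζ ω : ℝ) : ℂ) * Complex.I) ∂σ =
      ((r * ∫ ω, ω i₁ * Real.sin (r * ω i₁) ∂σ : ℝ) : ℂ) * Complex.I := by
    rw [h.integral_inner_congr hζ hn0 hn
      (fun x => (x : ℂ) * Complex.exp ((x : ℂ) * Complex.I))]
    simp_rw [hin]
    have e : ∀ ω : Eu (k + 4), ((r * ω i₁ : ℝ) : ℂ) *
        Complex.exp (((r * ω i₁ : ℝ) : ℂ) * Complex.I) =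
        ((r * ω i₁ * Real.cos (r * ω i₁) : ℝ) : ℂ) +
        ((r * ω i₁ * Real.sin (r * ω i₁) : ℝ) : ℂ) * Complex.I := fun ω => by
      rw [Complex.exp_mul_I, ← Complex.ofReal_cos, ← Complex.ofReal_sin]; push_cast; ring
    simp_rw [e]
    rw [integral_add hxcos.ofReal (hxsin.ofReal.mul_const _), integral_mul_const]
    rw [integral_complex_ofReal, integral_complex_ofReal,
      hodd (fun x => x * Real.cos x) (fun x => by simp)]
    simp_rw [mul_assoc r, integral_const_mul]
    simp
  have h3 := hC r (norm_nonneg _)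
  have hpow : 0 ≤ r ^ (k + 2) := pow_nonneg (norm_nonneg _) _
  rw [h1, h2, norm_mul, Complex.norm_I, mul_one, Complex.norm_real, Complex.norm_real,
    Real.norm_eq_abs, Real.norm_eq_abs, sq_abs, sq_abs, show k + 4 - 2 = k + 2 from rfl]
  constructor
  · nlinarith [mul_nonneg hpow (sq_nonneg (∫ ω, ω i₁ * Real.sin (r * ω i₁) ∂σ))]
  · have h4 : r ^ (k + 2) * (∫ ω, ω i₁ * Real.sin (r * ω i₁) ∂σ) ^ 2 ≤ C := by
      nlinarith [mul_nonneg hpow (sq_nonneg (∫ ω, Real.cos (r * ω i₁) ∂σ))]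
    calc (r * ∫ ω, ω i₁ * Real.sin (r * ω i₁) ∂σ) ^ 2 * r ^ (k + 2)
        = (r ^ (k + 2) * (∫ ω, ω i₁ * Real.sin (r * ω i₁) ∂σ) ^ 2) * r ^ 2 := by ring
      _ ≤ C * r ^ 2 := by gcongr

end IsEquatorial

/-! ### Mass of caps and the L² extension estimate -/

lemma lintegral_gaussian {d : ℕ} {b : ℝ} (hb : 0 < b) (v : Eu d) :
    ∫⁻ x, ENNReal.ofReal (Real.exp (-b * ‖x - v‖ ^ 2)) = ENNReal.ofReal ((Real.pi / b) ^ (d / 2 : ℝ)) := by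
  rw [lintegral_sub_right_eq_self (fun x : Eu d => ENNReal.ofReal (Real.exp (-b * ‖x‖ ^ 2))) v]
  have h := GaussianFourier.integral_rexp_neg_mul_sq_norm (V := Eu d) hb
  rw [finrank_euclideanSpace_fin] at h
  rw [← h, ofReal_integral_eq_lintegral_ofReal]
  -- A function that is not integrable has Bochner integral 0, whereas the Gaussian integral formula
  -- gives a positive value.
  · by_contra hn
    rw [integral_undef hn] at h
    have : 0 < (Real.pi / b) ^ (d / 2 : ℝ) := by positivity
    linarith
  · exact Eventually.of_forall fun x => (Real.exp_pos _).le

/-- A probability measure on the unit sphere that is invariant under linear isometries gives mass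
`O(ρ^{1-d})` to caps of radius `1/ρ`, in the form of Gaussian means. -/
lemma exists_gaussian_mean_le {d : ℕ} (hd : 1 ≤ d) {Ω : Type*} [MeasurableSpace Ω] {μ : Measure Ω}
    [IsProbabilityMeasure μ] {v : Ω → Eu d} (hv : Measurable v)
    (hinv : ∀ u : Eu d ≃ₗᵢ[ℝ] Eu d, μ.map (fun g => u (v g)) = μ.map v) :
    ∃ C : ℝ, 0 ≤ C ∧ ∀ ρ : ℝ, 1 ≤ ρ → ∀ w : Eu d, ‖w‖ = 1 →
      ∫⁻ g, ENNReal.ofReal (Real.exp (-(ρ ^ 2 / 4) * ‖w - v g‖ ^ 2)) ∂μ ≤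
        ENNReal.ofReal (C * ρ / ρ ^ d) := by
  have : NeZero d := ⟨by omega⟩
  have : Nontrivial (Eu d) := by
    have : Nonempty (Fin d) := ⟨0⟩
    infer_instance
  set β := (volume (Metric.ball (0 : Eu d) 1)).toReal with hβ
  have hβ0 : 0 < β := ENNReal.toReal_pos (Metric.measure_ball_pos _ _ one_pos).ne'
    measure_ball_lt_top.ne
  refine ⟨Real.exp (1 / 4) * (8 * Real.pi) ^ (d / 2 : ℝ) / β, by positivity, fun ρ hρ w hw => ?_⟩
  have hρ0 : 0 < ρ := by linarith
  set h : Eu d → ℝ≥0∞ := fun w => ∫⁻ g, ENNReal.ofReal (Real.exp (-(ρ ^ 2 / 4) * ‖w - v g‖ ^ 2)) ∂μ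
    with hh
  have hconst : ∀ w' : Eu d, ‖w'‖ = 1 → h w' = h w := by
    intro w' hw'
    let u := (ℝ ∙ (w' - w))ᗮ.reflection
    have hu : u w' = w := Submodule.reflection_sub (hw'.trans hw.symm)
    have hm : Measurable fun x : Eu d => ENNReal.ofReal (Real.exp (-(ρ ^ 2 / 4) * ‖w - x‖ ^ 2)) := by
      fun_prop
    have e1 : h w' = ∫⁻ x, ENNReal.ofReal (Real.exp (-(ρ ^ 2 / 4) * ‖w - x‖ ^ 2))
        ∂(μ.map (fun g => u (v g))) := by
      rw [lintegral_map (g := fun g => u (v g)) hm (u.continuous.measurable.comp hv)]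
      refine lintegral_congr fun g => ?_
      rw [← hu, ← map_sub, u.norm_map]
    rw [e1, hinv, lintegral_map hm hv]
  -- The mean h is constant on the unit sphere, so it can be estimated through the shell 1 ≤ |x| ≤ 1
  -- + 1/ρ, of volume at least β/ρ. Moving x radially to the sphere costs a factor e^{1/4} if the
  -- exponent ρ²/4 is relaxed to ρ²/8. The integral over all x has order ρ^{-d}; division by the
  -- volume of the shell gives ρ^{1-d}.
  set A : Set (Eu d) := Metric.closedBall 0 (1 + 1 / ρ) \ Metric.ball 0 1 with hA
  have hAm : MeasurableSet A := measurableSet_closedBall.diff measurableSet_ball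
  have hAvol : ENNReal.ofReal (β / ρ) ≤ volume A := by
    have hsub : Metric.ball (0 : Eu d) 1 ⊆ Metric.closedBall 0 (1 + 1 / ρ) :=
      Metric.ball_subset_closedBall.trans (Metric.closedBall_subset_closedBall (by
        have : 0 ≤ 1 / ρ := by positivity
        linarith))
    rw [measure_sdiff hsub measurableSet_ball.nullMeasurableSet measure_ball_lt_top.ne,
      Measure.addHaar_closedBall _ _ (by positivity), finrank_euclideanSpace_fin]
    have hb : volume (Metric.ball (0 : Eu d) 1) = ENNReal.ofReal β :=
      (ENNReal.ofReal_toReal measure_ball_lt_top.ne).symm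
    rw [hb, ← ENNReal.ofReal_mul (by positivity), ← ENNReal.ofReal_sub _ hβ0.le]
    refine ENNReal.ofReal_le_ofReal ?_
    have hbern : 1 + (d : ℝ) * (1 / ρ) ≤ (1 + 1 / ρ) ^ d :=
      one_add_mul_le_pow (by have : 0 ≤ 1 / ρ := by positivity
                             linarith) d
    have h1 : 1 / ρ ≤ (d : ℝ) * (1 / ρ) :=
      le_mul_of_one_le_left (by positivity) (by exact_mod_cast hd)
    calc β / ρ = (1 + 1 / ρ) * β - β := by ring
      _ ≤ (1 + 1 / ρ) ^ d * β - β := by gcongr; linarith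
  have hI : ∫⁻ x : Eu d, ∫⁻ g, ENNReal.ofReal (Real.exp (-(ρ ^ 2 / 8) * ‖x - v g‖ ^ 2)) ∂μ =
      ENNReal.ofReal ((8 * Real.pi) ^ (d / 2 : ℝ) / ρ ^ d) := by
    rw [lintegral_lintegral_swap]
    · simp_rw [lintegral_gaussian (show 0 < ρ ^ 2 / 8 by positivity)]
      rw [lintegral_const, measure_univ, mul_one]
      congr 1
      rw [show Real.pi / (ρ ^ 2 / 8) = (8 * Real.pi) / ρ ^ 2 by field_simp,
        Real.div_rpow (by positivity) (by positivity)]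
      congr 1
      rw [← Real.rpow_natCast_mul hρ0.le]
      rw [show ((2 : ℕ) : ℝ) * (d / 2) = d by push_cast; ring, Real.rpow_natCast]
    · refine Measurable.aemeasurable ?_
      have h2 : Measurable fun p : Eu d × Ω => v p.2 := hv.comp measurable_snd
      refine ENNReal.measurable_ofReal.comp (Real.measurable_exp.comp (Measurable.const_mul ?_ _))
      exact ((measurable_fst.sub h2).norm).pow_const 2
  have hlow : ∀ x ∈ A, ENNReal.ofReal (Real.exp (-(1 / 4))) * h w ≤
      ∫⁻ g, ENNReal.ofReal (Real.exp (-(ρ ^ 2 / 8) * ‖x - v g‖ ^ 2)) ∂μ := by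
    intro x hx
    have hx1 : 1 ≤ ‖x‖ := by
      by_contra hlt
      exact hx.2 (mem_ball_zero_iff.mpr (not_le.mp hlt))
    have hx2 : ‖x‖ ≤ 1 + 1 / ρ := mem_closedBall_zero_iff.mp hx.1
    have hxne : ‖x‖ ≠ 0 := by positivity
    set w' : Eu d := ‖x‖⁻¹ • x with hw'
    have hw'1 : ‖w'‖ = 1 := by rw [hw', norm_smul, norm_inv, norm_norm, inv_mul_cancel₀ hxne]
    have hdist : ‖x - w'‖ ≤ 1 / ρ := by
      have : x - w' = (1 - ‖x‖⁻¹) • x := by rw [hw', sub_smul, one_smul]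
      rw [this, norm_smul, Real.norm_eq_abs, abs_of_nonneg (by
        rw [sub_nonneg]; exact inv_le_one_of_one_le₀ hx1), sub_mul, inv_mul_cancel₀ hxne]
      linarith
    rw [← hconst w' hw'1, hh, ← lintegral_const_mul' _ _ ENNReal.ofReal_ne_top]
    refine lintegral_mono fun g => ?_
    rw [← ENNReal.ofReal_mul (Real.exp_pos _).le, ← Real.exp_add]
    refine ENNReal.ofReal_le_ofReal (Real.exp_le_exp.mpr ?_)
    have htri : ‖x - v g‖ ≤ 1 / ρ + ‖w' - v g‖ := by
      calc ‖x - v g‖ = ‖(x - w') + (w' - v g)‖ := by congr 1; abel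
        _ ≤ _ := (norm_add_le _ _).trans (by gcongr)
    have hsq : ‖x - v g‖ ^ 2 ≤ 2 * (1 / ρ) ^ 2 + 2 * ‖w' - v g‖ ^ 2 := by
      have := pow_le_pow_left₀ (norm_nonneg _) htri 2
      nlinarith [sq_nonneg (1 / ρ - ‖w' - v g‖)]
    have e3 : ρ ^ 2 * (1 / ρ) ^ 2 = 1 := by field_simp
    nlinarith [mul_le_mul_of_nonneg_left hsq (sq_nonneg ρ)]
  have hfin : ENNReal.ofReal (Real.exp (-(1 / 4))) * h w * ENNReal.ofReal (β / ρ) ≤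
      ENNReal.ofReal ((8 * Real.pi) ^ (d / 2 : ℝ) / ρ ^ d) := by
    calc _ ≤ ENNReal.ofReal (Real.exp (-(1 / 4))) * h w * volume A := by gcongr
      _ = ∫⁻ x in A, ENNReal.ofReal (Real.exp (-(1 / 4))) * h w := by
        rw [setLIntegral_const]
      _ ≤ ∫⁻ x in A, ∫⁻ g, ENNReal.ofReal (Real.exp (-(ρ ^ 2 / 8) * ‖x - v g‖ ^ 2)) ∂μ :=
        setLIntegral_mono' hAm hlow
      _ ≤ _ := by
        rw [← hI]; exact setLIntegral_le_lintegral _ _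
  have hpos : 0 < Real.exp (-(1 / 4)) * (β / ρ) := by positivity
  rw [mul_right_comm, ← ENNReal.ofReal_mul (Real.exp_pos _).le, mul_comm,
    ← ENNReal.le_div_iff_mul_le (Or.inl (by simpa using hpos)) (Or.inl ENNReal.ofReal_ne_top),
    ← ENNReal.ofReal_div_of_pos hpos] at hfin
  refine hfin.trans (le_of_eq ?_)
  congr 1
  rw [Real.exp_neg]
  field_simp

/-- Schur's test for a symmetric nonnegative kernel. -/
lemma lintegral_schur_le {Ω : Type*} [MeasurableSpace Ω] {μ : Measure Ω} [SFinite μ]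
    {κ : Ω → Ω → ℝ≥0∞} (hκ : Measurable (Function.uncurry κ)) (hsym : ∀ g g', κ g g' = κ g' g)
    {K : ℝ≥0∞} (hK : ∀ g, ∫⁻ g', κ g g' ∂μ ≤ K) {f : Ω → ℝ≥0∞} (hf : Measurable f) :
    ∫⁻ q, 2⁻¹ * (κ q.1 q.2 * f q.1 + κ q.1 q.2 * f q.2) ∂(μ.prod μ) ≤ K * ∫⁻ g, f g ∂μ := by
  have hκ1 : ∀ g, Measurable (κ g) := fun g => hκ.comp measurable_prodMk_left
  have m1 : Measurable fun q : Ω × Ω => κ q.1 q.2 * f q.1 := hκ.mul (hf.comp measurable_fst)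
  have m2 : Measurable fun q : Ω × Ω => κ q.1 q.2 * f q.2 := hκ.mul (hf.comp measurable_snd)
  rw [lintegral_const_mul' _ _ (by simp), lintegral_add_left m1, lintegral_prod _ m1.aemeasurable,
    lintegral_prod_symm _ m2.aemeasurable]
  calc _ ≤ 2⁻¹ * ((∫⁻ g, K * f g ∂μ) + ∫⁻ g', K * f g' ∂μ) := by
        gcongr with g g'
        · change ∫⁻ y, κ g y * f g ∂μ ≤ _
          rw [lintegral_mul_const _ (hκ1 _)]
          gcongr
          exact hK g
        · change ∫⁻ x, κ x g' * f g' ∂μ ≤ _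
          simp_rw [fun g => hsym g g']
          rw [lintegral_mul_const _ (hκ1 _)]
          gcongr
          exact hK g'
    _ = _ := by
        rw [lintegral_const_mul _ hf, ← two_mul, ← mul_assoc 2⁻¹, ENNReal.inv_mul_cancel (by simp)
          (by simp), one_mul]

/-- The `L²` extension estimate for a measure satisfying the Gaussian cap condition. -/
lemma lintegral_extension_le {d : ℕ} {Ω : Type*} [MeasurableSpace Ω] {μ : Measure Ω}
    [IsProbabilityMeasure μ] {v : Ω → Eu d} (hv : Measurable v) {ρ K : ℝ} (hρ : 0 < ρ)
    (hcap : ∀ g', ∫⁻ g, ENNReal.ofReal (Real.exp (-(ρ ^ 2 / 4) * ‖v g' - v g‖ ^ 2)) ∂μ ≤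
      ENNReal.ofReal K) {θ : ℝ} (hθ : 1 ≤ |θ|) {b : Ω → ℂ} (hb : Measurable b) {B : ℝ}
    (hB : ∀ g, ‖b g‖ ≤ B) :
    ∫⁻ ξ in Metric.closedBall 0 ρ,
        ‖∫ g, Complex.exp (((θ * inner ℝ ξ (v g) : ℝ) : ℂ) * Complex.I) * b g ∂μ‖ₑ ^ 2 ≤
      ENNReal.ofReal (Real.exp 1 * (Real.pi ^ (d / 2 : ℝ) * ρ ^ d) * K) * ∫⁻ g, ‖b g‖ₑ ^ 2 ∂μ := by
  have hB0 : 0 ≤ B := by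
    obtain ⟨g⟩ : Nonempty Ω := by
      by_contra hne
      rw [not_nonempty_iff] at hne
      have := measure_univ (μ := μ)
      rw [Measure.eq_zero_of_isEmpty μ] at this
      simp at this
    exact (norm_nonneg _).trans (hB g)
  let T : Eu d → ℂ := fun ξ => ∫ g, Complex.exp (((θ * inner ℝ ξ (v g) : ℝ) : ℂ) * Complex.I) * b g ∂μ
  -- This weight is at least e⁻¹ on the ball. With it the square can be expanded and integrated in ξ
  -- exactly, which gives a Gaussian kernel in v g - v g' of exponent ρ²θ²/4. As |θ| ≥ 1, it is
  -- dominated by the kernel of `hcap`, and Schur's test applies.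
  let w : Eu d → ℝ := fun ξ => Real.exp (-(ρ ^ 2)⁻¹ * ‖ξ‖ ^ 2)
  let Φ : Eu d → Ω × Ω → ℂ := fun ξ q => ((w ξ : ℝ) : ℂ) *
    ((Complex.exp (((θ * inner ℝ ξ (v q.1) : ℝ) : ℂ) * Complex.I) * b q.1) *
      (starRingEnd ℂ) (Complex.exp (((θ * inner ℝ ξ (v q.2) : ℝ) : ℂ) * Complex.I) * b q.2))
  have hnexp : ∀ x : ℝ, ‖Complex.exp ((x : ℂ) * Complex.I)‖ = 1 := Complex.norm_exp_ofReal_mul_I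
  have hwint : Integrable w volume := by
    have h := GaussianFourier.integral_rexp_neg_mul_sq_norm (V := Eu d)
      (show 0 < (ρ ^ 2)⁻¹ by positivity)
    by_contra hn
    rw [integral_undef hn] at h
    have : 0 < (Real.pi / (ρ ^ 2)⁻¹) ^ (Module.finrank ℝ (Eu d) / 2 : ℝ) := by positivity
    linarith
  have hTsq : ∀ ξ, ((w ξ * ‖T ξ‖ ^ 2 : ℝ) : ℂ) = ∫ q, Φ ξ q ∂(μ.prod μ) := by
    intro ξ
    simp only [Φ]
    rw [integral_const_mul, integral_prod_mul (fun g =>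
      Complex.exp (((θ * inner ℝ ξ (v g) : ℝ) : ℂ) * Complex.I) * b g)
      (fun g => (starRingEnd ℂ) (Complex.exp (((θ * inner ℝ ξ (v g) : ℝ) : ℂ) * Complex.I) * b g)),
      integral_conj, Complex.mul_conj, Complex.normSq_eq_norm_sq, Complex.ofReal_mul]
  have hm1 : Measurable fun p : Eu d × (Ω × Ω) => Φ p.1 p.2 := by
    have a1 : Measurable fun p : Eu d × (Ω × Ω) => v p.2.1 := hv.comp (measurable_fst.comp measurable_snd)
    have a2 : Measurable fun p : Eu d × (Ω × Ω) => v p.2.2 := hv.comp (measurable_snd.comp measurable_snd)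
    have a3 : Measurable fun p : Eu d × (Ω × Ω) => b p.2.1 := hb.comp (measurable_fst.comp measurable_snd)
    have a4 : Measurable fun p : Eu d × (Ω × Ω) => b p.2.2 := hb.comp (measurable_snd.comp measurable_snd)
    have i1 : Measurable fun p : Eu d × (Ω × Ω) => inner ℝ p.1 (v p.2.1) := measurable_fst.inner a1
    have i2 : Measurable fun p : Eu d × (Ω × Ω) => inner ℝ p.1 (v p.2.2) := measurable_fst.inner a2
    have c : Continuous (starRingEnd ℂ) := Complex.continuous_conj
    have w1 : Measurable fun p : Eu d × (Ω × Ω) => w p.1 := by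
      have : Measurable w := by simp only [w]; fun_prop
      exact this.comp measurable_fst
    refine (Complex.measurable_ofReal.comp w1).mul (((Complex.measurable_exp.comp
      ((Complex.measurable_ofReal.comp (i1.const_mul θ)).mul_const _)).mul a3).mul
      (c.measurable.comp ((Complex.measurable_exp.comp
      ((Complex.measurable_ofReal.comp (i2.const_mul θ)).mul_const _)).mul a4)))
  have hΦnorm : ∀ ξ q, ‖Φ ξ q‖ = w ξ * (‖b q.1‖ * ‖b q.2‖) := by
    intro ξ q
    simp only [Φ]
    rw [norm_mul, norm_mul, RCLike.norm_conj, norm_mul, norm_mul, hnexp, hnexp, one_mul, one_mul,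
      Complex.norm_real, Real.norm_eq_abs, abs_of_nonneg (Real.exp_pos _).le]
  have hΦint : Integrable (Function.uncurry Φ) (volume.prod (μ.prod μ)) := by
    refine Integrable.mono' (g := fun p : Eu d × (Ω × Ω) => w p.1 * (B * B))
      (hwint.mul_prod (integrable_const (B * B))) hm1.aestronglyMeasurable
      (Eventually.of_forall fun p => ?_)
    change ‖Φ p.1 p.2‖ ≤ _
    rw [hΦnorm]
    have := (Real.exp_pos (-(ρ ^ 2)⁻¹ * ‖p.1‖ ^ 2)).le
    have h1 := hB p.2.1
    have h2 := hB p.2.2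
    gcongr
  have hgauss : ∀ q : Ω × Ω, ∫ ξ, Φ ξ q = ((Real.pi / ((ρ ^ 2)⁻¹ : ℝ) : ℝ) : ℂ) ^ ((d : ℂ) / 2) *
      ((Real.exp (-(ρ ^ 2 * θ ^ 2 / 4) * ‖v q.1 - v q.2‖ ^ 2) : ℝ) : ℂ) *
      (b q.1 * (starRingEnd ℂ) (b q.2)) := by
    intro q
    have e : ∀ ξ, Φ ξ q = Complex.exp (-(((ρ ^ 2)⁻¹ : ℝ) : ℂ) * (‖ξ‖ : ℂ) ^ 2 + ((θ : ℂ) * Complex.I) *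
        ((inner ℝ (v q.1 - v q.2) ξ : ℝ) : ℂ)) * (b q.1 * (starRingEnd ℂ) (b q.2)) := by
      intro ξ
      simp only [Φ, w]
      rw [map_mul, ← Complex.exp_conj, map_mul, Complex.conj_I, Complex.conj_ofReal,
        Complex.ofReal_exp]
      rw [show ∀ x y z u s : ℂ, x * (y * u * (z * s)) = (x * y * z) * (u * s) by intros; ring,
        ← Complex.exp_add, ← Complex.exp_add]
      congr 2
      rw [inner_sub_left, real_inner_comm (v q.1), real_inner_comm (v q.2)]
      push_cast
      ring
    simp_rw [e]
    rw [integral_mul_const, GaussianFourier.integral_cexp_neg_mul_sq_norm_add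
      (by rw [Complex.ofReal_re]; positivity), finrank_euclideanSpace_fin]
    congr 2
    · push_cast; ring
    · rw [Complex.ofReal_exp]
      congr 1
      push_cast
      rw [mul_pow, Complex.I_sq]
      have : (ρ : ℂ) ≠ 0 := by exact_mod_cast hρ.ne'
      field_simp
  have hswap : ∫ ξ, ((w ξ * ‖T ξ‖ ^ 2 : ℝ) : ℂ) = ∫ q, (∫ ξ, Φ ξ q) ∂(μ.prod μ) := by
    simp_rw [hTsq]
    exact integral_integral_swap hΦint
  set P : ℝ := Real.pi ^ (d / 2 : ℝ) * ρ ^ d with hP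
  have hPnorm : ‖((Real.pi / ((ρ ^ 2)⁻¹ : ℝ) : ℝ) : ℂ) ^ ((d : ℂ) / 2)‖ = P := by
    rw [Complex.norm_cpow_eq_rpow_re_of_pos (by positivity), hP, div_inv_eq_mul,
      Real.mul_rpow Real.pi_pos.le (by positivity), ← Real.rpow_natCast_mul hρ.le]
    have : ((d : ℂ) / 2).re = (d : ℝ) / 2 := by simp
    rw [this, show ((2 : ℕ) : ℝ) * (d / 2) = d by push_cast; ring, Real.rpow_natCast]
  have hTint : Integrable (fun ξ => w ξ * ‖T ξ‖ ^ 2) := by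
    have h1 : Integrable (fun ξ => ∫ q, Φ ξ q ∂(μ.prod μ)) := hΦint.integral_prod_left
    simp_rw [← hTsq] at h1
    exact_mod_cast h1.re
  have hreal : ENNReal.ofReal (∫ ξ, w ξ * ‖T ξ‖ ^ 2) ≤
      ENNReal.ofReal (P * K) * ∫⁻ g, ‖b g‖ₑ ^ 2 ∂μ := by
    have h1 : ∫ ξ, w ξ * ‖T ξ‖ ^ 2 ≤ ‖∫ q, (∫ ξ, Φ ξ q) ∂(μ.prod μ)‖ := by
      rw [← hswap, integral_complex_ofReal, Complex.norm_real]
      exact Real.le_norm_self _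
    let κ : Ω → Ω → ℝ≥0∞ := fun g g' => ENNReal.ofReal (Real.exp (-(ρ ^ 2 / 4) * ‖v g - v g'‖ ^ 2))
    have b1 : Measurable fun p : Ω × Ω => v p.1 := hv.comp measurable_fst
    have b2 : Measurable fun p : Ω × Ω => v p.2 := hv.comp measurable_snd
    have hκm : Measurable (Function.uncurry κ) := by
      have : Measurable fun p : Ω × Ω =>
        ENNReal.ofReal (Real.exp (-(ρ ^ 2 / 4) * ‖v p.1 - v p.2‖ ^ 2)) := by fun_prop
      exact this
    have hP0 : 0 ≤ P := by positivity
    have hsym : ∀ g g', κ g g' = κ g' g := fun g g' => by simp only [κ]; rw [norm_sub_rev]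
    have hbm : Measurable fun g => ‖b g‖ₑ ^ 2 := hb.enorm.pow_const 2
    calc ENNReal.ofReal (∫ ξ, w ξ * ‖T ξ‖ ^ 2)
        ≤ ‖∫ q, (∫ ξ, Φ ξ q) ∂(μ.prod μ)‖ₑ := by
          rw [← ofReal_norm]; exact ENNReal.ofReal_le_ofReal h1
      _ ≤ ∫⁻ q, ‖∫ ξ, Φ ξ q‖ₑ ∂(μ.prod μ) := enorm_integral_le_lintegral_enorm _
      _ ≤ ∫⁻ q, ENNReal.ofReal P * (2⁻¹ * (κ q.1 q.2 * ‖b q.1‖ₑ ^ 2 + κ q.1 q.2 * ‖b q.2‖ₑ ^ 2))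
            ∂(μ.prod μ) := by
          refine lintegral_mono fun q => ?_
          simp only
          rw [hgauss, ← ofReal_norm, norm_mul, norm_mul, hPnorm, norm_mul,
            RCLike.norm_conj, Complex.norm_real, Real.norm_eq_abs, abs_of_nonneg (Real.exp_pos _).le]
          simp only [κ]
          rw [← ofReal_norm, ← ofReal_norm,
            ← ENNReal.ofReal_pow (norm_nonneg _), ← ENNReal.ofReal_pow (norm_nonneg _),
            ← ENNReal.ofReal_mul (Real.exp_pos _).le, ← ENNReal.ofReal_mul (Real.exp_pos _).le,
            ← ENNReal.ofReal_add (by positivity) (by positivity),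
            show (2⁻¹ : ℝ≥0∞) = ENNReal.ofReal 2⁻¹ by
              rw [ENNReal.ofReal_inv_of_pos two_pos, ENNReal.ofReal_ofNat],
            ← ENNReal.ofReal_mul (by norm_num), ← ENNReal.ofReal_mul (by positivity)]
          refine ENNReal.ofReal_le_ofReal ?_
          rw [mul_assoc]
          refine mul_le_mul_of_nonneg_left ?_ (by positivity)
          have hθ2 : 1 ≤ θ ^ 2 := by rw [← sq_abs]; nlinarith [abs_nonneg θ]
          have e1 : Real.exp (-(ρ ^ 2 * θ ^ 2 / 4) * ‖v q.1 - v q.2‖ ^ 2) ≤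
              Real.exp (-(ρ ^ 2 / 4) * ‖v q.1 - v q.2‖ ^ 2) := by
            refine Real.exp_le_exp.mpr ?_
            have : 0 ≤ ρ ^ 2 * ‖v q.1 - v q.2‖ ^ 2 := by positivity
            nlinarith
          have e2 : 0 ≤ Real.exp (-(ρ ^ 2 / 4) * ‖v q.1 - v q.2‖ ^ 2) := (Real.exp_pos _).le
          have e3 : ‖b q.1‖ * ‖b q.2‖ ≤ 2⁻¹ * (‖b q.1‖ ^ 2 + ‖b q.2‖ ^ 2) := by
            nlinarith [sq_nonneg (‖b q.1‖ - ‖b q.2‖)]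
          calc _ ≤ Real.exp (-(ρ ^ 2 / 4) * ‖v q.1 - v q.2‖ ^ 2) *
                (2⁻¹ * (‖b q.1‖ ^ 2 + ‖b q.2‖ ^ 2)) := by gcongr
            _ = _ := by ring
      _ ≤ ENNReal.ofReal P * (ENNReal.ofReal K * ∫⁻ g, ‖b g‖ₑ ^ 2 ∂μ) := by
          rw [lintegral_const_mul' _ _ ENNReal.ofReal_ne_top]
          gcongr
          exact lintegral_schur_le hκm hsym hcap hbm
      _ = _ := by rw [ENNReal.ofReal_mul hP0, mul_assoc]
  calc ∫⁻ ξ in Metric.closedBall 0 ρ, ‖T ξ‖ₑ ^ 2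
      ≤ ∫⁻ ξ in Metric.closedBall 0 ρ, ENNReal.ofReal (Real.exp 1) *
          ENNReal.ofReal (w ξ * ‖T ξ‖ ^ 2) := by
        refine setLIntegral_mono' measurableSet_closedBall fun ξ hξ => ?_
        rw [← ofReal_norm, ← ENNReal.ofReal_pow (norm_nonneg _),
          ← ENNReal.ofReal_mul (Real.exp_pos _).le]
        refine ENNReal.ofReal_le_ofReal ?_
        rw [← mul_assoc, ← Real.exp_add]
        refine le_mul_of_one_le_left (by positivity) (Real.one_le_exp ?_)
        have h1 : ‖ξ‖ ^ 2 ≤ ρ ^ 2 :=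
          pow_le_pow_left₀ (norm_nonneg _) (mem_closedBall_zero_iff.mp hξ) 2
        have : (ρ ^ 2)⁻¹ * ‖ξ‖ ^ 2 ≤ 1 := by
          rw [inv_mul_le_iff₀ (by positivity)]; linarith
        linarith
    _ ≤ ∫⁻ ξ, ENNReal.ofReal (Real.exp 1) * ENNReal.ofReal (w ξ * ‖T ξ‖ ^ 2) :=
        setLIntegral_le_lintegral _ _
    _ = ENNReal.ofReal (Real.exp 1) * ENNReal.ofReal (∫ ξ, w ξ * ‖T ξ‖ ^ 2) := by
        rw [lintegral_const_mul' _ _ ENNReal.ofReal_ne_top, ofReal_integral_eq_lintegral_ofReal hTint]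
        exact Eventually.of_forall fun ξ => by
          have := (Real.exp_pos (-(ρ ^ 2)⁻¹ * ‖ξ‖ ^ 2)).le
          change 0 ≤ w ξ * _
          positivity
    _ ≤ ENNReal.ofReal (Real.exp 1) * (ENNReal.ofReal (P * K) * ∫⁻ g, ‖b g‖ₑ ^ 2 ∂μ) := by gcongr
    _ = _ := by
        rw [← mul_assoc, ← ENNReal.ofReal_mul (Real.exp_pos _).le, ← mul_assoc]

/-- The mean of a function of size `(N |sin ∠(w, v)|)^{-(d-2)}` over the sphere is `O(N^{-(d-2)})`. -/
lemma exists_lintegral_sq_le {d : ℕ} (hd : 2 ≤ d) {Ω : Type*} [MeasurableSpace Ω] {μ : Measure Ω}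
    {v : Ω → Eu d} (hv : Measurable v) (hv1 : ∀ g, ‖v g‖ = 1) {C₀ : ℝ} (hC₀ : 0 ≤ C₀)
    (hcap : ∀ ρ : ℝ, 1 ≤ ρ → ∀ w : Eu d, ‖w‖ = 1 →
      ∫⁻ g, ENNReal.ofReal (Real.exp (-(ρ ^ 2 / 4) * ‖w - v g‖ ^ 2)) ∂μ ≤
        ENNReal.ofReal (C₀ * ρ / ρ ^ d)) {w : Eu d} (hw : ‖w‖ = 1) {N K : ℝ} (hN : 0 < N)
    (hK : 0 ≤ K) {b : Ω → ℂ} (hbK : ∀ g, ‖b g‖ ^ 2 ≤ K)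
    (hb : ∀ g, ∀ s : ℝ, 0 ≤ s → s ^ 2 = N ^ 2 * (1 - inner ℝ w (v g) ^ 2) →
      ‖b g‖ ^ 2 * s ^ (d - 2) ≤ K) :
    ∫⁻ g, ‖b g‖ₑ ^ 2 ∂μ ≤ ENNReal.ofReal (4 ^ (d - 2) * Real.exp 1 * 4 * C₀ * K / N ^ (d - 2)) := by
  obtain ⟨p, rfl⟩ : ∃ p, d = p + 2 := ⟨d - 2, by omega⟩
  simp only [Nat.add_sub_cancel] at hb ⊢
  -- Dyadic decomposition in the distance r from v g to the nearer of the poles ±w. Where r is about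
  -- 2^{-n}, the hypothesis bounds ‖b g‖² by a multiple of K (2^n / N)^p, and the Gaussian at scale
  -- 2^n is at least e⁻¹. The mean of that Gaussian is O(2^{-n(p+1)}), so the sum over n is
  -- geometric.
  let A : ℕ → ℝ := fun n => K / N ^ p * (4 ^ p * (2 ^ n) ^ p) * Real.exp 1
  have hA : ∀ n, 0 ≤ A n := fun n => by positivity
  let G : ℝ → Eu (p + 2) → Ω → ℝ := fun ρ w g => Real.exp (-(ρ ^ 2 / 4) * ‖w - v g‖ ^ 2)
  have hGpos : ∀ ρ w g, 0 ≤ G ρ w g := fun ρ w g => (Real.exp_pos _).le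
  have hGm : ∀ ρ w, Measurable fun g => ENNReal.ofReal (G ρ w g) := fun ρ w => by
    simp only [G]; fun_prop
  have hpt : ∀ g, ∃ n : ℕ, ‖b g‖ ^ 2 ≤ A n * (G (2 ^ n) w g + G (2 ^ n) (-w) g) := by
    intro g
    obtain ⟨w', hw', hr2⟩ : ∃ w' : Eu (p + 2), (w' = w ∨ w' = -w) ∧ 0 ≤ inner ℝ w' (v g) := by
      rcases le_total 0 (inner ℝ w (v g)) with h | h
      · exact ⟨w, Or.inl rfl, h⟩
      · exact ⟨-w, Or.inr rfl, by rw [inner_neg_left]; linarith⟩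
    have hw'1 : ‖w'‖ = 1 := by rcases hw' with rfl | rfl <;> simp [hw]
    have hsq : inner ℝ w (v g) ^ 2 = inner ℝ w' (v g) ^ 2 := by
      rcases hw' with rfl | rfl <;> simp [inner_neg_left]
    set a := inner ℝ w' (v g) with ha
    set r := ‖w' - v g‖ with hr
    have hr0 : 0 ≤ r := norm_nonneg _
    have hra : r ^ 2 = 2 - 2 * a := by
      rw [hr, norm_sub_sq_real, hw'1, hv1]; ring
    have ha1 : a ≤ 1 := by nlinarith [sq_nonneg r]
    have hsum : ∀ n : ℕ, G (2 ^ n) w' g ≤ G (2 ^ n) w g + G (2 ^ n) (-w) g := fun n => by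
      rcases hw' with rfl | rfl
      · linarith [hGpos (2 ^ n) (-w') g]
      · linarith [hGpos (2 ^ n) w g]
    suffices h : ∃ n : ℕ, ((2 : ℝ) ^ n) ^ 2 * r ^ 2 ≤ 4 ∧
        ‖b g‖ ^ 2 ≤ K / N ^ p * (4 ^ p * (2 ^ n) ^ p) by
      obtain ⟨n, hn1, hn2⟩ := h
      refine ⟨n, le_trans ?_ (mul_le_mul_of_nonneg_left (hsum n) (hA n))⟩
      have h1 : 1 ≤ Real.exp 1 * G (2 ^ n) w' g := by
        simp only [G]
        rw [← Real.exp_add]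
        refine Real.one_le_exp ?_
        rw [← hr]
        linarith
      calc ‖b g‖ ^ 2 ≤ K / N ^ p * (4 ^ p * (2 ^ n) ^ p) * 1 := by rw [mul_one]; exact hn2
        _ ≤ K / N ^ p * (4 ^ p * (2 ^ n) ^ p) * (Real.exp 1 * G (2 ^ n) w' g) := by gcongr
        _ = _ := by simp only [A]; ring
    rcases hr0.eq_or_lt with h0 | hpos
    -- At a pole the decay hypothesis says nothing; the trivial bound K suffices for any n with 2^n
    -- > N.
    · obtain ⟨n, hn⟩ := pow_unbounded_of_one_lt N (one_lt_two : (1 : ℝ) < 2)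
      refine ⟨n, by rw [← h0]; norm_num, (hbK g).trans ?_⟩
      rw [div_mul_eq_mul_div, le_div_iff₀ (by positivity)]
      refine mul_le_mul_of_nonneg_left ?_ hK
      calc N ^ p ≤ 1 * (2 ^ n) ^ p := by rw [one_mul]; gcongr
        _ ≤ 4 ^ p * (2 ^ n) ^ p := by gcongr; exact one_le_pow₀ (by norm_num)
    · have hs := hb g (N * √(1 - a ^ 2)) (by positivity) (by
        rw [mul_pow, Real.sq_sqrt (by nlinarith), hsq])
      -- 1 - a² = (1 - a)(1 + a) ≥ r²/2 because a ≥ 0: this is why the nearer pole w' was chosen.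
      have hlow : r / 2 ≤ √(1 - a ^ 2) := Real.le_sqrt_of_sq_le (by nlinarith)
      have h2 : ‖b g‖ ^ 2 ≤ K / N ^ p * (2 / r) ^ p := by
        have h3 : ‖b g‖ ^ 2 * (N * (r / 2)) ^ p ≤ K :=
          le_trans (by gcongr) hs
        rw [mul_pow, div_pow] at h3
        rw [div_pow]
        field_simp at h3 ⊢
        linarith
      rcases le_or_gt r 1 with hr1 | hr1
      · obtain ⟨n, hn1, hn2⟩ := exists_nat_pow_near_of_lt_one hpos hr1
          (show (0 : ℝ) < 1 / 2 by norm_num) (by norm_num)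
        rw [one_div, inv_pow] at hn1 hn2
        refine ⟨n, ?_, h2.trans ?_⟩
        · have : (2 : ℝ) ^ n * r ≤ 1 := by
            calc (2 : ℝ) ^ n * r ≤ 2 ^ n * (2 ^ n)⁻¹ := by gcongr
              _ = 1 := by field_simp
          rw [← mul_pow]
          have h5 : 0 ≤ (2 : ℝ) ^ n * r := by positivity
          nlinarith
        · gcongr
          rw [← mul_pow]
          gcongr
          rw [div_le_iff₀ hpos]
          have h6 : 1 ≤ 2 ^ (n + 1) * r := by
            have := mul_le_mul_of_nonneg_left hn1.le (show (0 : ℝ) ≤ 2 ^ (n + 1) by positivity)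
            rwa [mul_inv_cancel₀ (by positivity)] at this
          rw [pow_succ] at h6
          linarith
      · refine ⟨0, by norm_num; nlinarith, h2.trans ?_⟩
        gcongr
        rw [← mul_pow]
        gcongr
        rw [div_le_iff₀ hpos]
        norm_num
        linarith
  calc ∫⁻ g, ‖b g‖ₑ ^ 2 ∂μ
      ≤ ∫⁻ g, ∑' n : ℕ, ENNReal.ofReal (A n) *
          (ENNReal.ofReal (G (2 ^ n) w g) + ENNReal.ofReal (G (2 ^ n) (-w) g)) ∂μ := by
        refine lintegral_mono fun g => ?_
        obtain ⟨n, hn⟩ := hpt g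
        refine le_trans ?_ (ENNReal.le_tsum n)
        rw [← ENNReal.ofReal_add (hGpos _ _ _) (hGpos _ _ _), ← ENNReal.ofReal_mul (hA n),
          ← ofReal_norm, ← ENNReal.ofReal_pow (norm_nonneg _)]
        exact ENNReal.ofReal_le_ofReal hn
    _ = ∑' n : ℕ, ENNReal.ofReal (A n) *
          ((∫⁻ g, ENNReal.ofReal (G (2 ^ n) w g) ∂μ) + ∫⁻ g, ENNReal.ofReal (G (2 ^ n) (-w) g) ∂μ) := by
        have hGG : ∀ n : ℕ, Measurable fun g => ENNReal.ofReal (A n) *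
            (ENNReal.ofReal (G (2 ^ n) w g) + ENNReal.ofReal (G (2 ^ n) (-w) g)) := fun n =>
          ((hGm _ _).add (hGm _ _)).const_mul _
        rw [lintegral_tsum fun n => (hGG n).aemeasurable]
        congr 1
        ext n
        rw [lintegral_const_mul' _ _ ENNReal.ofReal_ne_top, lintegral_add_left (hGm _ _)]
    _ ≤ ∑' n : ℕ, ENNReal.ofReal (4 ^ p * Real.exp 1 * 2 * C₀ * K / N ^ p * (1 / 2) ^ n) := by
        refine ENNReal.tsum_le_tsum fun n => ?_
        have h2n : (1 : ℝ) ≤ 2 ^ n := one_le_pow₀ (by norm_num)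
        calc _ ≤ ENNReal.ofReal (A n) * (ENNReal.ofReal (C₀ * 2 ^ n / (2 ^ n) ^ (p + 2)) +
              ENNReal.ofReal (C₀ * 2 ^ n / (2 ^ n) ^ (p + 2))) := by
              gcongr
              · exact hcap _ h2n _ hw
              · exact hcap _ h2n _ (by rw [norm_neg, hw])
          _ = _ := by
              rw [← ENNReal.ofReal_add (by positivity) (by positivity), ← ENNReal.ofReal_mul (hA n)]
              congr 1
              simp only [A]
              rw [one_div, inv_pow, pow_add]
              field_simp
              ring
    _ = _ := by
        rw [← ENNReal.ofReal_tsum_of_nonneg (fun n => by positivity)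
          ((summable_geometric_two).mul_left _), tsum_mul_left, tsum_geometric_two]
        congr 1
        ring

/-! ### The triangle multiplier and its L² decay in one variable -/

/-- The bilinear multiplier `∫ exp(iθ(ξ·y + η·z)) dν(y, z)`. -/
noncomputable def mult {d : ℕ} (ν : Measure (Eu d × Eu d)) (θ : ℝ) (ξ η : Eu d) : ℂ :=
  ∫ p, Complex.exp (((θ * (inner ℝ ξ p.1 + inner ℝ η p.2) : ℝ) : ℂ) * Complex.I) ∂ν

/-- The derivative in `θ` of the bilinear multiplier. -/
noncomputable def multDeriv {d : ℕ} (ν : Measure (Eu d × Eu d)) (θ : ℝ) (ξ η : Eu d) : ℂ :=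
  ∫ p, ((inner ℝ ξ p.1 + inner ℝ η p.2 : ℝ) : ℂ) * Complex.I *
    Complex.exp (((θ * (inner ℝ ξ p.1 + inner ℝ η p.2) : ℝ) : ℂ) * Complex.I) ∂ν

namespace IsTriangleModel

variable {d : ℕ} {i₀ : Fin d} {μ : Measure (OrthGroup d)} {σ : Measure (Eu d)}

/-- The second vertex of the random triangle. -/
noncomputable def vertex (i₀ : Fin d) (g : OrthGroup d) (ω : Eu d) : Eu d :=
  (g : Eu d →L[ℝ] Eu d) ((1 / 2 : ℝ) • unitVec i₀ + (√3 / 2 : ℝ) • ω)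

lemma continuous_vertex : Continuous fun q : OrthGroup d × Eu d => vertex i₀ q.1 q.2 :=
  continuous_orth_apply.comp (continuous_fst.prodMk
    ((continuous_const (y := (1 / 2 : ℝ) • unitVec i₀)).add (continuous_snd.const_smul (√3 / 2 : ℝ))))

lemma continuous_axis : Continuous fun g : OrthGroup d => (g : Eu d →L[ℝ] Eu d) (unitVec i₀) :=
  continuous_orth_apply_const _

lemma integral_eq (h : IsTriangleModel i₀ μ σ) {ν : Measure (Eu d × Eu d)}
    (hν : IsTriangleInvariant ν) {F : Eu d × Eu d → ℂ} (hF : Continuous F) {C : ℝ}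
    (hC : ∀ (g : OrthGroup d) (ω : Eu d), ‖ω‖ = 1 → ω i₀ = 0 →
      ‖F ((g : Eu d →L[ℝ] Eu d) (unitVec i₀), vertex i₀ g ω)‖ ≤ C) :
    ∫ p, F p ∂ν = (ν Set.univ).toReal •
      ∫ g, ∫ ω, F ((g : Eu d →L[ℝ] Eu d) (unitVec i₀), vertex i₀ g ω) ∂σ ∂μ := by
  have := h.prob_left
  have := h.prob_right
  have hc : Continuous fun q : OrthGroup d × Eu d =>
      ((q.1 : Eu d →L[ℝ] Eu d) (unitVec i₀), vertex i₀ q.1 q.2) :=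
    (continuous_axis.comp continuous_fst).prodMk continuous_vertex
  have hrep : ν = ν Set.univ • (μ.prod σ).map (fun q : OrthGroup d × Eu d =>
      ((q.1 : Eu d →L[ℝ] Eu d) (unitVec i₀), vertex i₀ q.1 q.2)) := h.rep ν hν
  conv_lhs => rw [hrep]
  rw [integral_smul_measure, integral_map hc.measurable.aemeasurable
    hF.stronglyMeasurable.aestronglyMeasurable]
  congr 1
  refine integral_prod _ ?_
  refine Integrable.of_bound (C := C) (hF.comp hc).stronglyMeasurable.aestronglyMeasurable ?_
  have hs : ∀ᵐ q ∂(μ.prod σ), ‖q.2‖ = 1 ∧ q.2 i₀ = 0 :=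
    Measure.quasiMeasurePreserving_snd.ae h.supp
  filter_upwards [hs] with q hq using hC q.1 q.2 hq.1 hq.2

lemma norm_vertex (g : OrthGroup d) {ω : Eu d} (h1 : ‖ω‖ = 1) (h0 : ω i₀ = 0) :
    ‖vertex i₀ g ω‖ = 1 := by
  have h3 : √3 * √3 = 3 := Real.mul_self_sqrt (by norm_num)
  have e0 : ‖(unitVec i₀ : Eu d)‖ = 1 := by simp
  have hin : inner ℝ (unitVec i₀) ω = 0 := by simp [EuclideanSpace.inner_single_left, h0]
  rw [vertex, Unitary.norm_map, ← sq_eq_sq₀ (norm_nonneg _) zero_le_one, norm_add_sq_real, norm_smul,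
    norm_smul, inner_smul_left, inner_smul_right, hin, h1, e0]
  simp only [Real.norm_eq_abs, mul_pow, sq_abs]
  nlinarith

lemma norm_axis (g : OrthGroup d) : ‖(g : Eu d →L[ℝ] Eu d) (unitVec i₀)‖ = 1 := by
  rw [Unitary.norm_map]; simp

/-- The component of `g⁻¹ η` orthogonal to the axis. -/
noncomputable def transverse (i₀ : Fin d) (g : OrthGroup d) (η : Eu d) : Eu d :=
  (orthIsometry g).symm η - (inner ℝ η ((g : Eu d →L[ℝ] Eu d) (unitVec i₀))) • unitVec i₀

lemma inner_symm (g : OrthGroup d) (η x : Eu d) :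
    inner ℝ ((orthIsometry g).symm η) x = inner ℝ η ((g : Eu d →L[ℝ] Eu d) x) := by
  rw [← (orthIsometry g).inner_map_map, LinearIsometryEquiv.apply_symm_apply]
  rfl

lemma transverse_apply (g : OrthGroup d) (η : Eu d) : transverse i₀ g η i₀ = 0 := by
  have h := inner_symm g η (unitVec i₀)
  rw [real_inner_comm, EuclideanSpace.inner_single_left] at h
  simp only [transverse, PiLp.sub_apply, PiLp.smul_apply, ← h]
  simp

lemma inner_vertex (g : OrthGroup d) (η : Eu d) {ω : Eu d} (h0 : ω i₀ = 0) :
    inner ℝ η (vertex i₀ g ω) = 1 / 2 * inner ℝ η ((g : Eu d →L[ℝ] Eu d) (unitVec i₀)) +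
      √3 / 2 * inner ℝ (transverse i₀ g η) ω := by
  have hin : inner ℝ (unitVec i₀) ω = 0 := by simp [EuclideanSpace.inner_single_left, h0]
  rw [vertex, map_add, map_smul, map_smul, inner_add_right, inner_smul_right, inner_smul_right,
    transverse, inner_sub_left, inner_smul_left, hin, inner_symm]
  simp

lemma norm_transverse_sq (g : OrthGroup d) (η : Eu d) :
    ‖transverse i₀ g η‖ ^ 2 = ‖η‖ ^ 2 - inner ℝ η ((g : Eu d →L[ℝ] Eu d) (unitVec i₀)) ^ 2 := by
  rw [transverse, norm_sub_sq_real, inner_smul_right, inner_symm, LinearIsometryEquiv.norm_map,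
    norm_smul]
  simp
  ring

/-- The inner average over the rotations about the axis. -/
noncomputable def axisAverage (i₀ : Fin d) (σ : Measure (Eu d)) (θ : ℝ) (η : Eu d)
    (g : OrthGroup d) : ℂ :=
  ∫ ω, Complex.exp (((θ * inner ℝ η (vertex i₀ g ω) : ℝ) : ℂ) * Complex.I) ∂σ

/-- The derivative of `axisAverage` in `θ`. -/
noncomputable def axisAverageDeriv (i₀ : Fin d) (σ : Measure (Eu d)) (θ : ℝ) (η : Eu d)
    (g : OrthGroup d) : ℂ :=
  ∫ ω, ((inner ℝ η (vertex i₀ g ω) : ℝ) : ℂ) * Complex.I *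
    Complex.exp (((θ * inner ℝ η (vertex i₀ g ω) : ℝ) : ℂ) * Complex.I) ∂σ

lemma measurable_axisAverage (h : IsTriangleModel i₀ μ σ) (θ : ℝ) (η : Eu d) :
    Measurable (axisAverage i₀ σ θ η) := by
  have := h.prob_right
  have hc : Continuous fun q : OrthGroup d × Eu d =>
      Complex.exp (((θ * inner ℝ η (vertex i₀ q.1 q.2) : ℝ) : ℂ) * Complex.I) := by
    have := continuous_vertex (i₀ := i₀)
    fun_prop
  exact hc.stronglyMeasurable.integral_prod_right.measurable

lemma measurable_axisAverageDeriv (h : IsTriangleModel i₀ μ σ) (θ : ℝ) (η : Eu d) :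
    Measurable (axisAverageDeriv i₀ σ θ η) := by
  have := h.prob_right
  have hc : Continuous fun q : OrthGroup d × Eu d =>
      ((inner ℝ η (vertex i₀ q.1 q.2) : ℝ) : ℂ) * Complex.I *
      Complex.exp (((θ * inner ℝ η (vertex i₀ q.1 q.2) : ℝ) : ℂ) * Complex.I) := by
    have := continuous_vertex (i₀ := i₀)
    fun_prop
  exact hc.stronglyMeasurable.integral_prod_right.measurable

lemma norm_axisAverage_le (h : IsTriangleModel i₀ μ σ) (θ : ℝ) (η : Eu d) (g : OrthGroup d) :
    ‖axisAverage i₀ σ θ η g‖ ≤ 1 := by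
  have := h.prob_right
  refine (norm_integral_le_of_norm_le_const (C := 1) (Eventually.of_forall fun ω => ?_)).trans_eq
    (by simp)
  rw [Complex.norm_exp_ofReal_mul_I]

lemma norm_axisAverageDeriv_le (h : IsTriangleModel i₀ μ σ) (θ : ℝ) (η : Eu d) (g : OrthGroup d) :
    ‖axisAverageDeriv i₀ σ θ η g‖ ≤ ‖η‖ := by
  have := h.prob_right
  refine (norm_integral_le_of_norm_le_const (C := ‖η‖) ?_).trans_eq (by simp)
  filter_upwards [h.supp] with ω hω
  rw [norm_mul, norm_mul, Complex.norm_exp_ofReal_mul_I, Complex.norm_I, mul_one, mul_one,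
    Complex.norm_real]
  refine (norm_inner_le_norm _ _).trans_eq ?_
  rw [norm_vertex g hω.1 hω.2, mul_one]

/-- Decay of the averages about the axis. -/
lemma exists_axisAverage_decay (h : IsTriangleModel i₀ μ σ) (hd : 4 ≤ d) :
    ∃ C : ℝ, 0 ≤ C ∧ ∀ θ : ℝ, 1 ≤ |θ| → ∀ (η : Eu d) (g : OrthGroup d),
      ‖axisAverage i₀ σ θ η g‖ ^ 2 * ‖transverse i₀ g η‖ ^ (d - 2) ≤ C ∧
      ‖axisAverageDeriv i₀ σ θ η g‖ ^ 2 * ‖transverse i₀ g η‖ ^ (d - 2) ≤ C * ‖η‖ ^ 2 := by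
  have := h.prob_right
  obtain ⟨C, hC0, hC⟩ := h.isEquatorial.fourier_decay hd
  have h32 : (1 / 2 : ℝ) ≤ √3 / 2 := by
    have : (1 : ℝ) ≤ √3 := Real.one_le_sqrt.mpr (by norm_num)
    linarith
  refine ⟨4 * (2 ^ (d - 2) * C), by positivity, fun θ hθ η g => ?_⟩
  set τ := transverse i₀ g η with hτ
  set a := inner ℝ η ((g : Eu d →L[ℝ] Eu d) (unitVec i₀)) with ha
  -- The phase θ⟪η, vertex⟫ is the constant θ a/2 plus ⟪c τ, ω⟫. So the average is a unimodular
  -- factor times the transform J of σ at c τ, and its θ-derivative brings in a J/2 + θ⁻¹ J₁. Since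
  -- |c| ≥ 1/2, passing from c τ to τ costs at most 2^{d-2}.
  set c := θ * (√3 / 2) with hc
  have hcabs : 1 / 2 ≤ |c| := by
    rw [hc, abs_mul, abs_of_nonneg (show (0 : ℝ) ≤ √3 / 2 by positivity)]
    nlinarith
  have hct0 : (c • τ) i₀ = 0 := by
    rw [PiLp.smul_apply, hτ, transverse_apply, smul_zero]
  obtain ⟨h1, h2⟩ := hC (c • τ) hct0
  have hnorm : ‖τ‖ ≤ 2 * ‖c • τ‖ := by
    rw [norm_smul, Real.norm_eq_abs]
    nlinarith [norm_nonneg τ]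
  have hpow : ‖τ‖ ^ (d - 2) ≤ 2 ^ (d - 2) * ‖c • τ‖ ^ (d - 2) := by
    rw [← mul_pow]; gcongr
  set J := ∫ ω, Complex.exp (((inner ℝ (c • τ) ω : ℝ) : ℂ) * Complex.I) ∂σ with hJ
  set J₁ := ∫ ω, ((inner ℝ (c • τ) ω : ℝ) : ℂ) *
    Complex.exp (((inner ℝ (c • τ) ω : ℝ) : ℂ) * Complex.I) ∂σ with hJ₁
  have e1 : axisAverage i₀ σ θ η g = Complex.exp (((θ * (1 / 2 * a) : ℝ) : ℂ) * Complex.I) * J := by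
    rw [axisAverage, hJ, ← integral_const_mul]
    refine integral_congr_ae ?_
    filter_upwards [h.supp] with ω hω
    rw [inner_vertex g η hω.2, ← Complex.exp_add, inner_smul_left]
    congr 1
    simp only [hc, RCLike.conj_to_real]
    push_cast
    ring
  have e2 : axisAverageDeriv i₀ σ θ η g = Complex.exp (((θ * (1 / 2 * a) : ℝ) : ℂ) * Complex.I) *
      (((1 / 2 * a : ℝ) : ℂ) * Complex.I * J + ((θ⁻¹ : ℝ) : ℂ) * Complex.I * J₁) := by
    have hθ0 : (θ : ℂ) ≠ 0 := by
      have : θ ≠ 0 := by rintro rfl; norm_num at hθ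
      exact_mod_cast this
    have i1 : Integrable (fun ω => Complex.exp (((inner ℝ (c • τ) ω : ℝ) : ℂ) * Complex.I)) σ := by
      refine h.isEquatorial.integrable_of_bound (by fun_prop) 1 fun ω _ => ?_
      rw [Complex.norm_exp_ofReal_mul_I]
    have i2 : Integrable (fun ω => ((inner ℝ (c • τ) ω : ℝ) : ℂ) *
        Complex.exp (((inner ℝ (c • τ) ω : ℝ) : ℂ) * Complex.I)) σ := by
      refine Integrable.of_bound (C := ‖c • τ‖)
        (by fun_prop : Continuous _).stronglyMeasurable.aestronglyMeasurable ?_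
      filter_upwards [h.supp] with ω hω
      rw [norm_mul, Complex.norm_exp_ofReal_mul_I, mul_one, Complex.norm_real]
      refine (norm_inner_le_norm _ _).trans_eq ?_
      rw [hω.1, mul_one]
    rw [axisAverageDeriv, hJ, hJ₁, ← integral_const_mul, ← integral_const_mul,
      ← integral_add (i1.const_mul _) (i2.const_mul _), ← integral_const_mul]
    refine integral_congr_ae ?_
    filter_upwards [h.supp] with ω hω
    rw [inner_vertex g η hω.2]
    rw [show ∀ x y z w e : ℂ, e * (x * z + y * (w * z)) = (x + y * w) * (e * z) by intros; ring,
      ← Complex.exp_add, inner_smul_left]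
    simp only [hc, RCLike.conj_to_real]
    congr 1
    · push_cast
      field_simp
      rfl
    · congr 1
      push_cast
      ring
  have n1 : ‖axisAverage i₀ σ θ η g‖ = ‖J‖ := by
    rw [e1, norm_mul, Complex.norm_exp_ofReal_mul_I, one_mul]
  have b1 : ‖J‖ ^ 2 * ‖τ‖ ^ (d - 2) ≤ 2 ^ (d - 2) * C := by
    calc ‖J‖ ^ 2 * ‖τ‖ ^ (d - 2) ≤ ‖J‖ ^ 2 * (2 ^ (d - 2) * ‖c • τ‖ ^ (d - 2)) := by gcongr
      _ = 2 ^ (d - 2) * (‖J‖ ^ 2 * ‖c • τ‖ ^ (d - 2)) := by ring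
      _ ≤ _ := by gcongr
  have hA : 0 ≤ 2 ^ (d - 2) * C := by positivity
  refine ⟨by rw [n1]; linarith, ?_⟩
  have n2 : ‖axisAverageDeriv i₀ σ θ η g‖ ≤ 1 / 2 * ‖η‖ * ‖J‖ + |θ|⁻¹ * ‖J₁‖ := by
    rw [e2, norm_mul, Complex.norm_exp_ofReal_mul_I, one_mul]
    refine (norm_add_le _ _).trans ?_
    rw [norm_mul, norm_mul, norm_mul, norm_mul, Complex.norm_I, mul_one, mul_one, Complex.norm_real,
      Complex.norm_real, Real.norm_eq_abs, Real.norm_eq_abs, abs_inv, abs_mul]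
    have : |a| ≤ ‖η‖ := by
      refine (abs_real_inner_le_norm _ _).trans_eq ?_
      rw [norm_axis, mul_one]
    rw [abs_of_nonneg (show (0 : ℝ) ≤ 1 / 2 by norm_num)]
    gcongr
  have hτη : ‖τ‖ ≤ ‖η‖ := by
    have := norm_transverse_sq (i₀ := i₀) g η
    exact le_of_sq_le_sq (by nlinarith [sq_nonneg a]) (norm_nonneg _)
  have hcτ : |θ|⁻¹ * ‖c • τ‖ ≤ ‖η‖ := by
    rw [norm_smul, Real.norm_eq_abs, hc, abs_mul, abs_of_nonneg (show (0 : ℝ) ≤ √3 / 2 by positivity)]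
    have h3 : √3 ≤ 2 := Real.sqrt_le_iff.mpr ⟨by norm_num, by norm_num⟩
    have hθ0 : 0 < |θ| := by linarith
    rw [mul_assoc, ← mul_assoc, inv_mul_cancel₀ hθ0.ne', one_mul]
    nlinarith [norm_nonneg τ]
  have b2 : (|θ|⁻¹ * ‖J₁‖) ^ 2 * ‖τ‖ ^ (d - 2) ≤ 2 ^ (d - 2) * C * ‖η‖ ^ 2 := by
    calc (|θ|⁻¹ * ‖J₁‖) ^ 2 * ‖τ‖ ^ (d - 2)
        ≤ (|θ|⁻¹ * ‖J₁‖) ^ 2 * (2 ^ (d - 2) * ‖c • τ‖ ^ (d - 2)) := by gcongr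
      _ = 2 ^ (d - 2) * |θ|⁻¹ ^ 2 * (‖J₁‖ ^ 2 * ‖c • τ‖ ^ (d - 2)) := by ring
      _ ≤ 2 ^ (d - 2) * |θ|⁻¹ ^ 2 * (C * ‖c • τ‖ ^ 2) := by gcongr
      _ = 2 ^ (d - 2) * C * (|θ|⁻¹ * ‖c • τ‖) ^ 2 := by ring
      _ ≤ _ := by gcongr
  calc ‖axisAverageDeriv i₀ σ θ η g‖ ^ 2 * ‖τ‖ ^ (d - 2)
      ≤ (1 / 2 * ‖η‖ * ‖J‖ + |θ|⁻¹ * ‖J₁‖) ^ 2 * ‖τ‖ ^ (d - 2) := by gcongr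
    _ ≤ (2 * (1 / 2 * ‖η‖ * ‖J‖) ^ 2 + 2 * (|θ|⁻¹ * ‖J₁‖) ^ 2) * ‖τ‖ ^ (d - 2) := by
        gcongr
        nlinarith [sq_nonneg (1 / 2 * ‖η‖ * ‖J‖ - |θ|⁻¹ * ‖J₁‖)]
    _ = 1 / 2 * ‖η‖ ^ 2 * (‖J‖ ^ 2 * ‖τ‖ ^ (d - 2)) +
        2 * ((|θ|⁻¹ * ‖J₁‖) ^ 2 * ‖τ‖ ^ (d - 2)) := by ring
    _ ≤ 1 / 2 * ‖η‖ ^ 2 * (2 ^ (d - 2) * C) + 2 * (2 ^ (d - 2) * C * ‖η‖ ^ 2) := by gcongr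
    _ ≤ _ := by nlinarith [sq_nonneg ‖η‖, mul_nonneg hA (sq_nonneg ‖η‖)]

/-- The extension operator applied to a function on the orthogonal group. -/
noncomputable def axisExtension (i₀ : Fin d) (μ : Measure (OrthGroup d)) (θ : ℝ)
    (b : OrthGroup d → ℂ) (ξ : Eu d) : ℂ :=
  ∫ g, Complex.exp (((θ * inner ℝ ξ ((g : Eu d →L[ℝ] Eu d) (unitVec i₀)) : ℝ) : ℂ) * Complex.I) *
    b g ∂μ

/-- Integrating over ω first turns η into a parameter of a density on the group; what remains is an
extension operator in ξ. -/
lemma mult_eq (h : IsTriangleModel i₀ μ σ) {ν : Measure (Eu d × Eu d)} (hν : IsTriangleInvariant ν)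
    (θ : ℝ) (ξ η : Eu d) :
    mult ν θ ξ η = (ν Set.univ).toReal • axisExtension i₀ μ θ (axisAverage i₀ σ θ η) ξ := by
  rw [mult, h.integral_eq hν (by fun_prop) (C := 1) fun g ω _ _ => by
    rw [Complex.norm_exp_ofReal_mul_I]]
  congr 1
  refine integral_congr_ae (Eventually.of_forall fun g => ?_)
  simp only [axisAverage]
  rw [← integral_const_mul]
  refine integral_congr_ae (Eventually.of_forall fun ω => ?_)
  simp only
  rw [← Complex.exp_add]
  congr 1
  push_cast
  ring

/-- The factor ⟪ξ, y⟫ is expanded in coordinates: each ξᵢ leaves the integral and the i-th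
coordinate of the axis joins the density. The derivative is thus again a combination of extension
operators, to which the same L² estimate applies. -/
lemma multDeriv_eq (h : IsTriangleModel i₀ μ σ) {ν : Measure (Eu d × Eu d)}
    (hν : IsTriangleInvariant ν) (θ : ℝ) (ξ η : Eu d) :
    multDeriv ν θ ξ η = (ν Set.univ).toReal •
      ((∑ i, ((ξ i : ℝ) : ℂ) * Complex.I * axisExtension i₀ μ θ (fun g =>
        ((((g : Eu d →L[ℝ] Eu d) (unitVec i₀)) i : ℝ) : ℂ) * axisAverage i₀ σ θ η g) ξ) +
      axisExtension i₀ μ θ (axisAverageDeriv i₀ σ θ η) ξ) := by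
  have := h.prob_left
  have := h.prob_right
  have hax := continuous_axis (i₀ := i₀)
  rw [multDeriv, h.integral_eq hν (by fun_prop) (C := ‖ξ‖ + ‖η‖) fun g ω h1 h0 => by
    rw [norm_mul, norm_mul, Complex.norm_exp_ofReal_mul_I, Complex.norm_I, mul_one, mul_one,
      Complex.norm_real]
    refine (norm_add_le _ _).trans (add_le_add ?_ ?_)
    · refine (norm_inner_le_norm _ _).trans_eq ?_
      rw [norm_axis, mul_one]
    · refine (norm_inner_le_norm _ _).trans_eq ?_
      rw [norm_vertex g h1 h0, mul_one]]
  congr 1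
  have hm := h.measurable_axisAverage θ η
  have hcoord : ∀ g : OrthGroup d, ∀ i, ‖((((g : Eu d →L[ℝ] Eu d) (unitVec i₀)) i : ℝ) : ℂ)‖ ≤ 1 :=
    fun g i => by
      rw [Complex.norm_real, ← norm_axis (i₀ := i₀) g]
      exact PiLp.norm_apply_le _ i
  have hex : Measurable fun g : OrthGroup d =>
      Complex.exp (((θ * inner ℝ ξ ((g : Eu d →L[ℝ] Eu d) (unitVec i₀)) : ℝ) : ℂ) * Complex.I) :=
    (by fun_prop : Continuous fun g : OrthGroup d =>
      Complex.exp (((θ * inner ℝ ξ ((g : Eu d →L[ℝ] Eu d) (unitVec i₀)) : ℝ) : ℂ) *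
        Complex.I)).measurable
  have hi : ∀ i, Integrable (fun g : OrthGroup d =>
      Complex.exp (((θ * inner ℝ ξ ((g : Eu d →L[ℝ] Eu d) (unitVec i₀)) : ℝ) : ℂ) * Complex.I) *
      (((((g : Eu d →L[ℝ] Eu d) (unitVec i₀)) i : ℝ) : ℂ) * axisAverage i₀ σ θ η g)) μ := by
    intro i
    have hcm : Measurable fun g : OrthGroup d => ((((g : Eu d →L[ℝ] Eu d) (unitVec i₀)) i : ℝ) : ℂ) :=
      (by fun_prop : Continuous fun g : OrthGroup d =>
        ((((g : Eu d →L[ℝ] Eu d) (unitVec i₀)) i : ℝ) : ℂ)).measurable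
    refine Integrable.of_bound (C := 1) (hex.mul (hcm.mul hm)).aestronglyMeasurable
      (Eventually.of_forall fun g => ?_)
    rw [norm_mul, norm_mul, Complex.norm_exp_ofReal_mul_I, one_mul]
    exact mul_le_one₀ (hcoord g i) (norm_nonneg _) (h.norm_axisAverage_le θ η g)
  have hi2 : Integrable (fun g : OrthGroup d =>
      Complex.exp (((θ * inner ℝ ξ ((g : Eu d →L[ℝ] Eu d) (unitVec i₀)) : ℝ) : ℂ) * Complex.I) *
      axisAverageDeriv i₀ σ θ η g) μ := by
    refine Integrable.of_bound (C := ‖η‖)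
      (hex.mul (h.measurable_axisAverageDeriv θ η)).aestronglyMeasurable
      (Eventually.of_forall fun g => ?_)
    rw [norm_mul, Complex.norm_exp_ofReal_mul_I, one_mul]
    exact h.norm_axisAverageDeriv_le θ η g
  simp only [axisExtension]
  simp_rw [← integral_const_mul]
  rw [← integral_finsetSum _ fun i _ => (hi i).const_mul _,
    ← integral_add (integrable_finsetSum _ fun i _ => (hi i).const_mul _) hi2]
  refine integral_congr_ae (Eventually.of_forall fun g => ?_)
  set v := (g : Eu d →L[ℝ] Eu d) (unitVec i₀) with hv
  have hinner : ((inner ℝ ξ v : ℝ) : ℂ) = ∑ i, ((ξ i : ℝ) : ℂ) * ((v i : ℝ) : ℂ) := by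
    rw [PiLp.inner_apply]
    push_cast
    refine Finset.sum_congr rfl fun i _ => ?_
    simp [mul_comm]
  have hs : ∑ i, ((ξ i : ℝ) : ℂ) * Complex.I *
      (Complex.exp (((θ * inner ℝ ξ v : ℝ) : ℂ) * Complex.I) *
        (((v i : ℝ) : ℂ) * axisAverage i₀ σ θ η g)) =
      ((inner ℝ ξ v : ℝ) : ℂ) * (Complex.I * Complex.exp (((θ * inner ℝ ξ v : ℝ) : ℂ) * Complex.I) *
        axisAverage i₀ σ θ η g) := by
    rw [hinner, Finset.sum_mul]
    refine Finset.sum_congr rfl fun i _ => ?_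
    ring
  simp only
  rw [hs]
  simp only [axisAverage, axisAverageDeriv]
  have j1 : Integrable (fun ω => Complex.exp (((θ * inner ℝ η (vertex i₀ g ω) : ℝ) : ℂ) *
      Complex.I)) σ := by
    have hvx : Continuous fun ω => vertex i₀ g ω :=
      continuous_vertex.comp (continuous_const.prodMk continuous_id)
    refine Integrable.of_bound (C := 1)
      (by fun_prop : Continuous _).stronglyMeasurable.aestronglyMeasurable
      (Eventually.of_forall fun ω => ?_)
    rw [Complex.norm_exp_ofReal_mul_I]
  have j2 : Integrable (fun ω => ((inner ℝ η (vertex i₀ g ω) : ℝ) : ℂ) * Complex.I *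
      Complex.exp (((θ * inner ℝ η (vertex i₀ g ω) : ℝ) : ℂ) * Complex.I)) σ := by
    have hvx : Continuous fun ω => vertex i₀ g ω :=
      continuous_vertex.comp (continuous_const.prodMk continuous_id)
    refine Integrable.of_bound (C := ‖η‖)
      (by fun_prop : Continuous _).stronglyMeasurable.aestronglyMeasurable ?_
    filter_upwards [h.supp] with ω hω
    rw [norm_mul, norm_mul, Complex.norm_exp_ofReal_mul_I, Complex.norm_I, mul_one, mul_one,
      Complex.norm_real]
    refine (norm_inner_le_norm _ _).trans_eq ?_
    rw [norm_vertex g hω.1 hω.2, mul_one]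
  rw [← integral_const_mul, ← integral_const_mul, ← integral_const_mul,
    ← integral_add ((j1.const_mul _).const_mul _) (j2.const_mul _)]
  refine integral_congr_ae (Eventually.of_forall fun ω => ?_)
  simp only
  have hexp : Complex.exp (((θ * (inner ℝ ξ v + inner ℝ η (vertex i₀ g ω)) : ℝ) : ℂ) * Complex.I) =
      Complex.exp (((θ * inner ℝ ξ v : ℝ) : ℂ) * Complex.I) *
        Complex.exp (((θ * inner ℝ η (vertex i₀ g ω) : ℝ) : ℂ) * Complex.I) := by
    rw [← Complex.exp_add]
    congr 1
    push_cast
    ring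
  rw [hexp]
  push_cast
  ring

end IsTriangleModel

/-- `L²` decay of the triangle multiplier in one frequency variable. -/
theorem IsTriangleInvariant.exists_lintegral_mult_le {d : ℕ} (hd : 4 ≤ d)
    {ν : Measure (Eu d × Eu d)} (hν : IsTriangleInvariant ν) :
    ∃ C : ℝ, 0 ≤ C ∧ ∀ θ : ℝ, 1 ≤ |θ| → ∀ ρ : ℝ, 1 ≤ ρ → ∀ η : Eu d, η ≠ 0 →
      ∫⁻ ξ in Metric.closedBall 0 ρ, ‖mult ν θ ξ η‖ₑ ^ 2 ≤
        ENNReal.ofReal (C * ρ / ‖η‖ ^ (d - 2)) ∧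
      ∫⁻ ξ in Metric.closedBall 0 ρ, ‖multDeriv ν θ ξ η‖ₑ ^ 2 ≤
        ENNReal.ofReal (C * ρ * (ρ ^ 2 + ‖η‖ ^ 2) / ‖η‖ ^ (d - 2)) := by
  classical
  let i₀ : Fin d := ⟨0, by omega⟩
  let i₁ : Fin d := ⟨1, by omega⟩
  have hi : i₁ ≠ i₀ := by simp [i₀, i₁]
  obtain ⟨μ, σ, h⟩ := exists_isTriangleModel hi
  have := h.prob_left
  have := h.prob_right
  have := h.left_inv
  have hax := IsTriangleModel.continuous_axis (i₀ := i₀)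
  obtain ⟨C₀, hC₀, hcap⟩ := exists_gaussian_mean_le (d := d) (by omega) (μ := μ) hax.measurable (by
    intro u
    conv_rhs => rw [← map_mul_left_eq_self μ u.toOrthGroup]
    rw [Measure.map_map hax.measurable (measurable_const_mul _)]
    rfl)
  obtain ⟨C₁, hC₁, hdec⟩ := h.exists_axisAverage_decay hd
  set c := (ν Set.univ).toReal with hc
  have hc0 : 0 ≤ c := ENNReal.toReal_nonneg
  set A : ℝ := Real.exp 1 * Real.pi ^ (d / 2 : ℝ) * C₀ with hA
  set D : ℝ := 4 ^ (d - 2) * Real.exp 1 * 4 * C₀ * (1 + C₁) with hD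
  have hA0 : 0 ≤ A := by positivity
  have hD0 : 0 ≤ D := by positivity
  -- One factor d comes from Cauchy–Schwarz over the coordinates and one from adding their d equal
  -- bounds; the summand 2 accounts for the term in which η is differentiated.
  refine ⟨c ^ 2 * (2 * d ^ 2 + 2) * (A * D), by positivity, fun θ hθ ρ hρ η hη => ?_⟩
  have hη0 : 0 < ‖η‖ := norm_pos_iff.mpr hη
  have hρ0 : 0 < ρ := by linarith
  -- The volume factor ρ^d of the extension estimate meets the cap constant C₀ ρ^{1-d}, and a single
  -- power of ρ remains.
  have hext : ∀ (b : OrthGroup d → ℂ) (B S : ℝ), Measurable b → (∀ g, ‖b g‖ ≤ B) → 0 ≤ S →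
      ∫⁻ g, ‖b g‖ₑ ^ 2 ∂μ ≤ ENNReal.ofReal S →
      ∫⁻ ξ in Metric.closedBall 0 ρ, ‖IsTriangleModel.axisExtension i₀ μ θ b ξ‖ₑ ^ 2 ≤
        ENNReal.ofReal (A * ρ * S) := by
    intro b B S hb hB hS hbS
    have h1 := lintegral_extension_le (μ := μ) hax.measurable hρ0 (K := C₀ * ρ / ρ ^ d)
      (fun g' => hcap ρ hρ _ (IsTriangleModel.norm_axis g')) hθ hb hB
    refine h1.trans ?_
    calc _ ≤ ENNReal.ofReal (Real.exp 1 * (Real.pi ^ (d / 2 : ℝ) * ρ ^ d) * (C₀ * ρ / ρ ^ d)) *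
          ENNReal.ofReal S := by gcongr
      _ = _ := by
        rw [← ENNReal.ofReal_mul (by positivity)]
        congr 1
        rw [hA]
        field_simp
  set w : Eu d := ‖η‖⁻¹ • η with hw
  have hw1 : ‖w‖ = 1 := by rw [hw, norm_smul, norm_inv, norm_norm, inv_mul_cancel₀ hη0.ne']
  have htr : ∀ (g : OrthGroup d) (s : ℝ), 0 ≤ s →
      s ^ 2 = ‖η‖ ^ 2 * (1 - inner ℝ w ((g : Eu d →L[ℝ] Eu d) (unitVec i₀)) ^ 2) →
      s = ‖IsTriangleModel.transverse i₀ g η‖ := by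
    intro g s hs hs2
    rw [← sq_eq_sq₀ hs (norm_nonneg _), hs2, IsTriangleModel.norm_transverse_sq, hw, inner_smul_left,
      RCLike.conj_to_real]
    field_simp
  have hav : ∫⁻ g, ‖IsTriangleModel.axisAverage i₀ σ θ η g‖ₑ ^ 2 ∂μ ≤
      ENNReal.ofReal (D / ‖η‖ ^ (d - 2)) := by
    refine exists_lintegral_sq_le (by omega) hax.measurable IsTriangleModel.norm_axis hC₀ hcap hw1 hη0
      (K := 1 + C₁) (by positivity) (fun g => ?_) (fun g s hs hs2 => ?_)
    · have := h.norm_axisAverage_le θ η g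
      have h2 : ‖IsTriangleModel.axisAverage i₀ σ θ η g‖ ^ 2 ≤ 1 := pow_le_one₀ (norm_nonneg _) this
      linarith
    · rw [htr g s hs hs2]
      linarith [(hdec θ hθ η g).1]
  have hav' : ∫⁻ g, ‖IsTriangleModel.axisAverageDeriv i₀ σ θ η g‖ₑ ^ 2 ∂μ ≤
      ENNReal.ofReal (D * ‖η‖ ^ 2 / ‖η‖ ^ (d - 2)) := by
    have h1 := exists_lintegral_sq_le (μ := μ) (b := IsTriangleModel.axisAverageDeriv i₀ σ θ η)
      (by omega) hax.measurable IsTriangleModel.norm_axis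
      hC₀ hcap hw1 hη0 (K := (1 + C₁) * ‖η‖ ^ 2) (by positivity) (fun g => ?_)
      (fun g s hs hs2 => ?_)
    · refine h1.trans_eq ?_
      congr 1
      rw [hD]
      ring
    · have := h.norm_axisAverageDeriv_le θ η g
      have h2 : ‖IsTriangleModel.axisAverageDeriv i₀ σ θ η g‖ ^ 2 ≤ ‖η‖ ^ 2 := by gcongr
      nlinarith [sq_nonneg ‖η‖]
    · rw [htr g s hs hs2]
      nlinarith [(hdec θ hθ η g).2, sq_nonneg ‖η‖]
  have hsmul : ∀ z : ℂ, ‖c • z‖ₑ ^ 2 = ENNReal.ofReal (c ^ 2) * ‖z‖ₑ ^ 2 := by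
    intro z
    rw [enorm_smul, mul_pow, Real.enorm_of_nonneg hc0, ENNReal.ofReal_pow hc0]
  constructor
  · simp_rw [h.mult_eq hν, ← hc, hsmul]
    rw [lintegral_const_mul' _ _ ENNReal.ofReal_ne_top]
    calc _ ≤ ENNReal.ofReal (c ^ 2) * ENNReal.ofReal (A * ρ * (D / ‖η‖ ^ (d - 2))) := by
          gcongr
          exact hext _ 1 _ (h.measurable_axisAverage θ η) (h.norm_axisAverage_le θ η)
            (by positivity) hav
      _ ≤ _ := by
          rw [← ENNReal.ofReal_mul (by positivity)]
          refine ENNReal.ofReal_le_ofReal ?_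
          have : 0 ≤ c ^ 2 * (A * D) * ρ / ‖η‖ ^ (d - 2) := by positivity
          calc c ^ 2 * (A * ρ * (D / ‖η‖ ^ (d - 2))) = 1 * (c ^ 2 * (A * D) * ρ / ‖η‖ ^ (d - 2)) := by
                ring
            _ ≤ (2 * d ^ 2 + 2) * (c ^ 2 * (A * D) * ρ / ‖η‖ ^ (d - 2)) := by
                gcongr
                nlinarith [sq_nonneg (d : ℝ)]
            _ = _ := by ring
  · have hcm : ∀ i, Measurable fun g : OrthGroup d =>
        ((((g : Eu d →L[ℝ] Eu d) (unitVec i₀)) i : ℝ) : ℂ) := fun i =>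
      (by fun_prop : Continuous fun g : OrthGroup d =>
        ((((g : Eu d →L[ℝ] Eu d) (unitVec i₀)) i : ℝ) : ℂ)).measurable
    have hcoord : ∀ (g : OrthGroup d) i, ‖((((g : Eu d →L[ℝ] Eu d) (unitVec i₀)) i : ℝ) : ℂ)‖ ≤ 1 :=
      fun g i => by
        rw [Complex.norm_real, ← IsTriangleModel.norm_axis (i₀ := i₀) g]
        exact PiLp.norm_apply_le _ i
    let b : Fin d → OrthGroup d → ℂ := fun i g =>
      ((((g : Eu d →L[ℝ] Eu d) (unitVec i₀)) i : ℝ) : ℂ) * IsTriangleModel.axisAverage i₀ σ θ η g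
    have hbm : ∀ i, Measurable (b i) := fun i => (hcm i).mul (h.measurable_axisAverage θ η)
    have hble : ∀ i g, ‖b i g‖ ≤ ‖IsTriangleModel.axisAverage i₀ σ θ η g‖ := fun i g => by
      simp only [b]
      rw [norm_mul]
      exact mul_le_of_le_one_left (norm_nonneg _) (hcoord g i)
    have hT : ∀ i, ∫⁻ ξ in Metric.closedBall 0 ρ,
        ‖IsTriangleModel.axisExtension i₀ μ θ (b i) ξ‖ₑ ^ 2 ≤
        ENNReal.ofReal (A * ρ * (D / ‖η‖ ^ (d - 2))) := by
      intro i
      refine hext _ 1 _ (hbm i) (fun g => (hble i g).trans (h.norm_axisAverage_le θ η g))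
        (by positivity) (le_trans (lintegral_mono fun g => ?_) hav)
      have := hble i g
      gcongr
      rw [← ofReal_norm, ← ofReal_norm]
      exact ENNReal.ofReal_le_ofReal this
    have hT' := hext _ ‖η‖ _ (h.measurable_axisAverageDeriv θ η) (h.norm_axisAverageDeriv_le θ η)
      (by positivity) hav'
    have hTm : ∀ b : OrthGroup d → ℂ, Measurable b →
        Measurable fun ξ => ‖IsTriangleModel.axisExtension i₀ μ θ b ξ‖ₑ ^ 2 := by
      intro b hb
      have hc1 : Continuous fun q : Eu d × OrthGroup d => Complex.exp (((θ * inner ℝ q.1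
          ((q.2 : Eu d →L[ℝ] Eu d) (unitVec i₀)) : ℝ) : ℂ) * Complex.I) := by
        have h2 : Continuous fun q : Eu d × OrthGroup d => (q.2 : Eu d →L[ℝ] Eu d) (unitVec i₀) :=
          hax.comp continuous_snd
        fun_prop
      have hm : Measurable fun q : Eu d × OrthGroup d => Complex.exp (((θ * inner ℝ q.1
          ((q.2 : Eu d →L[ℝ] Eu d) (unitVec i₀)) : ℝ) : ℂ) * Complex.I) * b q.2 :=
        hc1.measurable.mul (hb.comp measurable_snd)
      exact hm.stronglyMeasurable.integral_prod_right.measurable.enorm.pow_const 2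
    have hpt : ∀ ξ ∈ Metric.closedBall (0 : Eu d) ρ, ‖multDeriv ν θ ξ η‖ₑ ^ 2 ≤
        ENNReal.ofReal (c ^ 2) * (ENNReal.ofReal (2 * d * ρ ^ 2) *
          ∑ i, ‖IsTriangleModel.axisExtension i₀ μ θ (b i) ξ‖ₑ ^ 2 +
          2 * ‖IsTriangleModel.axisExtension i₀ μ θ (IsTriangleModel.axisAverageDeriv i₀ σ θ η) ξ‖ₑ
            ^ 2) := by
      intro ξ hξ
      rw [h.multDeriv_eq hν, ← hc, hsmul]
      gcongr
      set S := ∑ i, ((ξ i : ℝ) : ℂ) * Complex.I * IsTriangleModel.axisExtension i₀ μ θ (b i) ξ with hS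
      set R := IsTriangleModel.axisExtension i₀ μ θ (IsTriangleModel.axisAverageDeriv i₀ σ θ η) ξ
      have h1 : ‖S‖ ^ 2 ≤ d * ρ ^ 2 * ∑ i, ‖IsTriangleModel.axisExtension i₀ μ θ (b i) ξ‖ ^ 2 := by
        have h2 : ‖S‖ ≤ ∑ i, ρ * ‖IsTriangleModel.axisExtension i₀ μ θ (b i) ξ‖ := by
          refine (norm_sum_le _ _).trans (Finset.sum_le_sum fun i _ => ?_)
          rw [norm_mul, norm_mul, Complex.norm_I, mul_one, Complex.norm_real]
          gcongr
          exact (PiLp.norm_apply_le ξ i).trans (mem_closedBall_zero_iff.mp hξ)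
        calc ‖S‖ ^ 2 ≤ (∑ i, ρ * ‖IsTriangleModel.axisExtension i₀ μ θ (b i) ξ‖) ^ 2 := by gcongr
          _ ≤ (Finset.univ : Finset (Fin d)).card *
              ∑ i, (ρ * ‖IsTriangleModel.axisExtension i₀ μ θ (b i) ξ‖) ^ 2 :=
            sq_sum_le_card_mul_sum_sq
          _ = _ := by
            rw [Finset.card_univ, Fintype.card_fin]
            simp_rw [mul_pow]
            rw [← Finset.mul_sum, mul_assoc]
      have h3 : ‖S + R‖ ^ 2 ≤ 2 * d * ρ ^ 2 *
          ∑ i, ‖IsTriangleModel.axisExtension i₀ μ θ (b i) ξ‖ ^ 2 + 2 * ‖R‖ ^ 2 := by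
        have h4 := pow_le_pow_left₀ (norm_nonneg _) (norm_add_le S R) 2
        nlinarith [sq_nonneg (‖S‖ - ‖R‖)]
      have he : ∀ z : ℂ, ‖z‖ₑ ^ 2 = ENNReal.ofReal (‖z‖ ^ 2) := fun z => by
        rw [← ofReal_norm, ENNReal.ofReal_pow (norm_nonneg _)]
      simp_rw [he]
      rw [← ENNReal.ofReal_sum_of_nonneg (fun i _ => by positivity),
        ← ENNReal.ofReal_mul (by positivity),
        show (2 : ℝ≥0∞) = ENNReal.ofReal 2 by rw [ENNReal.ofReal_ofNat],
        ← ENNReal.ofReal_mul (by norm_num), ← ENNReal.ofReal_add (by positivity) (by positivity)]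
      exact ENNReal.ofReal_le_ofReal h3
    have hbd := fun i => hTm (b i) (hbm i)
    calc ∫⁻ ξ in Metric.closedBall 0 ρ, ‖multDeriv ν θ ξ η‖ₑ ^ 2
        ≤ ENNReal.ofReal (c ^ 2) * (ENNReal.ofReal (2 * d * ρ ^ 2) *
          (∑ i, ∫⁻ ξ in Metric.closedBall 0 ρ,
            ‖IsTriangleModel.axisExtension i₀ μ θ (b i) ξ‖ₑ ^ 2) +
          2 * ∫⁻ ξ in Metric.closedBall 0 ρ,
            ‖IsTriangleModel.axisExtension i₀ μ θ (IsTriangleModel.axisAverageDeriv i₀ σ θ η) ξ‖ₑ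
            ^ 2) := by
          refine (setLIntegral_mono' measurableSet_closedBall hpt).trans_eq ?_
          rw [lintegral_const_mul' _ _ ENNReal.ofReal_ne_top, lintegral_add_left,
            lintegral_const_mul' _ _ ENNReal.ofReal_ne_top, lintegral_finsetSum _ fun i _ => hbd i,
            lintegral_const_mul' _ _ (by simp)]
          exact (Finset.measurable_sum _ fun i _ => hbd i).const_mul _
      _ ≤ ENNReal.ofReal (c ^ 2) * (ENNReal.ofReal (2 * d * ρ ^ 2) *
          (∑ i : Fin d, ENNReal.ofReal (A * ρ * (D / ‖η‖ ^ (d - 2)))) +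
          2 * ENNReal.ofReal (A * ρ * (D * ‖η‖ ^ 2 / ‖η‖ ^ (d - 2)))) := by
          gcongr with i
          exact hT i
      _ ≤ _ := by
          have e0 : ∀ x : ℝ, 2 * ENNReal.ofReal x = ENNReal.ofReal (2 * x) := fun x => by
            rw [ENNReal.ofReal_mul (by norm_num), ENNReal.ofReal_ofNat]
          rw [← ENNReal.ofReal_sum_of_nonneg (fun i _ => by positivity),
            ← ENNReal.ofReal_mul (by positivity),
            e0, ← ENNReal.ofReal_add (by positivity) (by positivity),
            ← ENNReal.ofReal_mul (by positivity)]
          refine ENNReal.ofReal_le_ofReal ?_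
          rw [Finset.sum_const, Finset.card_univ, Fintype.card_fin, nsmul_eq_mul]
          set U := c ^ 2 * (A * D) * ρ / ‖η‖ ^ (d - 2) with hU
          have hU0 : 0 ≤ U := by positivity
          have e1 : c ^ 2 * (2 * d * ρ ^ 2 * (d * (A * ρ * (D / ‖η‖ ^ (d - 2)))) +
              2 * (A * ρ * (D * ‖η‖ ^ 2 / ‖η‖ ^ (d - 2)))) =
              U * (2 * d ^ 2 * ρ ^ 2 + 2 * ‖η‖ ^ 2) := by rw [hU]; ring
          have e2 : c ^ 2 * (2 * d ^ 2 + 2) * (A * D) * ρ * (ρ ^ 2 + ‖η‖ ^ 2) / ‖η‖ ^ (d - 2) =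
              U * ((2 * d ^ 2 + 2) * (ρ ^ 2 + ‖η‖ ^ 2)) := by rw [hU]; ring
          rw [e1, e2]
          refine mul_le_mul_of_nonneg_left ?_ hU0
          nlinarith [sq_nonneg ρ, sq_nonneg ‖η‖, mul_nonneg (sq_nonneg (d : ℝ)) (sq_nonneg ‖η‖)]

/-! ### Plancherel's theorem for integrable functions -/

section Plancherel

variable {V : Type*} [NormedAddCommGroup V] [InnerProductSpace ℝ V] [FiniteDimensional ℝ V]
  [MeasurableSpace V] [BorelSpace V]

/-- The two inverse transforms agree as distributions: against a test function both move the
transform to that function, the L² one by duality of tempered distributions, the integral one by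
Fubini. -/
lemma MeasureTheory.MemLp.fourierInv_toLp_ae_eq {f : V → ℂ} (hf : MemLp f 2 volume)
    (hi : Integrable f volume) : (𝓕⁻ (hf.toLp f) : Lp ℂ 2 (volume : Measure V)) =ᵐ[volume] 𝓕⁻ f := by
  have hcont : Continuous (𝓕⁻ f) := by
    have h1 : 𝓕⁻ f = fun x => 𝓕 f (-x) := by
      ext x; exact Real.fourierInv_eq_fourier_neg f x
    rw [h1]
    exact (VectorFourier.fourierIntegral_continuous Real.continuous_fourierChar
      (continuous_inner) hi).comp continuous_neg
  refine ae_eq_of_integral_contDiff_smul_eq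
    ((Lp.memLp _).locallyIntegrable (by norm_num)) hcont.locallyIntegrable ?_
  intro g hg hgc
  have hg₁ : HasCompactSupport (Complex.ofRealCLM ∘ g) := hgc.comp_left rfl
  have hg₂ : ContDiff ℝ ((⊤ : ℕ∞) : WithTop ℕ∞) (Complex.ofRealCLM ∘ g) :=
    Complex.ofRealCLM.contDiff.comp hg
  set φ : 𝓢(V, ℂ) := hg₁.toSchwartzMap hg₂ with hφ
  have hφa : ∀ x, φ x = (g x : ℂ) := fun x => rfl
  calc ∫ x, g x • (𝓕⁻ (hf.toLp f) : Lp ℂ 2 (volume : Measure V)) x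
      = ((𝓕⁻ (hf.toLp f) : Lp ℂ 2 (volume : Measure V)) : 𝓢'(V, ℂ)) φ := by
        rw [Lp.toTemperedDistribution_apply]
        simp [hφa]
    _ = ∫ x, (𝓕⁻ φ) x • f x := by
        rw [← Lp.fourierInv_toTemperedDistribution_eq, TemperedDistribution.fourierInv_apply,
          Lp.toTemperedDistribution_apply]
        refine integral_congr_ae ?_
        filter_upwards [hf.coeFn_toLp] with x hx
        rw [hx]
    _ = ∫ x, g x • 𝓕⁻ f x := by
        have h2 := VectorFourier.integral_fourierIntegral_smul_eq_flip (μ := (volume : Measure V))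
          (ν := (volume : Measure V)) (L := -innerₗ V) (f := fun x => φ x) (g := f)
          Real.continuous_fourierChar continuous_inner.neg φ.integrable hi
        have e1 : ∀ h : V → ℂ, VectorFourier.fourierIntegral Real.fourierChar
            (volume : Measure V) (-innerₗ V) h = 𝓕⁻ h := by
          intro h; ext x
          rw [Real.fourierInv_eq, VectorFourier.fourierIntegral]
          simp
        have e2 : ∀ h : V → ℂ, VectorFourier.fourierIntegral Real.fourierChar
            (volume : Measure V) (-innerₗ V).flip h = 𝓕⁻ h := by
          intro h; ext x
          rw [Real.fourierInv_eq, VectorFourier.fourierIntegral]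
          simp [real_inner_comm]
        rw [e1, e2] at h2
        simp only [SchwartzMap.fourierInv_coe]
        refine h2.trans (integral_congr_ae (Eventually.of_forall fun x => ?_))
        simp [hφa]

/-- For f ∈ L² this is Plancherel's identity. As an inequality it also covers integrable f outside
L², where the right-hand side is infinite. -/
lemma lintegral_fourierInv_sq_le {f : V → ℂ} (hi : Integrable f volume) (hm : Measurable f) :
    ∫⁻ x, ‖𝓕⁻ f x‖ₑ ^ 2 ≤ ∫⁻ x, ‖f x‖ₑ ^ 2 := by
  by_cases hfin : ∫⁻ x, ‖f x‖ₑ ^ 2 = ∞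
  · rw [hfin]; exact le_top
  have key : ∀ g : V → ℂ, eLpNorm g 2 volume ^ 2 = ∫⁻ x, ‖g x‖ₑ ^ 2 := by
    intro g
    rw [eLpNorm_eq_lintegral_rpow_enorm_toReal (by norm_num) (by norm_num),
      ← ENNReal.rpow_natCast, ← ENNReal.rpow_mul]
    norm_num
  have hf : MemLp f 2 volume := by
    refine ⟨hm.aestronglyMeasurable, ?_⟩
    rw [← key] at hfin
    exact lt_top_iff_ne_top.mpr fun h => hfin (by rw [h]; rfl)
  rw [← key, ← key, ← eLpNorm_congr_ae (hf.fourierInv_toLp_ae_eq hi)]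
  gcongr
  rw [← Lp.enorm_def]
  have h1 : ‖(𝓕⁻ (hf.toLp f) : Lp ℂ 2 (volume : Measure V))‖ = ‖hf.toLp f‖ :=
    (Lp.fourierTransformₗᵢ V ℂ).symm.norm_map _
  rw [← ofReal_norm, h1, ofReal_norm, Lp.enorm_toLp]

end Plancherel

/-! ### Weighted convolutions -/

section Bilinear

variable {V : Type*} [NormedAddCommGroup V] [MeasurableSpace V] [BorelSpace V]
  [SecondCountableTopology V] (μ : Measure V) [SFinite μ] [μ.IsAddHaarMeasure]

lemma lintegral_lintegral_shear (F : V → V → ℝ≥0∞) (hF : Measurable (Function.uncurry F)) :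
    ∫⁻ ζ, ∫⁻ η, F (ζ - η) η ∂μ ∂μ = ∫⁻ ξ, ∫⁻ η, F ξ η ∂μ ∂μ := by
  have h1 : Measurable fun q : V × V => F (q.1 - q.2) q.2 :=
    hF.comp ((measurable_fst.sub measurable_snd).prodMk measurable_snd)
  rw [lintegral_lintegral_swap h1.aemeasurable, lintegral_lintegral_swap hF.aemeasurable]
  refine lintegral_congr fun η => ?_
  exact lintegral_sub_right_eq_self (fun ζ => F ζ η) η

/-- Cauchy–Schwarz bound for a weighted convolution whose weight is square integrable in the
first variable. -/
lemma lintegral_twisted_conv_sq_le {α β : V → ℝ≥0∞} {κ : V → V → ℝ≥0∞} (hα : Measurable α)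
    (hβ : Measurable β) (hκ : Measurable (Function.uncurry κ)) {A : ℝ≥0∞}
    (hA : ∀ η, ∫⁻ ξ, κ ξ η ^ 2 ∂μ ≤ A)
    (hfin : ∫⁻ ζ, (∫⁻ η, α (ζ - η) * β η * κ (ζ - η) η ∂μ) ^ 2 ∂μ ≠ ∞) :
    ∫⁻ ζ, (∫⁻ η, α (ζ - η) * β η * κ (ζ - η) η ∂μ) ^ 2 ∂μ ≤
      A * (∫⁻ ξ, α ξ ^ 2 ∂μ) * ∫⁻ η, β η ^ 2 ∂μ := by
  set C : V → ℝ≥0∞ := fun ζ => ∫⁻ η, α (ζ - η) * β η * κ (ζ - η) η ∂μ with hC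
  have hκ' : Measurable fun q : V × V => κ q.1 q.2 := hκ
  have hCm : Measurable C := by
    have : Measurable fun q : V × V => α (q.1 - q.2) * β q.2 * κ (q.1 - q.2) q.2 := by
      have h1 : Measurable fun q : V × V => κ (q.1 - q.2) q.2 :=
        hκ.comp ((measurable_fst.sub measurable_snd).prodMk measurable_snd)
      fun_prop
    exact this.lintegral_prod_right'
  set X := ∫⁻ ζ, C ζ ^ 2 ∂μ with hX
  have hκA : ∫⁻ ξ, ∫⁻ η, (β η * κ ξ η) ^ 2 ∂μ ∂μ ≤ A * ∫⁻ η, β η ^ 2 ∂μ := by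
    rw [lintegral_lintegral_swap (by fun_prop), ← lintegral_const_mul _ (hβ.pow_const 2)]
    refine lintegral_mono fun η => ?_
    simp only [mul_pow]
    rw [lintegral_const_mul _ (by fun_prop), mul_comm]
    gcongr
    exact hA η
  have hαC : ∫⁻ ξ, ∫⁻ η, (α ξ * C (ξ + η)) ^ 2 ∂μ ∂μ = (∫⁻ ξ, α ξ ^ 2 ∂μ) * X := by
    rw [← lintegral_mul_const _ (hα.pow_const 2)]
    refine lintegral_congr fun ξ => ?_
    simp only [mul_pow]
    rw [lintegral_const_mul _ (by fun_prop),
      lintegral_add_left_eq_self (fun ζ => C ζ ^ 2) ξ]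
  -- One of the two factors C in X is expanded. Keeping C(ξ + η) with α(ξ) and κ with β(η),
  -- Cauchy–Schwarz in (ξ, η) gives X² ≤ (‖α‖² X)(A ‖β‖²). One X is then cancelled, which is where
  -- `hfin` is needed.
  have hXle : X ≤ ∫⁻ q, (α q.1 * C (q.1 + q.2)) * (β q.2 * κ q.1 q.2) ∂(μ.prod μ) := by
    rw [lintegral_prod _ (by fun_prop), ← lintegral_lintegral_shear μ
      (fun ξ η => (α ξ * C (ξ + η)) * (β η * κ ξ η)) (by unfold Function.uncurry; fun_prop)]
    refine lintegral_mono fun ζ => ?_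
    rw [sq]
    nth_rewrite 2 [hC]
    simp only
    rw [← lintegral_const_mul _ ?_]
    · refine lintegral_mono fun η => le_of_eq ?_
      rw [sub_add_cancel]; ring
    · have h1 : Measurable fun η : V => κ (ζ - η) η :=
        hκ.comp ((measurable_const.sub measurable_id).prodMk measurable_id)
      fun_prop
  have hCS := ENNReal.lintegral_mul_le_Lp_mul_Lq (μ.prod μ) Real.HolderConjugate.two_two
    (f := fun q => α q.1 * C (q.1 + q.2)) (g := fun q => β q.2 * κ q.1 q.2)
    (by fun_prop) (by fun_prop)
  have hsq : X ^ 2 ≤ ((∫⁻ ξ, α ξ ^ 2 ∂μ) * X) * (A * ∫⁻ η, β η ^ 2 ∂μ) := by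
    have h2 := pow_le_pow_left' (hXle.trans hCS) 2
    refine h2.trans ?_
    rw [mul_pow, ← ENNReal.rpow_natCast, ← ENNReal.rpow_natCast, ← ENNReal.rpow_mul,
      ← ENNReal.rpow_mul]
    norm_num
    rw [lintegral_prod _ (by fun_prop), lintegral_prod _ (by fun_prop), hαC]
    gcongr
  by_cases h0 : X = 0
  · rw [h0]; exact zero_le
  rw [sq] at hsq
  have : X * X ≤ X * (A * (∫⁻ ξ, α ξ ^ 2 ∂μ) * ∫⁻ η, β η ^ 2 ∂μ) := hsq.trans_eq (by ring)
  exact (ENNReal.mul_le_mul_iff_right h0 hfin).mp this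

end Bilinear

/-! ### L² bound for bilinear multiplier operators -/

section BilinearOscillatory

variable {V : Type*} [NormedAddCommGroup V] [InnerProductSpace ℝ V] [FiniteDimensional ℝ V]
  [MeasurableSpace V] [BorelSpace V]

/-- The bilinear multiplier operator with symbol `k`, applied to functions with Fourier
transforms `a` and `b`. -/
noncomputable def bilinearMultiplier (k : V → V → ℂ) (a b : V → ℂ) (x : V) : ℂ :=
  ∫ q : V × V, a q.1 * b q.2 * k q.1 q.2 *
    Complex.exp (((2 * Real.pi * inner ℝ x (q.1 + q.2) : ℝ) : ℂ) * Complex.I)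

/-- In the variable ζ = ξ + η the operator is the inverse Fourier transform of a twisted
convolution, so Plancherel and the weighted Cauchy–Schwarz bound apply. The pointwise bounds `M` and
`Ma` only guarantee integrability and finiteness; they do not enter the constant. -/
theorem lintegral_bilinearMultiplier_sq_le {k : V → V → ℂ} (hk : Measurable (Function.uncurry k))
    {M : ℝ} (hkM : ∀ ξ η, ‖k ξ η‖ ≤ M) {a b : V → ℂ} (ha : Measurable a) (hb : Measurable b)
    (hai : Integrable a) (hbi : Integrable b) {Ma : ℝ} (haM : ∀ ξ, ‖a ξ‖ ≤ Ma)
    {A : ℝ≥0∞} (hA : ∀ η, ∫⁻ ξ, ‖k ξ η‖ₑ ^ 2 ≤ A) :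
    ∫⁻ x, ‖bilinearMultiplier k a b x‖ₑ ^ 2 ≤
      A * (∫⁻ ξ, ‖a ξ‖ₑ ^ 2) * ∫⁻ η, ‖b η‖ₑ ^ 2 := by
  set c : V → ℂ := fun ζ => ∫ η, a (ζ - η) * b η * k (ζ - η) η with hc
  have hk' : Measurable fun q : V × V => k q.1 q.2 := hk
  have hsm : Measurable fun q : V × V => a (q.1 - q.2) * b q.2 * k (q.1 - q.2) q.2 := by
    have h1 : Measurable fun q : V × V => k (q.1 - q.2) q.2 :=
      hk.comp ((measurable_fst.sub measurable_snd).prodMk measurable_snd)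
    fun_prop
  have hcm : Measurable c := hsm.stronglyMeasurable.integral_prod_right.measurable
  have hint : Integrable (fun q : V × V => a q.1 * b q.2 * k q.1 q.2)
      ((volume : Measure V).prod volume) :=
    (hai.mul_prod hbi).mul_bdd hk'.aestronglyMeasurable
      (Eventually.of_forall fun q => hkM _ _)
  have hshear : MeasurePreserving (fun q : V × V => (q.1 - q.2, q.2))
      ((volume : Measure V).prod volume) ((volume : Measure V).prod volume) := by
    have := measurePreserving_sub_prod (volume : Measure V) (volume : Measure V)
    exact this
  have hint' : Integrable (fun q : V × V => a (q.1 - q.2) * b q.2 * k (q.1 - q.2) q.2)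
      ((volume : Measure V).prod volume) := hshear.integrable_comp_of_integrable hint
  have hci : Integrable c := hint'.integral_prod_left
  have hG : bilinearMultiplier k a b = 𝓕⁻ c := by
    ext x
    rw [Real.fourierInv_eq', bilinearMultiplier, Measure.volume_eq_prod]
    have he : Measurable fun q : V × V => Complex.exp (((2 * Real.pi *
        inner ℝ x (q.1 + q.2) : ℝ) : ℂ) * Complex.I) :=
      Continuous.measurable (by fun_prop)
    have hF : Integrable (fun q : V × V => a q.1 * b q.2 * k q.1 q.2 *
        Complex.exp (((2 * Real.pi * inner ℝ x (q.1 + q.2) : ℝ) : ℂ) * Complex.I))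
        ((volume : Measure V).prod volume) :=
      hint.mul_bdd he.aestronglyMeasurable
        (Eventually.of_forall fun q => (Complex.norm_exp_ofReal_mul_I _).le)
    rw [← hshear.map_eq, integral_map hshear.measurable.aemeasurable
      (by rw [hshear.map_eq]; exact hF.aestronglyMeasurable),
      integral_prod]
    swap
    · exact hshear.integrable_comp_of_integrable hF
    refine integral_congr_ae (Eventually.of_forall fun ζ => ?_)
    simp only [sub_add_cancel]
    rw [integral_mul_const, smul_eq_mul, mul_comm, real_inner_comm x ζ]
  have hle : ∀ ζ, ‖c ζ‖ₑ ≤ ∫⁻ η, ‖a (ζ - η)‖ₑ * ‖b η‖ₑ * ‖k (ζ - η) η‖ₑ := fun ζ =>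
    (enorm_integral_le_lintegral_enorm _).trans_eq (by simp only [enorm_mul])
  rw [hG]
  refine (lintegral_fourierInv_sq_le hci hcm).trans ((lintegral_mono fun ζ =>
    pow_le_pow_left' (hle ζ) 2).trans ?_)
  refine lintegral_twisted_conv_sq_le volume (α := fun ξ => ‖a ξ‖ₑ) (β := fun η => ‖b η‖ₑ)
    (κ := fun ξ η => ‖k ξ η‖ₑ) ha.enorm hb.enorm hk.enorm hA ?_
  have hB : ∀ ζ, ∫⁻ η, ‖a (ζ - η)‖ₑ * ‖b η‖ₑ * ‖k (ζ - η) η‖ₑ ≤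
      ENNReal.ofReal Ma * ENNReal.ofReal M * ∫⁻ η, ‖b η‖ₑ := by
    intro ζ
    rw [← lintegral_const_mul _ hb.enorm]
    refine lintegral_mono fun η => ?_
    have h1 : ‖a (ζ - η)‖ₑ ≤ ENNReal.ofReal Ma := by
      rw [← ofReal_norm]; exact ENNReal.ofReal_le_ofReal (haM _)
    have h2 : ‖k (ζ - η) η‖ₑ ≤ ENNReal.ofReal M := by
      rw [← ofReal_norm]; exact ENNReal.ofReal_le_ofReal (hkM _ _)
    calc _ ≤ ENNReal.ofReal Ma * ‖b η‖ₑ * ENNReal.ofReal M := by gcongr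
      _ = _ := by ring
  have hbt : ∫⁻ η, ‖b η‖ₑ ≠ ∞ := hbi.2.ne
  have hI : ∫⁻ ζ, ∫⁻ η, ‖a (ζ - η)‖ₑ * ‖b η‖ₑ * ‖k (ζ - η) η‖ₑ ≠ ∞ := by
    have h3 := hint'.2
    rw [HasFiniteIntegral, lintegral_prod _ hsm.enorm.aemeasurable] at h3
    simpa only [enorm_mul] using h3.ne
  have hK : ENNReal.ofReal Ma * ENNReal.ofReal M * ∫⁻ η, ‖b η‖ₑ ≠ ∞ :=
    ENNReal.mul_ne_top (ENNReal.mul_ne_top ENNReal.ofReal_ne_top ENNReal.ofReal_ne_top) hbt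
  refine ne_top_of_le_ne_top (ENNReal.mul_ne_top hK hI) ?_
  calc ∫⁻ ζ, (∫⁻ η, ‖a (ζ - η)‖ₑ * ‖b η‖ₑ * ‖k (ζ - η) η‖ₑ) ^ 2
      ≤ ∫⁻ ζ, (ENNReal.ofReal Ma * ENNReal.ofReal M * ∫⁻ η, ‖b η‖ₑ) *
        ∫⁻ η, ‖a (ζ - η)‖ₑ * ‖b η‖ₑ * ‖k (ζ - η) η‖ₑ := by
        refine lintegral_mono fun ζ => ?_
        simp only
        rw [sq]
        gcongr
        exact hB ζ
    _ = _ := by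
        rw [lintegral_const_mul' _ _ hK]

end BilinearOscillatory

/-! ### Regularity of the multiplier in the radius -/

section MultRegularity

variable {d : ℕ} {ν : Measure (Eu d × Eu d)}

lemma measurable_mult [SFinite ν] :
    Measurable fun q : ℝ × Eu d × Eu d => mult ν q.1 q.2.1 q.2.2 := by
  have h : Continuous fun r : (ℝ × Eu d × Eu d) × (Eu d × Eu d) =>
      Complex.exp (((r.1.1 * (inner ℝ r.1.2.1 r.2.1 + inner ℝ r.1.2.2 r.2.2) : ℝ) : ℂ) *
        Complex.I) := by fun_prop
  exact h.measurable.stronglyMeasurable.integral_prod_right.measurable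

lemma measurable_multDeriv [SFinite ν] :
    Measurable fun q : ℝ × Eu d × Eu d => multDeriv ν q.1 q.2.1 q.2.2 := by
  have h : Continuous fun r : (ℝ × Eu d × Eu d) × (Eu d × Eu d) =>
      ((inner ℝ r.1.2.1 r.2.1 + inner ℝ r.1.2.2 r.2.2 : ℝ) : ℂ) * Complex.I *
      Complex.exp (((r.1.1 * (inner ℝ r.1.2.1 r.2.1 + inner ℝ r.1.2.2 r.2.2) : ℝ) : ℂ) *
        Complex.I) := by fun_prop
  exact h.measurable.stronglyMeasurable.integral_prod_right.measurable

lemma norm_mult_le [IsFiniteMeasure ν] (θ : ℝ) (ξ η : Eu d) : ‖mult ν θ ξ η‖ ≤ ν.real Set.univ :=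
  (norm_integral_le_of_norm_le_const (C := 1) (Eventually.of_forall fun _ =>
    (Complex.norm_exp_ofReal_mul_I _).le)).trans_eq (one_mul _)

lemma IsTriangleInvariant.norm_multDeriv_le (hν : IsTriangleInvariant ν) (θ : ℝ) (ξ η : Eu d) :
    ‖multDeriv ν θ ξ η‖ ≤ (‖ξ‖ + ‖η‖) * ν.real Set.univ := by
  have := hν.finite
  refine norm_integral_le_of_norm_le_const (C := ‖ξ‖ + ‖η‖) ?_
  filter_upwards [hν.supp] with p hp
  rw [norm_mul, Complex.norm_exp_ofReal_mul_I, norm_mul, Complex.norm_I, mul_one, mul_one,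
    Complex.norm_real]
  refine (norm_add_le _ _).trans (add_le_add ?_ ?_)
  · simpa [hp.1] using norm_inner_le_norm (𝕜 := ℝ) ξ p.1
  · simpa [hp.2.1] using norm_inner_le_norm (𝕜 := ℝ) η p.2

lemma mult_map_swap (θ : ℝ) (ξ η : Eu d) : mult (ν.map Prod.swap) θ η ξ = mult ν θ ξ η := by
  rw [mult, mult, integral_map measurable_swap.aemeasurable
    (Continuous.aestronglyMeasurable (by fun_prop))]
  simp only [Prod.fst_swap, Prod.snd_swap, add_comm]

lemma IsTriangleInvariant.hasDerivAt_mult (hν : IsTriangleInvariant ν) (θ : ℝ) (ξ η : Eu d) :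
    HasDerivAt (fun θ => mult ν θ ξ η) (multDeriv ν θ ξ η) θ := by
  have := hν.finite
  refine (hasDerivAt_integral_of_dominated_loc_of_deriv_le (μ := ν) (s := Set.univ)
    (F := fun (θ : ℝ) (p : Eu d × Eu d) =>
      Complex.exp (((θ * (inner ℝ ξ p.1 + inner ℝ η p.2) : ℝ) : ℂ) * Complex.I))
    (F' := fun (θ : ℝ) (p : Eu d × Eu d) => ((inner ℝ ξ p.1 + inner ℝ η p.2 : ℝ) : ℂ) * Complex.I *
      Complex.exp (((θ * (inner ℝ ξ p.1 + inner ℝ η p.2) : ℝ) : ℂ) * Complex.I))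
    (bound := fun _ => ‖ξ‖ + ‖η‖) univ_mem (Eventually.of_forall fun θ =>
      Continuous.aestronglyMeasurable (by fun_prop)) ?_
      (Continuous.aestronglyMeasurable (by fun_prop)) ?_ (integrable_const _) ?_).2
  · exact (integrable_const (1 : ℝ)).mono' (Continuous.aestronglyMeasurable (by fun_prop))
      (Eventually.of_forall fun p => (Complex.norm_exp_ofReal_mul_I _).le)
  · filter_upwards [hν.supp] with p hp θ _
    rw [norm_mul, Complex.norm_exp_ofReal_mul_I, norm_mul, Complex.norm_I, mul_one, mul_one,
      Complex.norm_real]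
    refine (norm_add_le _ _).trans (add_le_add ?_ ?_)
    · simpa [hp.1] using norm_inner_le_norm (𝕜 := ℝ) ξ p.1
    · simpa [hp.2.1] using norm_inner_le_norm (𝕜 := ℝ) η p.2
  · refine Eventually.of_forall fun p θ _ => ?_
    set r := inner ℝ ξ p.1 + inner ℝ η p.2
    have h1 : HasDerivAt (fun θ : ℝ => ((θ * r : ℝ) : ℂ) * Complex.I) ((r : ℂ) * Complex.I) θ := by
      have h2 : HasDerivAt (fun θ : ℝ => θ * r) r θ := by
        simpa using (hasDerivAt_id θ).mul_const r
      exact h2.ofReal_comp.mul_const _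
    convert! h1.cexp using 1
    ring

end MultRegularity

/-! ### Dyadic annuli -/

section Dyadic

/-- The index `n` of the dyadic annulus `2^(n-1) ≤ r < 2^n` containing `r` (`n = 0` if
`r < 1`). -/
noncomputable def dyadicIndex (r : ℝ) : ℕ := Nat.size ⌊r⌋₊

lemma measurable_dyadicIndex : Measurable dyadicIndex :=
  (measurable_of_countable Nat.size).comp Nat.measurable_floor

lemma lt_two_pow_dyadicIndex (r : ℝ) : r < 2 ^ dyadicIndex r := by
  have h := Nat.lt_size_self ⌊r⌋₊
  have h2 : r < ((2 ^ dyadicIndex r : ℕ) : ℝ) :=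
    (Nat.floor_lt' (by positivity)).mp h
  exact_mod_cast h2

lemma two_pow_dyadicIndex_le {r : ℝ} (h0 : dyadicIndex r ≠ 0) : (2 : ℝ) ^ dyadicIndex r ≤ 2 * r := by
  obtain ⟨n, hn⟩ := Nat.exists_eq_succ_of_ne_zero h0
  have h1 : 2 ^ n ≤ ⌊r⌋₊ := Nat.lt_size.mp (by
    change n < dyadicIndex r
    omega)
  have h2 : ((2 ^ n : ℕ) : ℝ) ≤ r := (Nat.le_floor_iff' (by positivity)).mp h1
  rw [hn, pow_succ]
  push_cast at h2
  linarith

/-- The multiplier bounds on a dyadic annulus in the larger frequency. -/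
theorem IsTriangleInvariant.exists_lintegral_mult_dyadic_le {d : ℕ} (hd : 4 ≤ d)
    {ν : Measure (Eu d × Eu d)} (hν : IsTriangleInvariant ν) :
    ∃ K : ℝ, 0 ≤ K ∧ ∀ θ : ℝ, 1 ≤ |θ| → ∀ η : Eu d,
      ∫⁻ ξ in Metric.closedBall 0 ‖η‖, ‖mult ν θ ξ η‖ₑ ^ 2 ≤
        ENNReal.ofReal (K / (2 ^ dyadicIndex ‖η‖) ^ (d - 3)) ∧
      ∫⁻ ξ in Metric.closedBall 0 ‖η‖, ‖multDeriv ν θ ξ η‖ₑ ^ 2 ≤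
        ENNReal.ofReal (K * (2 ^ dyadicIndex ‖η‖) ^ 2 / (2 ^ dyadicIndex ‖η‖) ^ (d - 3)) := by
  have := hν.finite
  obtain ⟨C, hC0, hC⟩ := hν.exists_lintegral_mult_le hd
  set m := ν.real Set.univ with hm
  set w := (volume : Measure (Eu d)).real (Metric.closedBall 0 1) with hw
  have hm0 : 0 ≤ m := measureReal_nonneg
  have hw0 : 0 ≤ w := measureReal_nonneg
  -- The first summand serves n = 0, that is |η| < 1, by the trivial bounds m and 2m for the
  -- multiplier and its derivative on the unit ball. The second comes from the decay estimate with ρ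
  -- = |η|; replacing |η| by 2^n ≤ 2|η| costs 2^{d-3}.
  refine ⟨4 * m ^ 2 * w + 2 * C * 2 ^ (d - 3), by positivity, fun θ hθ η => ?_⟩
  have hP : 0 ≤ 2 * C * (2 : ℝ) ^ (d - 3) := by positivity
  have hP' : 0 ≤ 4 * m ^ 2 * w := by positivity
  set n := dyadicIndex ‖η‖ with hn
  have hsq : ∀ z : ℂ, ∀ c : ℝ, ‖z‖ ≤ c → ‖z‖ₑ ^ 2 ≤ ENNReal.ofReal (c ^ 2) := fun z c hc => by
    rw [← ofReal_norm, ← ENNReal.ofReal_pow (norm_nonneg _)]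
    exact ENNReal.ofReal_le_ofReal (by gcongr)
  by_cases h0 : n = 0
  · have h1 : ‖η‖ < 1 := by simpa [← hn, h0] using lt_two_pow_dyadicIndex ‖η‖
    have hball : ∀ (g : Eu d → ℝ≥0∞) (c : ℝ), 0 ≤ c → (∀ ξ, ‖ξ‖ ≤ 1 → g ξ ≤ ENNReal.ofReal c) →
        ∫⁻ ξ in Metric.closedBall 0 ‖η‖, g ξ ≤ ENNReal.ofReal (c * w) := by
      intro g c hc hg
      calc ∫⁻ ξ in Metric.closedBall 0 ‖η‖, g ξ ≤ ∫⁻ ξ in Metric.closedBall 0 1, g ξ :=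
            lintegral_mono_set (Metric.closedBall_subset_closedBall h1.le)
        _ ≤ ∫⁻ ξ in Metric.closedBall (0 : Eu d) 1, ENNReal.ofReal c :=
            setLIntegral_mono' measurableSet_closedBall fun ξ hξ =>
              hg ξ (mem_closedBall_zero_iff.mp hξ)
        _ = _ := by
            rw [setLIntegral_const, ENNReal.ofReal_mul hc, hw, ofReal_measureReal measure_closedBall_lt_top.ne]
    rw [h0]
    simp only [pow_zero, one_pow, div_one, mul_one]
    constructor
    · refine (hball _ (m ^ 2) (by positivity) fun ξ _ => hsq _ _ (norm_mult_le _ _ _)).trans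
        (ENNReal.ofReal_le_ofReal ?_)
      nlinarith [mul_nonneg (sq_nonneg m) hw0]
    · refine (hball _ ((2 * m) ^ 2) (by positivity) fun ξ hξ => hsq _ _
        ((hν.norm_multDeriv_le _ _ _).trans ?_)).trans (ENNReal.ofReal_le_ofReal ?_)
      · gcongr; linarith
      · nlinarith
  · have h2 : (2 : ℝ) ^ n ≤ 2 * ‖η‖ := two_pow_dyadicIndex_le h0
    have h3 : ‖η‖ ≤ 2 ^ n := (lt_two_pow_dyadicIndex _).le
    have h4 : 1 ≤ ‖η‖ := by
      have h5 : (2 : ℝ) ^ 1 ≤ 2 ^ n := pow_le_pow_right₀ (by norm_num) (by omega)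
      linarith
    have h5 : 0 < ‖η‖ := by linarith
    have hη : η ≠ 0 := norm_pos_iff.mp h5
    have h6 : ‖η‖ ^ (d - 2) = ‖η‖ ^ (d - 3) * ‖η‖ := by
      rw [← pow_succ]; congr 1; omega
    have h7 : 1 / ‖η‖ ^ (d - 3) ≤ 2 ^ (d - 3) / (2 ^ n) ^ (d - 3) := by
      rw [div_le_div_iff₀ (by positivity) (by positivity), one_mul, ← mul_pow]
      gcongr
    obtain ⟨H1, H2⟩ := hC θ hθ ‖η‖ h4 η hη
    constructor
    · refine H1.trans (ENNReal.ofReal_le_ofReal ?_)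
      calc C * ‖η‖ / ‖η‖ ^ (d - 2) = C * (1 / ‖η‖ ^ (d - 3)) := by rw [h6]; field_simp
        _ ≤ C * (2 ^ (d - 3) / (2 ^ n) ^ (d - 3)) := by gcongr
        _ = C * 2 ^ (d - 3) / (2 ^ n) ^ (d - 3) := by ring
        _ ≤ _ := by gcongr; linarith
    · refine H2.trans (ENNReal.ofReal_le_ofReal ?_)
      calc C * ‖η‖ * (‖η‖ ^ 2 + ‖η‖ ^ 2) / ‖η‖ ^ (d - 2)
          = 2 * C * ‖η‖ ^ 2 * (1 / ‖η‖ ^ (d - 3)) := by rw [h6]; field_simp; ring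
        _ ≤ 2 * C * (2 ^ n) ^ 2 * (2 ^ (d - 3) / (2 ^ n) ^ (d - 3)) := by gcongr
        _ = 2 * C * 2 ^ (d - 3) * (2 ^ n) ^ 2 / (2 ^ n) ^ (d - 3) := by ring
        _ ≤ _ := by gcongr; linarith

end Dyadic

/-! ### Covering numbers and Minkowski dimension -/

section Covering

variable {E : Set ℝ}

lemma exists_cover_intervalCoveringNumber (hE : E ⊆ Set.Icc 1 2) {δ : ℝ} (hδ : 0 < δ) :
    ∃ c : Fin (intervalCoveringNumber E δ) → ℝ, E ⊆ ⋃ i, Set.Icc (c i) (c i + δ) := by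
  refine Nat.sInf_mem (s := {n : ℕ | ∃ c : Fin n → ℝ, E ⊆ ⋃ i, Set.Icc (c i) (c i + δ)}) ?_
  -- In ℕ the infimum of the empty set is 0, so it has to be shown that some finite cover exists.
  refine ⟨⌊1 / δ⌋₊ + 1, fun i => 1 + i * δ, fun t ht => ?_⟩
  have h1 : 0 ≤ t - 1 := by linarith [(hE ht).1]
  have h2 : (t - 1) / δ ≤ 1 / δ := by gcongr; linarith [(hE ht).2]
  have h3 : ⌊(t - 1) / δ⌋₊ < ⌊1 / δ⌋₊ + 1 := Nat.lt_succ_of_le (Nat.floor_le_floor h2)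
  refine Set.mem_iUnion.mpr ⟨⟨_, h3⟩, ?_, ?_⟩
  · have := Nat.floor_le (div_nonneg h1 hδ.le)
    rw [le_div_iff₀ hδ] at this
    simp only
    linarith
  · have := Nat.lt_floor_add_one ((t - 1) / δ)
    rw [div_lt_iff₀ hδ] at this
    simp only
    linarith

/-- A cover of a subset of `[1, 2]` may be taken inside `[1, 2]`. -/
lemma exists_cover_inside (hE : E ⊆ Set.Icc 1 2) {δ : ℝ} (hδ : 0 < δ) :
    ∃ c : Fin (intervalCoveringNumber E δ) → ℝ, (∀ i, 1 ≤ c i) ∧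
      E ⊆ ⋃ i, Set.Icc (c i) (c i + δ) := by
  obtain ⟨c, hc⟩ := exists_cover_intervalCoveringNumber hE hδ
  -- Raising the left endpoints to 1 keeps every radius in the intervals at least 1, which makes |θ|
  -- ≥ 1 in the multiplier bounds.
  refine ⟨fun i => max 1 (c i), fun i => le_max_left _ _, fun t ht => ?_⟩
  obtain ⟨i, h1, h2⟩ := Set.mem_iUnion.mp (hc ht)
  refine Set.mem_iUnion.mpr ⟨i, max_le (hE ht).1 h1, h2.trans ?_⟩
  gcongr
  exact le_max_right _ _

lemma log_intervalCoveringNumber_div_nonneg {δ : ℝ} (hδ : 0 < δ) (hδ1 : δ < 1) :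
    0 ≤ Real.log (intervalCoveringNumber E δ) / Real.log (1 / δ) :=
  div_nonneg (Real.log_natCast_nonneg _) (Real.log_nonneg (by
    rw [le_div_iff₀ hδ]; linarith))

/-- For 0 < δ < 1 the quotient of logarithms is nonnegative, also for empty E because log 0 = 0 by
convention. -/
lemma nonneg_of_upperMinkowskiDim_eq {β : ℝ} (hβ : upperMinkowskiDim E = (β : EReal)) : 0 ≤ β := by
  by_contra! h
  have h1 : limsup (fun δ : ℝ => ((Real.log (intervalCoveringNumber E δ) / Real.log (1 / δ) : ℝ) :
      EReal)) (𝓝[>] 0) < ((0 : ℝ) : EReal) := by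
    change upperMinkowskiDim E < _
    rw [hβ]; exact_mod_cast h
  have h2 := eventually_lt_of_limsup_lt h1
  have h3 : ∀ᶠ δ : ℝ in 𝓝[>] 0, δ ∈ Set.Ioo (0 : ℝ) 1 := Ioo_mem_nhdsGT one_pos
  obtain ⟨δ, h4, h5⟩ := (h2.and h3).exists
  have h6 : Real.log (intervalCoveringNumber E δ) / Real.log (1 / δ) < 0 := by exact_mod_cast h4
  exact absurd (log_intervalCoveringNumber_div_nonneg h5.1 h5.2) (not_le.mpr h6)

/-- The limsup gives N(E, δ) ≤ δ^{-γ} for all small δ; the finitely many remaining scales 2^{-n} go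
into the constant. -/
lemma exists_intervalCoveringNumber_le {β γ : ℝ} (hβ : upperMinkowskiDim E = (β : EReal))
    (hγ : β < γ) : ∃ C : ℝ, 0 ≤ C ∧ ∀ n : ℕ,
      (intervalCoveringNumber E ((2 : ℝ)⁻¹ ^ n) : ℝ) ≤ C * (2 : ℝ) ^ (γ * n) := by
  have h1 : limsup (fun δ : ℝ => ((Real.log (intervalCoveringNumber E δ) / Real.log (1 / δ) : ℝ) :
      EReal)) (𝓝[>] 0) < (γ : EReal) := by
    change upperMinkowskiDim E < _
    rw [hβ]; exact_mod_cast hγ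
  have h2 := eventually_lt_of_limsup_lt h1
  have h3 : Tendsto (fun n : ℕ => ((2 : ℝ)⁻¹) ^ n) atTop (𝓝[>] 0) :=
    tendsto_nhdsWithin_iff.mpr ⟨tendsto_pow_atTop_nhds_zero_of_lt_one (by norm_num) (by norm_num),
      Eventually.of_forall fun n => by simp⟩
  obtain ⟨n₀, hn₀⟩ := eventually_atTop.mp (h3.eventually h2)
  set f : ℕ → ℝ := fun n => (intervalCoveringNumber E ((2 : ℝ)⁻¹ ^ n) : ℝ) / (2 : ℝ) ^ (γ * n)
    with hf
  have hf0 : ∀ n, 0 ≤ f n := fun n => by positivity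
  refine ⟨1 + ∑ n ∈ Finset.range (n₀ + 1), f n,
    add_nonneg zero_le_one (Finset.sum_nonneg fun n _ => hf0 n), fun n => ?_⟩
  rw [← div_le_iff₀ (by positivity)]
  change f n ≤ _
  by_cases hn : n < n₀ + 1
  · have := Finset.single_le_sum (f := f) (fun i _ => hf0 i) (Finset.mem_range.mpr hn)
    linarith
  · have h4 : 0 ≤ ∑ n ∈ Finset.range (n₀ + 1), f n := Finset.sum_nonneg fun n _ => hf0 n
    suffices f n ≤ 1 by linarith
    rw [hf]
    simp only
    rw [div_le_one (by positivity)]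
    have h5 := hn₀ n (by omega)
    have h6 : Real.log (intervalCoveringNumber E ((2 : ℝ)⁻¹ ^ n)) /
      Real.log (1 / (2 : ℝ)⁻¹ ^ n) < γ := by exact_mod_cast h5
    have h7 : Real.log (1 / (2 : ℝ)⁻¹ ^ n) = n * Real.log 2 := by
      rw [one_div, inv_pow, inv_inv, Real.log_pow]
    have hn1 : (0 : ℝ) < n := by exact_mod_cast (by omega : 0 < n)
    rw [h7, div_lt_iff₀ (mul_pos hn1 (Real.log_pos (by norm_num)))] at h6
    rcases Nat.eq_zero_or_pos (intervalCoveringNumber E ((2 : ℝ)⁻¹ ^ n)) with h8 | h8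
    · rw [h8]; simp only [Nat.cast_zero]; positivity
    · rw [← Real.log_le_log_iff (by exact_mod_cast h8) (by positivity), Real.log_rpow (by norm_num)]
      linarith

end Covering

/-! ### Pointwise bounds on short intervals -/

section SobolevInterval

lemma add_sq_le_two_mul (x y : ℝ≥0∞) : (x + y) ^ 2 ≤ 2 * x ^ 2 + 2 * y ^ 2 := by
  rcases eq_or_ne x ∞ with rfl | hx
  · simp
  rcases eq_or_ne y ∞ with rfl | hy
  · simp
  lift x to NNReal using hx
  lift y to NNReal using hy
  rw [← mul_add]
  exact_mod_cast add_sq_le (a := x) (b := y)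

/-- A pointwise bound on an interval of length `δ` by the mean square of the function and of its
derivative. -/
lemma enorm_sq_le_of_hasDerivAt {F F' : ℝ → ℂ} (hF : ∀ t, HasDerivAt F (F' t) t)
    (hF' : Continuous F') {c δ : ℝ} (hδ : 0 < δ) {t : ℝ} (ht : t ∈ Set.Icc c (c + δ)) :
    ‖F t‖ₑ ^ 2 ≤ ENNReal.ofReal (2 / δ) * (∫⁻ s in Set.Icc c (c + δ), ‖F s‖ₑ ^ 2) +
      ENNReal.ofReal (2 * δ) * ∫⁻ s in Set.Icc c (c + δ), ‖F' s‖ₑ ^ 2 := by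
  have hFc : Continuous F := continuous_iff_continuousAt.mpr fun s => (hF s).continuousAt
  set J := Set.Icc c (c + δ) with hJ
  have hvol : volume J = ENNReal.ofReal δ := by rw [hJ, Real.volume_Icc]; congr 1; ring
  set D := ∫⁻ s in J, ‖F' s‖ₑ with hD
  -- The fundamental theorem of calculus compares F t with F s for every s in the interval; the
  -- bound follows by averaging over s and estimating D by Cauchy–Schwarz.
  have hpt : ∀ s ∈ J, ‖F t‖ₑ ≤ ‖F s‖ₑ + D := by
    intro s hs
    have h1 : F t = F s + ∫ r in s..t, F' r := by
      rw [intervalIntegral.integral_eq_sub_of_hasDerivAt (fun r _ => hF r)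
        (hF'.intervalIntegrable _ _)]
      ring
    rw [h1]
    refine (enorm_add_le _ _).trans ?_
    gcongr
    have h2 : ‖∫ r in s..t, F' r‖ₑ = ‖∫ r in Set.uIoc s t, F' r‖ₑ := by
      rw [← ofReal_norm, ← ofReal_norm, intervalIntegral.norm_integral_eq_norm_integral_uIoc]
    rw [h2]
    refine (enorm_integral_le_lintegral_enorm _).trans (lintegral_mono_set ?_)
    intro r hr
    have hr' := Set.uIoc_subset_uIcc hr
    exact Set.uIcc_subset_Icc hs ht hr'
  have hD2 : D ^ 2 ≤ ENNReal.ofReal δ * ∫⁻ s in J, ‖F' s‖ₑ ^ 2 := by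
    have h := ENNReal.lintegral_mul_le_Lp_mul_Lq (volume.restrict J) Real.HolderConjugate.two_two
      (f := fun _ => 1) (g := fun s => ‖F' s‖ₑ) aemeasurable_const
      hF'.measurable.enorm.aemeasurable
    have h2 := pow_le_pow_left' h 2
    simp only [Pi.mul_apply, one_mul] at h2
    refine h2.trans ?_
    rw [mul_pow, ← ENNReal.rpow_natCast, ← ENNReal.rpow_natCast, ← ENNReal.rpow_mul,
      ← ENNReal.rpow_mul]
    norm_num
    rw [hvol]
  have hmain : ENNReal.ofReal δ * ‖F t‖ₑ ^ 2 ≤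
      2 * (∫⁻ s in J, ‖F s‖ₑ ^ 2) + 2 * D ^ 2 * ENNReal.ofReal δ := by
    calc ENNReal.ofReal δ * ‖F t‖ₑ ^ 2 = ∫⁻ s in J, ‖F t‖ₑ ^ 2 := by
          rw [setLIntegral_const, hvol, mul_comm]
      _ ≤ ∫⁻ s in J, (2 * ‖F s‖ₑ ^ 2 + 2 * D ^ 2) :=
          setLIntegral_mono' measurableSet_Icc fun s hs =>
            (pow_le_pow_left' (hpt s hs) 2).trans (add_sq_le_two_mul _ _)
      _ = _ := by
          rw [lintegral_add_right _ measurable_const, lintegral_const_mul _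
            (hFc.measurable.enorm.pow_const 2), setLIntegral_const, hvol]
  have hδ0 : ENNReal.ofReal δ ≠ 0 := by simpa using hδ
  have hδt : ENNReal.ofReal δ ≠ ∞ := ENNReal.ofReal_ne_top
  rw [← ENNReal.mul_le_mul_iff_right hδ0 hδt]
  refine hmain.trans ?_
  rw [mul_add, ← mul_assoc, ← mul_assoc, ← ENNReal.ofReal_mul hδ.le, ← ENNReal.ofReal_mul hδ.le]
  refine add_le_add ?_ ?_
  · rw [mul_div_cancel₀ _ hδ.ne', ENNReal.ofReal_ofNat]
  · calc 2 * D ^ 2 * ENNReal.ofReal δ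
        ≤ 2 * (ENNReal.ofReal δ * ∫⁻ s in J, ‖F' s‖ₑ ^ 2) * ENNReal.ofReal δ := by gcongr
      _ = ENNReal.ofReal (δ * (2 * δ)) * ∫⁻ s in J, ‖F' s‖ₑ ^ 2 := by
        rw [ENNReal.ofReal_mul hδ.le, ENNReal.ofReal_mul (by norm_num), ENNReal.ofReal_ofNat]
        ring

end SobolevInterval

/-! ### The maximal estimate for one dyadic piece -/

section Piece

variable {d : ℕ} {ν : Measure (Eu d × Eu d)}

/-- The symbol of the average of radius `t`, cut off to a set `S` of frequencies. -/
noncomputable def cutSymbol (ν : Measure (Eu d × Eu d)) (S : Set (Eu d × Eu d)) (t : ℝ)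
    (ξ η : Eu d) : ℂ :=
  S.indicator (fun q => mult ν (-(2 * Real.pi) * t) q.1 q.2) (ξ, η)

/-- The derivative in `t` of `cutSymbol`. -/
noncomputable def cutSymbolDeriv (ν : Measure (Eu d × Eu d)) (S : Set (Eu d × Eu d)) (t : ℝ)
    (ξ η : Eu d) : ℂ :=
  S.indicator (fun q => ((-(2 * Real.pi) : ℝ) : ℂ) * multDeriv ν (-(2 * Real.pi) * t) q.1 q.2) (ξ, η)

lemma measurable_cutSymbol [SFinite ν] {S : Set (Eu d × Eu d)} (hS : MeasurableSet S) :
    Measurable fun r : ℝ × Eu d × Eu d => cutSymbol ν S r.1 r.2.1 r.2.2 := by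
  have h : (fun r : ℝ × Eu d × Eu d => cutSymbol ν S r.1 r.2.1 r.2.2) =
      ((Prod.snd : ℝ × Eu d × Eu d → Eu d × Eu d) ⁻¹' S).indicator
        (fun r => mult ν (-(2 * Real.pi) * r.1) r.2.1 r.2.2) := by
    rfl
  rw [h]
  refine Measurable.indicator ?_ (measurable_snd hS)
  exact measurable_mult.comp ((measurable_fst.const_mul _).prodMk measurable_snd)

lemma measurable_cutSymbolDeriv [SFinite ν] {S : Set (Eu d × Eu d)} (hS : MeasurableSet S) :
    Measurable fun r : ℝ × Eu d × Eu d => cutSymbolDeriv ν S r.1 r.2.1 r.2.2 := by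
  have h : (fun r : ℝ × Eu d × Eu d => cutSymbolDeriv ν S r.1 r.2.1 r.2.2) =
      ((Prod.snd : ℝ × Eu d × Eu d → Eu d × Eu d) ⁻¹' S).indicator
        (fun r => ((-(2 * Real.pi) : ℝ) : ℂ) * multDeriv ν (-(2 * Real.pi) * r.1) r.2.1 r.2.2) := by
    rfl
  rw [h]
  refine Measurable.indicator ?_ (measurable_snd hS)
  exact (measurable_multDeriv.comp
    ((measurable_fst.const_mul _).prodMk measurable_snd)).const_mul _

lemma measurable_uncurry_cutSymbol [SFinite ν] {S : Set (Eu d × Eu d)} (hS : MeasurableSet S)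
    (t : ℝ) : Measurable (Function.uncurry (cutSymbol ν S t)) :=
  (measurable_cutSymbol (ν := ν) hS).comp (measurable_prodMk_left (x := t))

lemma measurable_uncurry_cutSymbolDeriv [SFinite ν] {S : Set (Eu d × Eu d)} (hS : MeasurableSet S)
    (t : ℝ) : Measurable (Function.uncurry (cutSymbolDeriv ν S t)) := by
  have h : Measurable fun q : Eu d × Eu d => cutSymbolDeriv ν S t q.1 q.2 := by
    have h1 := measurable_cutSymbolDeriv (ν := ν) hS
    have h2 : Measurable fun q : Eu d × Eu d => (t, q) := measurable_prodMk_left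
    exact Measurable.comp (f := fun q : Eu d × Eu d => (t, q)) h1 h2
  exact h

lemma norm_cutSymbol_le [IsFiniteMeasure ν] (S : Set (Eu d × Eu d)) (t : ℝ) (ξ η : Eu d) :
    ‖cutSymbol ν S t ξ η‖ ≤ ν.real Set.univ :=
  (norm_indicator_le_norm_self _ _).trans (norm_mult_le _ _ _)

lemma norm_cutSymbolDeriv_le (hν : IsTriangleInvariant ν) {S : Set (Eu d × Eu d)} {R : ℝ}
    (hR : 0 ≤ R) (hS : ∀ q ∈ S, ‖q.1‖ ≤ R ∧ ‖q.2‖ ≤ R) (t : ℝ) (ξ η : Eu d) :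
    ‖cutSymbolDeriv ν S t ξ η‖ ≤ 2 * Real.pi * ((R + R) * ν.real Set.univ) := by
  have h0 : 0 ≤ ν.real Set.univ := measureReal_nonneg
  rw [cutSymbolDeriv, Set.indicator]
  split_ifs with h
  · rw [norm_mul, Complex.norm_real, norm_neg, Real.norm_of_nonneg (by positivity)]
    gcongr
    refine (hν.norm_multDeriv_le _ _ _).trans ?_
    gcongr
    exacts [(hS _ h).1, (hS _ h).2]
  · simp only [norm_zero]; positivity

lemma hasDerivAt_cutSymbol (hν : IsTriangleInvariant ν) (S : Set (Eu d × Eu d)) (t : ℝ)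
    (ξ η : Eu d) :
    HasDerivAt (fun t => cutSymbol ν S t ξ η) (cutSymbolDeriv ν S t ξ η) t := by
  by_cases h : (ξ, η) ∈ S
  · simp only [cutSymbol, cutSymbolDeriv, Set.indicator_of_mem h]
    have h1 : HasDerivAt (fun t : ℝ => -(2 * Real.pi) * t) (-(2 * Real.pi)) t := by
      simpa using (hasDerivAt_id t).const_mul (-(2 * Real.pi))
    have h2 := (hν.hasDerivAt_mult (-(2 * Real.pi) * t) ξ η).scomp t h1
    simpa [Function.comp_def] using h2
  · simp only [cutSymbol, cutSymbolDeriv, Set.indicator_of_notMem h]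
    exact hasDerivAt_const _ _

lemma continuous_multDeriv (hν : IsTriangleInvariant ν) (ξ η : Eu d) :
    Continuous fun θ => multDeriv ν θ ξ η := by
  have := hν.finite
  refine continuous_of_dominated (bound := fun _ => ‖ξ‖ + ‖η‖)
    (fun θ => Continuous.aestronglyMeasurable (by fun_prop)) (fun θ => ?_) (integrable_const _)
    (Eventually.of_forall fun p => by fun_prop)
  filter_upwards [hν.supp] with p hp
  rw [norm_mul, Complex.norm_exp_ofReal_mul_I, norm_mul, Complex.norm_I, mul_one, mul_one,
    Complex.norm_real]
  refine (norm_add_le _ _).trans (add_le_add ?_ ?_)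
  · simpa [hp.1] using norm_inner_le_norm (𝕜 := ℝ) ξ p.1
  · simpa [hp.2.1] using norm_inner_le_norm (𝕜 := ℝ) η p.2

lemma continuous_cutSymbolDeriv (hν : IsTriangleInvariant ν) (S : Set (Eu d × Eu d))
    (ξ η : Eu d) : Continuous fun t => cutSymbolDeriv ν S t ξ η := by
  by_cases h : (ξ, η) ∈ S
  · simp only [cutSymbolDeriv, Set.indicator_of_mem h]
    exact ((continuous_multDeriv hν ξ η).comp (continuous_const.mul continuous_id)).const_mul _
  · simp only [cutSymbolDeriv, Set.indicator_of_notMem h]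
    exact continuous_const

variable {a b : Eu d → ℂ}

lemma measurable_bilinearMultiplier {k : ℝ → Eu d → Eu d → ℂ}
    (hk : Measurable fun r : ℝ × Eu d × Eu d => k r.1 r.2.1 r.2.2) (ha : Measurable a)
    (hb : Measurable b) :
    Measurable fun r : ℝ × Eu d => bilinearMultiplier (k r.1) a b r.2 := by
  have h : Measurable fun r : (ℝ × Eu d) × (Eu d × Eu d) => a r.2.1 * b r.2.2 *
      k r.1.1 r.2.1 r.2.2 *
      Complex.exp (((2 * Real.pi * inner ℝ r.1.2 (r.2.1 + r.2.2) : ℝ) : ℂ) * Complex.I) := by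
    have h1 : Measurable fun r : (ℝ × Eu d) × (Eu d × Eu d) => k r.1.1 r.2.1 r.2.2 :=
      hk.comp ((measurable_fst.comp measurable_fst).prodMk measurable_snd)
    have h2 : Measurable fun r : (ℝ × Eu d) × (Eu d × Eu d) =>
        Complex.exp (((2 * Real.pi * inner ℝ r.1.2 (r.2.1 + r.2.2) : ℝ) : ℂ) * Complex.I) :=
      Continuous.measurable (by fun_prop)
    fun_prop
  exact h.stronglyMeasurable.integral_prod_right.measurable

lemma integrable_mul_mul_exp {k : Eu d → Eu d → ℂ} (hk : Measurable (Function.uncurry k)) {M : ℝ}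
    (hkM : ∀ ξ η, ‖k ξ η‖ ≤ M) (ha : Integrable a) (hb : Integrable b) (x : Eu d) :
    Integrable fun q : Eu d × Eu d => a q.1 * b q.2 * k q.1 q.2 *
      Complex.exp (((2 * Real.pi * inner ℝ x (q.1 + q.2) : ℝ) : ℂ) * Complex.I) := by
  have hk' : Measurable fun q : Eu d × Eu d => k q.1 q.2 := hk
  refine Integrable.mul_bdd (c := 1) ((ha.mul_prod hb).mul_bdd (c := M) hk'.aestronglyMeasurable
      (Eventually.of_forall fun q => hkM _ _)) (Continuous.aestronglyMeasurable (by fun_prop)) ?_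
  exact Eventually.of_forall fun q => (Complex.norm_exp_ofReal_mul_I _).le

lemma integrable_norm_mul_const (ha : Integrable a) (hb : Integrable b) (c : ℝ) :
    Integrable (fun q : Eu d × Eu d => ‖a q.1 * b q.2‖ * c) volume :=
  (ha.mul_prod hb).norm.mul_const _

/-- The cut-off to a bounded set of frequencies makes the t-derivative of the integrand at most a
constant times |a(ξ) b(η)|, so the integral can be differentiated. -/
lemma hasDerivAt_bilinearMultiplier_cutSymbol (hν : IsTriangleInvariant ν)
    {S : Set (Eu d × Eu d)} (hSm : MeasurableSet S) {R : ℝ} (hR : 0 ≤ R)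
    (hS : ∀ q ∈ S, ‖q.1‖ ≤ R ∧ ‖q.2‖ ≤ R) (ha : Integrable a) (hb : Integrable b) (x : Eu d)
    (t : ℝ) :
    HasDerivAt (fun t => bilinearMultiplier (cutSymbol ν S t) a b x)
      (bilinearMultiplier (cutSymbolDeriv ν S t) a b x) t := by
  have := hν.finite
  have hI := fun t => integrable_mul_mul_exp (measurable_uncurry_cutSymbol (ν := ν) hSm t)
    (norm_cutSymbol_le S t) ha hb x
  have hI' := fun t => integrable_mul_mul_exp (measurable_uncurry_cutSymbolDeriv (ν := ν) hSm t)
    (norm_cutSymbolDeriv_le hν hR hS t) ha hb x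
  have hB := integrable_norm_mul_const ha hb (2 * Real.pi * ((R + R) * ν.real Set.univ))
  refine (hasDerivAt_integral_of_dominated_loc_of_deriv_le (μ := volume)
    (s := Set.univ) (F := fun (t : ℝ) (q : Eu d × Eu d) => a q.1 * b q.2 * cutSymbol ν S t q.1 q.2 *
      Complex.exp (((2 * Real.pi * inner ℝ x (q.1 + q.2) : ℝ) : ℂ) * Complex.I))
    (F' := fun (t : ℝ) (q : Eu d × Eu d) => a q.1 * b q.2 * cutSymbolDeriv ν S t q.1 q.2 *
      Complex.exp (((2 * Real.pi * inner ℝ x (q.1 + q.2) : ℝ) : ℂ) * Complex.I))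
    (bound := fun q => ‖a q.1 * b q.2‖ * (2 * Real.pi * ((R + R) * ν.real Set.univ))) univ_mem
    (Eventually.of_forall fun t => (hI t).aestronglyMeasurable) (hI t) (hI' t).aestronglyMeasurable
    (Eventually.of_forall fun q t _ => ?_) hB
    (Eventually.of_forall fun q t _ => ?_)).2
  · rw [norm_mul, Complex.norm_exp_ofReal_mul_I, mul_one, norm_mul]
    gcongr
    exact norm_cutSymbolDeriv_le hν hR hS t _ _
  · exact ((hasDerivAt_cutSymbol hν S t q.1 q.2).const_mul _).mul_const _

lemma continuous_bilinearMultiplier_cutSymbolDeriv (hν : IsTriangleInvariant ν)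
    {S : Set (Eu d × Eu d)} (hSm : MeasurableSet S) {R : ℝ} (hR : 0 ≤ R)
    (hS : ∀ q ∈ S, ‖q.1‖ ≤ R ∧ ‖q.2‖ ≤ R) (ha : Integrable a) (hb : Integrable b) (x : Eu d) :
    Continuous fun t => bilinearMultiplier (cutSymbolDeriv ν S t) a b x := by
  have := hν.finite
  have hI' := fun t => integrable_mul_mul_exp (measurable_uncurry_cutSymbolDeriv (ν := ν) hSm t)
    (norm_cutSymbolDeriv_le hν hR hS t) ha hb x
  have hB := integrable_norm_mul_const ha hb (2 * Real.pi * ((R + R) * ν.real Set.univ))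
  refine continuous_of_dominated (μ := volume)
    (bound := fun q : Eu d × Eu d => ‖a q.1 * b q.2‖ * (2 * Real.pi * ((R + R) * ν.real Set.univ)))
    (fun t => (hI' t).aestronglyMeasurable)
    (fun t => Eventually.of_forall fun q => ?_) hB
    (Eventually.of_forall fun q => ?_)
  · rw [norm_mul, Complex.norm_exp_ofReal_mul_I, mul_one, norm_mul]
    gcongr
    exact norm_cutSymbolDeriv_le hν hR hS t _ _
  · exact ((continuous_cutSymbolDeriv hν S q.1 q.2).const_mul _).mul_const _

/-- The square of the `H^{-s}` norm in terms of the Fourier transform. -/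
noncomputable def negSobolevSq (s : ℝ) (a : Eu d → ℂ) : ℝ≥0∞ :=
  ∫⁻ ξ, ENNReal.ofReal ((1 + ‖ξ‖ ^ 2) ^ (-s)) * ‖a ξ‖ₑ ^ 2

/-- On the ball 1 + |ξ|² ≤ 2R². This is the only place where the negative Sobolev order is paid for,
by R^{2s} in the squared norm. -/
lemma setLIntegral_ball_le_negSobolevSq {s : ℝ} (hs : 0 ≤ s) {R : ℝ} (hR : 1 ≤ R) (a : Eu d → ℂ) :
    ∫⁻ ξ in Metric.ball 0 R, ‖a ξ‖ₑ ^ 2 ≤ ENNReal.ofReal ((2 * R ^ 2) ^ s) * negSobolevSq s a := by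
  rw [negSobolevSq, ← lintegral_const_mul' _ _ ENNReal.ofReal_ne_top]
  refine (setLIntegral_mono' measurableSet_ball fun ξ hξ => ?_).trans (setLIntegral_le_lintegral _ _)
  rw [← mul_assoc, ← ENNReal.ofReal_mul (by positivity)]
  refine le_mul_of_one_le_left (by positivity) ?_
  rw [← ENNReal.ofReal_one]
  refine ENNReal.ofReal_le_ofReal ?_
  have h1 : ‖ξ‖ < R := mem_ball_zero_iff.mp hξ
  have h0 := norm_nonneg ξ
  rw [Real.rpow_neg (by positivity), ← div_eq_mul_inv, one_le_div (by positivity)]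
  refine Real.rpow_le_rpow (by positivity) ?_ hs
  nlinarith

lemma bilinearMultiplier_eq_indicator {k : Eu d → Eu d → ℂ} {B : Set (Eu d)}
    (hk : ∀ ξ η, k ξ η ≠ 0 → ξ ∈ B ∧ η ∈ B) (a b : Eu d → ℂ) (x : Eu d) :
    bilinearMultiplier k a b x = bilinearMultiplier k (B.indicator a) (B.indicator b) x := by
  refine integral_congr_ae (Eventually.of_forall fun q => ?_)
  by_cases h : k q.1 q.2 = 0
  · simp [h]
  · simp only
    rw [Set.indicator_of_mem (hk _ _ h).1, Set.indicator_of_mem (hk _ _ h).2]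

/-- The `L²` bound for a multiplier supported in a ball. -/
lemma lintegral_bilinearMultiplier_sq_le_ball {k : Eu d → Eu d → ℂ}
    (hk : Measurable (Function.uncurry k)) {M : ℝ} (hkM : ∀ ξ η, ‖k ξ η‖ ≤ M) (ha : Measurable a)
    (hb : Measurable b) (hai : Integrable a) (hbi : Integrable b) {Ma : ℝ} (haM : ∀ ξ, ‖a ξ‖ ≤ Ma)
    {A : ℝ≥0∞} (hA : ∀ η, ∫⁻ ξ, ‖k ξ η‖ₑ ^ 2 ≤ A) {R : ℝ}
    (hkR : ∀ ξ η, k ξ η ≠ 0 → ξ ∈ Metric.ball (0 : Eu d) R ∧ η ∈ Metric.ball (0 : Eu d) R) :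
    ∫⁻ x, ‖bilinearMultiplier k a b x‖ₑ ^ 2 ≤
      A * (∫⁻ ξ in Metric.ball 0 R, ‖a ξ‖ₑ ^ 2) * ∫⁻ η in Metric.ball 0 R, ‖b η‖ₑ ^ 2 := by
  have hB := measurableSet_ball (x := (0 : Eu d)) (ε := R)
  have he : ∀ f : Eu d → ℂ, ∫⁻ ξ, ‖(Metric.ball 0 R).indicator f ξ‖ₑ ^ 2 =
      ∫⁻ ξ in Metric.ball 0 R, ‖f ξ‖ₑ ^ 2 := by
    intro f
    rw [← lintegral_indicator hB]
    refine lintegral_congr fun ξ => ?_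
    by_cases h : ξ ∈ Metric.ball (0 : Eu d) R <;> simp [h]
  simp_rw [bilinearMultiplier_eq_indicator hkR a b]
  rw [← he a, ← he b]
  exact lintegral_bilinearMultiplier_sq_le hk hkM (ha.indicator hB) (hb.indicator hB)
    (hai.indicator hB) (hbi.indicator hB) (Ma := Ma)
    (fun ξ => (norm_indicator_le_norm_self _ _).trans (haM ξ)) hA

/-- The maximal estimate over a family of radii for one dyadic frequency piece. -/
theorem IsTriangleInvariant.exists_dyadic_maximal_le (hν : IsTriangleInvariant ν) {E : Set ℝ}
    (hE : E ⊆ Set.Icc 1 2) {β : ℝ} (hβ : upperMinkowskiDim E = (β : EReal))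
    (hd : 4 + β < (d : ℝ)) {s₁ s₂ : ℝ} (hs₁ : 0 ≤ s₁) (hs₂ : 0 ≤ s₂)
    (hs : s₁ + s₂ < ((d : ℝ) - 4 - β) / 2) :
    ∃ C : ℝ, 0 ≤ C ∧ ∀ (n : ℕ) (S : Set (Eu d × Eu d)), MeasurableSet S →
      (∀ q ∈ S, ‖q.1‖ ≤ ‖q.2‖ ∧ dyadicIndex ‖q.2‖ = n) → ∀ a b : Eu d → ℂ, Measurable a →
      Measurable b → Integrable a → Integrable b → (∃ Ma, ∀ ξ, ‖a ξ‖ ≤ Ma) →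
      ∃ U : Eu d → ℝ≥0∞, Measurable U ∧
        (∀ t ∈ E, ∀ x, ‖bilinearMultiplier (cutSymbol ν S t) a b x‖ₑ ^ 2 ≤ U x) ∧
        ∫⁻ x, U x ≤ ENNReal.ofReal (C * (2 : ℝ) ^ (-(n : ℝ) / 2)) * negSobolevSq s₁ a *
          negSobolevSq s₂ b := by
  have := hν.finite
  have hβ0 := nonneg_of_upperMinkowskiDim_eq hβ
  have hd4 : 4 ≤ d := by
    have : (4 : ℝ) < d := by linarith
    exact_mod_cast this.le
  obtain ⟨K, hK0, hK⟩ := hν.exists_lintegral_mult_dyadic_le hd4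
  -- The hypothesis on s₁ + s₂ gives β - (d-3) + 2(s₁+s₂) < -1, a full power of 2^{-n} to spare.
  -- Half of it pays for the covering exponent β + 1/2, the other half becomes the decay 2^{-n/2}.
  obtain ⟨N, hN0, hN⟩ := exists_intervalCoveringNumber_le hβ (show β < β + 1 / 2 by linarith)
  have hpi : 1 ≤ 2 * Real.pi := by linarith [Real.pi_gt_three]
  refine ⟨N * ((2 + 2 * (2 * Real.pi) ^ 2) * K) * 2 ^ s₁ * 2 ^ s₂, by positivity, ?_⟩
  rintro n S hSm hS a b ha hb hai hbi ⟨Ma, haM⟩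
  set R : ℝ := 2 ^ n with hR
  have hR1 : 1 ≤ R := one_le_pow₀ (by norm_num)
  have hR0 : 0 < R := by linarith
  have hSR : ∀ q ∈ S, ‖q.1‖ < R ∧ ‖q.2‖ < R := fun q hq => by
    have h1 := lt_two_pow_dyadicIndex ‖q.2‖
    rw [(hS q hq).2] at h1
    exact ⟨(hS q hq).1.trans_lt h1, h1⟩
  have hSR' : ∀ q ∈ S, ‖q.1‖ ≤ R ∧ ‖q.2‖ ≤ R := fun q hq => ⟨(hSR q hq).1.le, (hSR q hq).2.le⟩
  -- A derivative in t costs a factor R, so intervals of length 1/R balance the two terms of the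
  -- pointwise bound.
  set δ : ℝ := (2 : ℝ)⁻¹ ^ n with hδ
  have hδR : δ = R⁻¹ := inv_pow _ _
  have hδ0 : 0 < δ := by positivity
  obtain ⟨c, hc1, hcE⟩ := exists_cover_inside hE hδ0
  set F : ℝ → Eu d → ℂ := fun t x => bilinearMultiplier (cutSymbol ν S t) a b x with hF
  set F' : ℝ → Eu d → ℂ := fun t x => bilinearMultiplier (cutSymbolDeriv ν S t) a b x with hF'
  have hFm : Measurable (Function.uncurry F) :=
    measurable_bilinearMultiplier (measurable_cutSymbol hSm) ha hb
  have hFm' : Measurable (Function.uncurry F') :=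
    measurable_bilinearMultiplier (measurable_cutSymbolDeriv hSm) ha hb
  have hFm2 : Measurable fun r : Eu d × ℝ => ‖F r.2 r.1‖ₑ ^ 2 :=
    (hFm.comp measurable_swap).enorm.pow_const 2
  have hFm2' : Measurable fun r : Eu d × ℝ => ‖F' r.2 r.1‖ₑ ^ 2 :=
    (hFm'.comp measurable_swap).enorm.pow_const 2
  set Y := (∫⁻ ξ in Metric.ball 0 R, ‖a ξ‖ₑ ^ 2) * ∫⁻ η in Metric.ball 0 R, ‖b η‖ₑ ^ 2 with hY
  have hθ : ∀ t : ℝ, 1 ≤ t → 1 ≤ |(-(2 * Real.pi) * t)| := fun t ht => by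
    rw [neg_mul, abs_neg, abs_of_nonneg (by positivity)]; nlinarith
  have hL : ∀ t, 1 ≤ t → ∫⁻ x, ‖F t x‖ₑ ^ 2 ≤ ENNReal.ofReal (K / R ^ (d - 3)) * Y := by
    intro t ht
    rw [hY, ← mul_assoc]
    refine lintegral_bilinearMultiplier_sq_le_ball
      (measurable_uncurry_cutSymbol hSm t)
      (norm_cutSymbol_le S t) ha hb hai hbi haM (fun η => ?_) fun ξ η h => ?_
    · by_cases hη : dyadicIndex ‖η‖ = n
      · refine le_trans ?_ ((hK _ (hθ t ht) η).1.trans_eq (by rw [hη]))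
        rw [← lintegral_indicator measurableSet_closedBall]
        refine lintegral_mono fun ξ => ?_
        by_cases h : (ξ, η) ∈ S
        · rw [Set.indicator_of_mem (mem_closedBall_zero_iff.mpr (hS _ h).1), cutSymbol,
            Set.indicator_of_mem h]
        · simp [cutSymbol, Set.indicator_of_notMem h]
      · have : ∀ ξ, (ξ, η) ∉ S := fun ξ h => hη (hS _ h).2
        simp [cutSymbol, this]
    · have := hSR _ (Set.mem_of_indicator_ne_zero h)
      exact ⟨mem_ball_zero_iff.mpr this.1, mem_ball_zero_iff.mpr this.2⟩
  have hL' : ∀ t, 1 ≤ t → ∫⁻ x, ‖F' t x‖ₑ ^ 2 ≤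
      ENNReal.ofReal ((2 * Real.pi) ^ 2 * (K * R ^ 2 / R ^ (d - 3))) * Y := by
    intro t ht
    rw [hY, ← mul_assoc]
    refine lintegral_bilinearMultiplier_sq_le_ball
      (measurable_uncurry_cutSymbolDeriv hSm t)
      (norm_cutSymbolDeriv_le hν hR0.le hSR' t) ha hb hai hbi haM (fun η => ?_) fun ξ η h => ?_
    · rw [ENNReal.ofReal_mul (by positivity)]
      by_cases hη : dyadicIndex ‖η‖ = n
      · refine le_trans ?_ (mul_le_mul_right ((hK _ (hθ t ht) η).2.trans_eq (by rw [hη])) _)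
        rw [← lintegral_const_mul' _ _ ENNReal.ofReal_ne_top,
          ← lintegral_indicator measurableSet_closedBall]
        refine lintegral_mono fun ξ => ?_
        by_cases h : (ξ, η) ∈ S
        · rw [Set.indicator_of_mem (mem_closedBall_zero_iff.mpr (hS _ h).1), cutSymbolDeriv,
            Set.indicator_of_mem h, enorm_mul, mul_pow]
          gcongr
          rw [← ofReal_norm, Complex.norm_real, norm_neg, Real.norm_of_nonneg (by positivity),
            ENNReal.ofReal_pow (by positivity)]
        · simp [cutSymbolDeriv, Set.indicator_of_notMem h]
      · have : ∀ ξ, (ξ, η) ∉ S := fun ξ h => hη (hS _ h).2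
        simp [cutSymbolDeriv, this]
    · have := hSR _ (Set.mem_of_indicator_ne_zero h)
      exact ⟨mem_ball_zero_iff.mpr this.1, mem_ball_zero_iff.mpr this.2⟩
  set G : Fin (intervalCoveringNumber E δ) → Eu d → ℝ≥0∞ := fun i x =>
    ENNReal.ofReal (2 / δ) * (∫⁻ s in Set.Icc (c i) (c i + δ), ‖F s x‖ₑ ^ 2) +
      ENNReal.ofReal (2 * δ) * ∫⁻ s in Set.Icc (c i) (c i + δ), ‖F' s x‖ₑ ^ 2 with hG
  have hGm : ∀ i, Measurable (G i) := fun i =>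
    (hFm2.lintegral_prod_right'.const_mul _).add (hFm2'.lintegral_prod_right'.const_mul _)
  have hint : ∀ i (Φ : ℝ → Eu d → ℂ) (A : ℝ≥0∞), Measurable (fun r : Eu d × ℝ => ‖Φ r.2 r.1‖ₑ ^ 2) →
      (∀ t, 1 ≤ t → ∫⁻ x, ‖Φ t x‖ₑ ^ 2 ≤ A) →
      ∫⁻ x, ∫⁻ s in Set.Icc (c i) (c i + δ), ‖Φ s x‖ₑ ^ 2 ≤ A * ENNReal.ofReal δ := by
    intro i Φ A hΦm hΦ
    rw [lintegral_lintegral_swap hΦm.aemeasurable]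
    calc _ ≤ ∫⁻ s in Set.Icc (c i) (c i + δ), A :=
          setLIntegral_mono' measurableSet_Icc fun s hs => hΦ s ((hc1 i).trans hs.1)
      _ = _ := by rw [setLIntegral_const, Real.volume_Icc]; congr 2; ring
  set P : ℝ := (2 + 2 * (2 * Real.pi) ^ 2) * K / R ^ (d - 3) with hP
  have hP0 : 0 ≤ P := by positivity
  have hGi : ∀ i, ∫⁻ x, G i x ≤ ENNReal.ofReal P * Y := by
    intro i
    rw [hG]
    simp only
    rw [lintegral_add_left (hFm2.lintegral_prod_right'.const_mul _),
      lintegral_const_mul' _ _ ENNReal.ofReal_ne_top, lintegral_const_mul' _ _ ENNReal.ofReal_ne_top]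
    refine (add_le_add (mul_le_mul_right (hint i F _ hFm2 hL) _)
      (mul_le_mul_right (hint i F' _ hFm2' hL') _)).trans_eq ?_
    have e : ∀ u v w : ℝ, 0 ≤ u → 0 ≤ v → 0 ≤ w → ENNReal.ofReal u * (ENNReal.ofReal v * Y *
        ENNReal.ofReal w) = ENNReal.ofReal (u * v * w) * Y := by
      intro u v w hu hv hw
      rw [ENNReal.ofReal_mul (by positivity), ENNReal.ofReal_mul (by positivity)]; ring
    rw [e _ _ _ (by positivity) (by positivity) (by positivity),
      e _ _ _ (by positivity) (by positivity) (by positivity), ← add_mul,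
      ← ENNReal.ofReal_add (by positivity) (by positivity)]
    congr 2
    rw [hP, hδR]
    field_simp
  -- The majorant is a finite sum over the covering intervals, hence measurable even if E is
  -- uncountable.
  refine ⟨fun x => ∑ i, G i x, Finset.measurable_sum _ fun i _ => hGm i, fun t ht x => ?_, ?_⟩
  · obtain ⟨i, hi⟩ := Set.mem_iUnion.mp (hcE ht)
    refine (enorm_sq_le_of_hasDerivAt (fun t => hasDerivAt_bilinearMultiplier_cutSymbol hν hSm
      hR0.le hSR' hai hbi x t) (continuous_bilinearMultiplier_cutSymbolDeriv hν hSm hR0.le hSR'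
      hai hbi x) hδ0 hi).trans ?_
    exact Finset.single_le_sum (f := fun i => G i x) (fun _ _ => zero_le) (Finset.mem_univ i)
  · rw [lintegral_finsetSum _ fun i _ => hGm i]
    have hYle : Y ≤ ENNReal.ofReal ((2 * R ^ 2) ^ s₁ * (2 * R ^ 2) ^ s₂) *
        (negSobolevSq s₁ a * negSobolevSq s₂ b) := by
      rw [ENNReal.ofReal_mul (by positivity)]
      calc Y ≤ _ := mul_le_mul' (setLIntegral_ball_le_negSobolevSq hs₁ hR1 a)
            (setLIntegral_ball_le_negSobolevSq hs₂ hR1 b)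
        _ = _ := by ring
    calc ∑ i, ∫⁻ x, G i x ≤ ∑ i : Fin (intervalCoveringNumber E δ), ENNReal.ofReal P * Y :=
          Finset.sum_le_sum fun i _ => hGi i
      _ = ENNReal.ofReal ((intervalCoveringNumber E δ : ℝ) * P) * Y := by
          rw [Finset.sum_const, Finset.card_univ, Fintype.card_fin, nsmul_eq_mul,
            ENNReal.ofReal_mul (by positivity), ENNReal.ofReal_natCast, mul_assoc]
      _ ≤ ENNReal.ofReal (N * 2 ^ ((β + 1 / 2) * n) * P) *
          (ENNReal.ofReal ((2 * R ^ 2) ^ s₁ * (2 * R ^ 2) ^ s₂) *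
            (negSobolevSq s₁ a * negSobolevSq s₂ b)) := by
          gcongr
          exact hN n
      _ = ENNReal.ofReal (N * 2 ^ ((β + 1 / 2) * n) * P * ((2 * R ^ 2) ^ s₁ * (2 * R ^ 2) ^ s₂)) *
            (negSobolevSq s₁ a * negSobolevSq s₂ b) := by
          rw [← mul_assoc, ← ENNReal.ofReal_mul (by positivity)]
      _ ≤ _ := by
          rw [← mul_assoc]
          refine mul_le_mul' (mul_le_mul' (ENNReal.ofReal_le_ofReal ?_) le_rfl) le_rfl
          have hRr : ∀ s : ℝ, (2 * R ^ 2) ^ s = 2 ^ s * (2 : ℝ) ^ (2 * n * s) := by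
            intro s
            rw [Real.mul_rpow (by norm_num) (by positivity), hR, ← pow_mul,
              ← Real.rpow_natCast 2 (n * 2), ← Real.rpow_mul (by norm_num)]
            congr 2
            push_cast; ring
          have hRd : R ^ (d - 3) = (2 : ℝ) ^ ((n : ℝ) * ((d : ℝ) - 3)) := by
            rw [hR, ← pow_mul, ← Real.rpow_natCast]
            congr 1
            rw [Nat.cast_mul, Nat.cast_sub (by omega)]
            norm_num
          rw [hP, hRr, hRr, hRd, div_eq_mul_inv _ ((2 : ℝ) ^ (_ : ℝ)), ← Real.rpow_neg (by norm_num)]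
          have h2 : (2 : ℝ) ^ ((β + 1 / 2) * n) * 2 ^ (-((n : ℝ) * ((d : ℝ) - 3))) *
              2 ^ (2 * n * s₁) * 2 ^ (2 * n * s₂) ≤ 2 ^ (-(n : ℝ) / 2) := by
            rw [← Real.rpow_add (by norm_num), ← Real.rpow_add (by norm_num),
              ← Real.rpow_add (by norm_num)]
            refine Real.rpow_le_rpow_of_exponent_le (by norm_num) ?_
            have hn0 : (0 : ℝ) ≤ n := Nat.cast_nonneg n
            have h3 : β + 1 / 2 - ((d : ℝ) - 3) + 2 * (s₁ + s₂) ≤ -1 / 2 := by linarith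
            nlinarith [mul_le_mul_of_nonneg_left h3 hn0]
          calc _ = N * ((2 + 2 * (2 * Real.pi) ^ 2) * K) * 2 ^ s₁ * 2 ^ s₂ *
                ((2 : ℝ) ^ ((β + 1 / 2) * n) * 2 ^ (-((n : ℝ) * ((d : ℝ) - 3))) *
              2 ^ (2 * n * s₁) * 2 ^ (2 * n * s₂)) := by ring
            _ ≤ _ := by gcongr

end Piece

/-! ### Weighted Cauchy–Schwarz for series -/

section WeightedSum

/-- Cauchy–Schwarz for a series with weights. -/
lemma tsum_sq_le_weighted {w : ℕ → ℝ≥0∞} (hw0 : ∀ n, w n ≠ 0) (hwt : ∀ n, w n ≠ ∞) (u : ℕ → ℝ≥0∞) :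
    (∑' n, u n) ^ 2 ≤ (∑' n, w n) * ∑' n, (w n)⁻¹ * u n ^ 2 := by
  have h := ENNReal.lintegral_mul_le_Lp_mul_Lq (Measure.count : Measure ℕ)
    Real.HolderConjugate.two_two (f := fun n => w n ^ (1 / 2 : ℝ))
    (g := fun n => (w n ^ (1 / 2 : ℝ))⁻¹ * u n) (measurable_of_countable _).aemeasurable
    (measurable_of_countable _).aemeasurable
  simp only [Pi.mul_apply, lintegral_count] at h
  have h1 : ∀ n, w n ^ (1 / 2 : ℝ) * ((w n ^ (1 / 2 : ℝ))⁻¹ * u n) = u n := fun n => by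
    rw [← mul_assoc, ENNReal.mul_inv_cancel, one_mul]
    · simp [hw0 n, hwt n]
    · exact ENNReal.rpow_ne_top_of_nonneg (by norm_num) (hwt n)
  have h2 : ∀ n, (w n ^ (1 / 2 : ℝ)) ^ (2 : ℝ) = w n := fun n => by
    rw [← ENNReal.rpow_mul]; norm_num
  have h3 : ∀ n, ((w n ^ (1 / 2 : ℝ))⁻¹ * u n) ^ (2 : ℝ) = (w n)⁻¹ * u n ^ 2 := fun n => by
    rw [ENNReal.mul_rpow_of_nonneg _ _ (by norm_num), ← ENNReal.inv_rpow, ← ENNReal.rpow_mul]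
    norm_num
  simp only [h1, h2, h3] at h
  refine (pow_le_pow_left' h 2).trans_eq ?_
  rw [mul_pow, ← ENNReal.rpow_natCast, ← ENNReal.rpow_natCast, ← ENNReal.rpow_mul,
    ← ENNReal.rpow_mul]
  norm_num

end WeightedSum

/-! ### Summation over all frequencies -/

section FullMultiplier

variable {d : ℕ} {ν : Measure (Eu d × Eu d)} {a b : Eu d → ℂ}

lemma setIntegral_eq_bilinearMultiplier_cutSymbol {S : Set (Eu d × Eu d)} (hS : MeasurableSet S)
    (t : ℝ) (x : Eu d) :
    ∫ q in S, a q.1 * b q.2 * mult ν (-(2 * Real.pi) * t) q.1 q.2 *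
      Complex.exp (((2 * Real.pi * inner ℝ x (q.1 + q.2) : ℝ) : ℂ) * Complex.I) =
    bilinearMultiplier (cutSymbol ν S t) a b x := by
  rw [← integral_indicator hS, bilinearMultiplier]
  refine integral_congr_ae (Eventually.of_forall fun q => ?_)
  by_cases h : q ∈ S <;> simp [cutSymbol, h]

lemma bilinearMultiplier_cutSymbol_swap (S : Set (Eu d × Eu d)) (t : ℝ) (x : Eu d) :
    bilinearMultiplier (cutSymbol ν S t) a b x =
      bilinearMultiplier (cutSymbol (ν.map Prod.swap) (Prod.swap ⁻¹' S) t) b a x := by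
  rw [bilinearMultiplier, bilinearMultiplier, Measure.volume_eq_prod, ← integral_prod_swap]
  refine integral_congr_ae (Eventually.of_forall fun q => ?_)
  have h : cutSymbol ν S t q.2 q.1 =
      cutSymbol (ν.map Prod.swap) (Prod.swap ⁻¹' S) t q.1 q.2 := by
    by_cases h : (q.2, q.1) ∈ S
    · have h' : (q.1, q.2) ∈ Prod.swap ⁻¹' S := h
      rw [cutSymbol, cutSymbol, Set.indicator_of_mem h, Set.indicator_of_mem h', mult_map_swap]
    · have h' : (q.1, q.2) ∉ Prod.swap ⁻¹' S := h
      rw [cutSymbol, cutSymbol, Set.indicator_of_notMem h, Set.indicator_of_notMem h']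
  simp only [Prod.fst_swap, Prod.snd_swap]
  rw [h, add_comm q.2 q.1]
  ring

/-- The maximal estimate for bilinear multiplier operators with the triangle symbols. -/
theorem IsTriangleInvariant.exists_multiplier_maximal_le (hν : IsTriangleInvariant ν) {E : Set ℝ}
    (hE : E ⊆ Set.Icc 1 2) {β : ℝ} (hβ : upperMinkowskiDim E = (β : EReal))
    (hd : 4 + β < (d : ℝ)) {s₁ s₂ : ℝ} (hs₁ : 0 ≤ s₁) (hs₂ : 0 ≤ s₂)
    (hs : s₁ + s₂ < ((d : ℝ) - 4 - β) / 2) :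
    ∃ C : NNReal, ∀ a b : Eu d → ℂ, Measurable a → Measurable b → Integrable a → Integrable b →
      (∃ Ma, ∀ ξ, ‖a ξ‖ ≤ Ma) → (∃ Mb, ∀ ξ, ‖b ξ‖ ≤ Mb) →
      ∃ U : Eu d → ℝ≥0∞, Measurable U ∧
        (∀ t ∈ E, ∀ x,
          ‖bilinearMultiplier (mult ν (-(2 * Real.pi) * t)) a b x‖ₑ ^ 2 ≤ U x) ∧
        ∫⁻ x, U x ≤ C * negSobolevSq s₁ a * negSobolevSq s₂ b := by
  have := hν.finite
  obtain ⟨C₁, hC₁, H₁⟩ := hν.exists_dyadic_maximal_le hE hβ hd hs₁ hs₂ hs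
  obtain ⟨C₂, hC₂, H₂⟩ := hν.swap.exists_dyadic_maximal_le hE hβ hd hs₂ hs₁ (by linarith)
  -- The weights are w n = 2^{-n/4}. The n-th piece decays like 2^{-n/2} = (w n)², so after division
  -- by w n the summable w n remains.
  set r : ℝ := (2 : ℝ) ^ (-1 / 4 : ℝ) with hr
  have hr0 : 0 < r := by positivity
  have hr1 : r < 1 := Real.rpow_lt_one_of_one_lt_of_neg (by norm_num) (by norm_num)
  set w : ℕ → ℝ≥0∞ := fun n => ENNReal.ofReal r ^ n with hw
  have hrE0 : ENNReal.ofReal r ≠ 0 := by simpa using hr0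
  have hw0 : ∀ n, w n ≠ 0 := fun n => pow_ne_zero _ hrE0
  have hwt : ∀ n, w n ≠ ∞ := fun n => ENNReal.pow_ne_top ENNReal.ofReal_ne_top
  have hW : ∑' n, w n ≠ ∞ := by
    rw [hw, ENNReal.tsum_geometric]
    refine ENNReal.inv_ne_top.mpr (tsub_pos_of_lt ?_).ne'
    rw [← ENNReal.ofReal_one]
    exact (ENNReal.ofReal_lt_ofReal_iff one_pos).mpr hr1
  set W := ∑' n, w n with hWdef
  have hpow : ∀ C : ℝ, 0 ≤ C → ∀ n : ℕ, ENNReal.ofReal (C * (2 : ℝ) ^ (-(n : ℝ) / 2)) =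
      ENNReal.ofReal C * w n ^ 2 := by
    intro C hC n
    rw [ENNReal.ofReal_mul hC, hw]
    simp only
    rw [← ENNReal.ofReal_pow hr0.le, ← ENNReal.ofReal_pow (pow_nonneg hr0.le n), hr,
      ← Real.rpow_natCast, ← Real.rpow_natCast, ← Real.rpow_mul zero_le_two,
      ← Real.rpow_mul zero_le_two]
    congr 3
    push_cast; ring
  set K : ℝ≥0∞ := W * (W * (2 * ENNReal.ofReal C₁ + 2 * ENNReal.ofReal C₂)) with hK
  have hKt : K ≠ ∞ := ENNReal.mul_ne_top hW (ENNReal.mul_ne_top hW (by finiteness))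
  refine ⟨K.toNNReal, fun a b ha hb hai hbi haM hbM => ?_⟩
  rw [ENNReal.coe_toNNReal hKt]
  -- Frequency space is split according to which frequency is larger, then dyadically in the larger
  -- one. After swapping the coordinates, Q n satisfies the conditions of the dyadic estimate for
  -- the swapped measure.
  set P : ℕ → Set (Eu d × Eu d) := fun n => {q | ‖q.1‖ ≤ ‖q.2‖ ∧ dyadicIndex ‖q.2‖ = n} with hP
  set Q : ℕ → Set (Eu d × Eu d) := fun n => {q | ‖q.2‖ < ‖q.1‖ ∧ dyadicIndex ‖q.1‖ = n} with hQ
  have hPm : ∀ n, MeasurableSet (P n) := fun n =>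
    (measurableSet_le measurable_fst.norm measurable_snd.norm).inter
      ((measurable_dyadicIndex.comp measurable_snd.norm) (measurableSet_singleton n))
  have hQm : ∀ n, MeasurableSet (Q n) := fun n =>
    (measurableSet_lt measurable_snd.norm measurable_fst.norm).inter
      ((measurable_dyadicIndex.comp measurable_fst.norm) (measurableSet_singleton n))
  choose U hUm hU hUi using fun n => H₁ n (P n) (hPm n) (fun q hq => hq) a b ha hb hai hbi haM
  choose V hVm hV hVi using fun n => H₂ n (Prod.swap ⁻¹' (Q n)) (measurable_swap (hQm n))
    (fun q hq => ⟨hq.1.le, hq.2⟩) b a hb ha hbi hai hbM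
  refine ⟨fun x => W * ∑' n, (w n)⁻¹ * (2 * U n x + 2 * V n x), ?_, fun t ht x => ?_, ?_⟩
  · exact (Measurable.tsum fun n => (((hUm n).const_mul 2).add
      ((hVm n).const_mul 2)).const_mul _).const_mul _
  · set f : Eu d × Eu d → ℂ := fun q => a q.1 * b q.2 * mult ν (-(2 * Real.pi) * t) q.1 q.2 *
      Complex.exp (((2 * Real.pi * inner ℝ x (q.1 + q.2) : ℝ) : ℂ) * Complex.I) with hf
    have hmm : Measurable (Function.uncurry (mult ν (-(2 * Real.pi) * t))) :=
      (measurable_mult (ν := ν)).comp (measurable_prodMk_left (x := -(2 * Real.pi) * t))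
    have hfi : Integrable f :=
      integrable_mul_mul_exp hmm (norm_mult_le _) hai hbi x
    have hun : ⋃ n, (P n ∪ Q n) = Set.univ := by
      refine Set.eq_univ_of_forall fun q => Set.mem_iUnion.mpr ?_
      rcases le_or_gt ‖q.1‖ ‖q.2‖ with h | h
      · exact ⟨_, Or.inl ⟨h, rfl⟩⟩
      · exact ⟨_, Or.inr ⟨h, rfl⟩⟩
    have hdis : Pairwise (Function.onFun Disjoint fun n => P n ∪ Q n) := by
      intro m n hmn
      refine Set.disjoint_left.mpr ?_
      rintro q (⟨h1, h2⟩ | ⟨h1, h2⟩) (⟨h3, h4⟩ | ⟨h3, h4⟩)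
      · exact hmn (h2.symm.trans h4)
      · exact absurd h1 (not_le.mpr h3)
      · exact absurd h3 (not_le.mpr h1)
      · exact hmn (h2.symm.trans h4)
    have hsum := hasSum_integral_iUnion (μ := volume) (f := f)
      (fun n => (hPm n).union (hQm n)) hdis hfi.integrableOn
    rw [hun, setIntegral_univ] at hsum
    have hle : ‖bilinearMultiplier (mult ν (-(2 * Real.pi) * t)) a b x‖ₑ ≤
        ∑' n, ‖∫ q in P n ∪ Q n, f q‖ₑ := by
      change ‖∫ q, f q‖ₑ ≤ _
      rw [← hsum.tsum_eq]
      exact enorm_tsum_le_tsum_enorm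
    have hpiece : ∀ n, ‖∫ q in P n ∪ Q n, f q‖ₑ ^ 2 ≤ 2 * U n x + 2 * V n x := by
      intro n
      have hd' : Disjoint (P n) (Q n) := by
        refine Set.disjoint_left.mpr ?_
        rintro q ⟨h1, -⟩ ⟨h3, -⟩
        exact absurd h1 (not_le.mpr h3)
      rw [setIntegral_union hd' (hQm n) hfi.integrableOn hfi.integrableOn,
        setIntegral_eq_bilinearMultiplier_cutSymbol (hPm n),
        setIntegral_eq_bilinearMultiplier_cutSymbol (hQm n), bilinearMultiplier_cutSymbol_swap (Q n)]
      refine (pow_le_pow_left' (enorm_add_le _ _) 2).trans ((add_sq_le_two_mul _ _).trans ?_)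
      gcongr
      · exact hU n t ht x
      · exact hV n t ht x
    refine (pow_le_pow_left' hle 2).trans ((tsum_sq_le_weighted hw0 hwt _).trans ?_)
    exact mul_le_mul_right (ENNReal.tsum_le_tsum fun n => mul_le_mul_right (hpiece n) _) _
  · have hm : ∀ n, Measurable fun x => 2 * U n x + 2 * V n x := fun n =>
      ((hUm n).const_mul 2).add ((hVm n).const_mul 2)
    rw [lintegral_const_mul' _ _ hW, lintegral_tsum fun n => ((hm n).const_mul _).aemeasurable]
    have hn : ∀ n, ∫⁻ x, (w n)⁻¹ * (2 * U n x + 2 * V n x) ≤ w n *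
        ((2 * ENNReal.ofReal C₁ + 2 * ENNReal.ofReal C₂) * negSobolevSq s₁ a * negSobolevSq s₂ b) := by
      intro n
      rw [lintegral_const_mul _ (hm n), lintegral_add_left ((hUm n).const_mul 2),
        lintegral_const_mul _ (hUm n), lintegral_const_mul _ (hVm n)]
      calc (w n)⁻¹ * (2 * (∫⁻ x, U n x) + 2 * ∫⁻ x, V n x)
          ≤ (w n)⁻¹ * (2 * (ENNReal.ofReal C₁ * w n ^ 2 * negSobolevSq s₁ a * negSobolevSq s₂ b) +
            2 * (ENNReal.ofReal C₂ * w n ^ 2 * negSobolevSq s₂ b * negSobolevSq s₁ a)) := by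
            rw [← hpow C₁ hC₁, ← hpow C₂ hC₂]
            gcongr
            · exact hUi n
            · exact hVi n
        _ = ((w n)⁻¹ * w n) * w n * ((2 * ENNReal.ofReal C₁ + 2 * ENNReal.ofReal C₂) *
            negSobolevSq s₁ a * negSobolevSq s₂ b) := by ring
        _ = _ := by rw [ENNReal.inv_mul_cancel (hw0 n) (hwt n), one_mul]
    calc _ ≤ W * ∑' n, w n * ((2 * ENNReal.ofReal C₁ + 2 * ENNReal.ofReal C₂) *
            negSobolevSq s₁ a * negSobolevSq s₂ b) := by
          gcongr
          exact hn _
      _ = _ := by rw [ENNReal.tsum_mul_right, hK]; ring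

end FullMultiplier

/-! ### Averages of Schwartz functions as bilinear multipliers -/

section SchwartzFormula

variable {d : ℕ}

lemma triangleAverage_eq (f g : Eu d → ℂ) (t : ℝ) (x : Eu d) :
    triangleAverage f g t x = ∫ p, f (x - t • p.1) * g (x - t • p.2) ∂(pairMeasure d) := by
  rw [pairMeasure, integral_map_equiv]
  rfl

lemma SchwartzMap.eq_integral_fourier (φ : 𝓢(Eu d, ℂ)) (x : Eu d) :
    φ x = ∫ ξ, (𝓕 φ : 𝓢(Eu d, ℂ)) ξ * Complex.exp (((2 * Real.pi * inner ℝ ξ x : ℝ) : ℂ) * Complex.I) := by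
  have h : 𝓕⁻ (𝓕 φ : 𝓢(Eu d, ℂ)) = φ := FourierTransform.fourierInv_fourier_eq φ
  conv_lhs => rw [← h, SchwartzMap.fourierInv_coe, Real.fourierInv_eq']
  simp only [smul_eq_mul, mul_comm]

/-- Fourier inversion in both factors, then Fubini: the integral of the phases over the triangles is
the multiplier at θ = -2πt. -/
lemma triangleAverage_schwartz (φ ψ : 𝓢(Eu d, ℂ)) (t : ℝ) (x : Eu d) :
    triangleAverage φ ψ t x =
      bilinearMultiplier (mult (pairMeasure d) (-(2 * Real.pi) * t)) (𝓕 φ : 𝓢(Eu d, ℂ)) (𝓕 ψ : 𝓢(Eu d, ℂ)) x := by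
  have := (isTriangleInvariant_pairMeasure d).finite
  set ν := pairMeasure d
  set a : 𝓢(Eu d, ℂ) := 𝓕 φ
  set b : 𝓢(Eu d, ℂ) := 𝓕 ψ
  set G : Eu d × Eu d → Eu d × Eu d → ℂ := fun p q =>
    (a q.1 * Complex.exp (((2 * Real.pi * inner ℝ q.1 (x - t • p.1) : ℝ) : ℂ) * Complex.I)) *
    (b q.2 * Complex.exp (((2 * Real.pi * inner ℝ q.2 (x - t • p.2) : ℝ) : ℂ) * Complex.I)) with hG
  have hGc : Continuous (Function.uncurry G) := by
    have h1 := a.continuous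
    have h2 := b.continuous
    simp only [hG, Function.uncurry_def]
    fun_prop
  have hGi : Integrable (Function.uncurry G) (ν.prod (volume.prod volume)) := by
    have h3 : Integrable (fun q : Eu d × Eu d => ‖a q.1 * b q.2‖) (volume.prod volume) :=
      (a.integrable.mul_prod b.integrable).norm
    refine ((integrable_const (1 : ℝ)).mul_prod h3 (μ := ν)).mono'
      hGc.aestronglyMeasurable (Eventually.of_forall fun r => ?_)
    simp only [hG, Function.uncurry_def, norm_mul, Complex.norm_exp_ofReal_mul_I, mul_one, one_mul]
    exact le_rfl
  rw [triangleAverage_eq]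
  calc ∫ p, φ (x - t • p.1) * ψ (x - t • p.2) ∂ν
      = ∫ p, (∫ q, G p q ∂(volume.prod volume)) ∂ν := by
        refine integral_congr_ae (Eventually.of_forall fun p => ?_)
        simp only [hG]
        rw [integral_prod_mul (fun ξ => a ξ * Complex.exp (((2 * Real.pi *
          inner ℝ ξ (x - t • p.1) : ℝ) : ℂ) * Complex.I)) (fun ξ => b ξ * Complex.exp (((2 *
          Real.pi * inner ℝ ξ (x - t • p.2) : ℝ) : ℂ) * Complex.I)),
          ← SchwartzMap.eq_integral_fourier, ← SchwartzMap.eq_integral_fourier]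
    _ = ∫ q, (∫ p, G p q ∂ν) ∂(volume.prod volume) := integral_integral_swap hGi
    _ = _ := by
        rw [bilinearMultiplier, Measure.volume_eq_prod]
        refine integral_congr_ae (Eventually.of_forall fun q => ?_)
        simp only [hG, mult]
        rw [← integral_const_mul, ← integral_mul_const]
        refine integral_congr_ae (Eventually.of_forall fun p => ?_)
        simp only
        have he : Complex.exp (((2 * Real.pi * inner ℝ q.1 (x - t • p.1) : ℝ) : ℂ) * Complex.I) *
            Complex.exp (((2 * Real.pi * inner ℝ q.2 (x - t • p.2) : ℝ) : ℂ) * Complex.I) =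
            Complex.exp (((-(2 * Real.pi) * t * (inner ℝ q.1 p.1 + inner ℝ q.2 p.2) : ℝ) : ℂ) *
              Complex.I) *
            Complex.exp (((2 * Real.pi * inner ℝ x (q.1 + q.2) : ℝ) : ℂ) * Complex.I) := by
          rw [← Complex.exp_add, ← Complex.exp_add, inner_sub_right, inner_sub_right,
            inner_smul_right, inner_smul_right, inner_add_right, real_inner_comm x q.1,
            real_inner_comm x q.2]
          congr 1
          push_cast
          ring
        calc _ = a q.1 * b q.2 * (Complex.exp (((2 * Real.pi * inner ℝ q.1 (x - t • p.1) : ℝ) :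
              ℂ) * Complex.I) * Complex.exp (((2 * Real.pi * inner ℝ q.2 (x - t • p.2) : ℝ) : ℂ) *
              Complex.I)) := by ring
          _ = _ := by rw [he]; ring

/-- The maximal estimate for Schwartz functions. -/
theorem exists_schwartz_maximal_le {E : Set ℝ} (hE : E ⊆ Set.Icc 1 2) {β : ℝ}
    (hβ : upperMinkowskiDim E = (β : EReal)) (hd : 4 + β < (d : ℝ)) {s₁ s₂ : ℝ} (hs₁ : 0 ≤ s₁)
    (hs₂ : 0 ≤ s₂) (hs : s₁ + s₂ < ((d : ℝ) - 4 - β) / 2) :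
    ∃ C : NNReal, ∀ φ ψ : 𝓢(Eu d, ℂ),
      ∫⁻ x, triangleMaximal E φ ψ x ^ 2 ≤
        C * negSobolevSq s₁ (𝓕 φ : 𝓢(Eu d, ℂ)) * negSobolevSq s₂ (𝓕 ψ : 𝓢(Eu d, ℂ)) := by
  obtain ⟨C, hC⟩ := (isTriangleInvariant_pairMeasure d).exists_multiplier_maximal_le hE hβ hd
    hs₁ hs₂ hs
  have hbd : ∀ φ : 𝓢(Eu d, ℂ), ∃ M, ∀ ξ, ‖φ ξ‖ ≤ M := fun φ =>
    ⟨_, fun ξ => SchwartzMap.norm_le_seminorm ℂ φ ξ⟩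
  refine ⟨C, fun φ ψ => ?_⟩
  set a : 𝓢(Eu d, ℂ) := 𝓕 φ with ha
  set b : 𝓢(Eu d, ℂ) := 𝓕 ψ with hb
  obtain ⟨U, -, hU, hUi⟩ := hC a b a.continuous.measurable b.continuous.measurable a.integrable
    b.integrable (hbd _) (hbd _)
  refine (lintegral_mono fun x => ?_).trans hUi
  have hpow : ∀ z : ℝ≥0∞, z = (z ^ 2) ^ (1 / 2 : ℝ) := fun z => by
    rw [← ENNReal.rpow_natCast, ← ENNReal.rpow_mul]; norm_num
  have h : triangleMaximal E φ ψ x ≤ U x ^ (1 / 2 : ℝ) := by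
    refine iSup₂_le fun t ht => ?_
    rw [hpow ‖_‖ₑ, triangleAverage_schwartz]
    exact ENNReal.rpow_le_rpow (hU t ht x) (by norm_num)
  refine (pow_le_pow_left' h 2).trans_eq ?_
  rw [← ENNReal.rpow_natCast, ← ENNReal.rpow_mul]; norm_num

end SchwartzFormula

/-! ### Approximation from below and by Schwartz functions -/

section Approximation

variable {d : ℕ}

/-- A nonnegative lower semicontinuous function is the supremum of an increasing sequence of
compactly supported continuous functions. -/
lemma LowerSemicontinuous.exists_monotone_seq {f : Eu d → ℝ≥0∞} (hf : LowerSemicontinuous f) :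
    ∃ h : ℕ → Eu d → ℝ, (∀ n, Continuous (h n)) ∧ (∀ n, HasCompactSupport (h n)) ∧
      (∀ n x, 0 ≤ h n x) ∧ Monotone h ∧ ∀ x, ⨆ n, ENNReal.ofReal (h n x) = f x := by
  -- A bump at x scaled to a height c < f x stays below f, so f is the supremum of A. A countable
  -- subfamily has the same supremum, and its partial suprema increase to f. The zero function is
  -- added to make that family nonempty before it is enumerated.
  set A : Set (Eu d → ℝ≥0∞) := {F | ∃ g : Eu d → ℝ, Continuous g ∧ HasCompactSupport g ∧
    (∀ x, 0 ≤ g x) ∧ F = (fun x => ENNReal.ofReal (g x)) ∧ F ≤ f} with hA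
  have hlub : IsLUB A f := by
    rw [isLUB_pi]
    intro x
    refine ⟨?_, fun b hb => ?_⟩
    · rintro _ ⟨F, ⟨g, -, -, -, -, hle⟩, rfl⟩
      exact hle x
    · refine le_of_forall_lt_imp_le_of_dense fun c hc => ?_
      have hct : c ≠ ∞ := hc.ne_top
      obtain ⟨g, hg1, hg0, hgc, hg01⟩ := exists_continuous_one_zero_of_isCompact
        (isCompact_singleton (x := x)) (hf.isOpen_preimage c).isClosed_compl
        (by simpa using hc)
      refine hb ⟨fun y => ENNReal.ofReal (c.toReal * g y), ⟨fun y => c.toReal * g y,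
        by fun_prop, hgc.mul_left, fun y => mul_nonneg ENNReal.toReal_nonneg (hg01 y).1, rfl, ?_⟩, ?_⟩
      · intro y
        by_cases hy : c < f y
        · refine le_trans ?_ hy.le
          change ENNReal.ofReal (c.toReal * g y) ≤ c
          rw [ENNReal.ofReal_mul ENNReal.toReal_nonneg, ENNReal.ofReal_toReal hct]
          exact mul_le_of_le_one_right (by positivity) (ENNReal.ofReal_le_one.mpr (hg01 y).2)
        · have : g y = 0 := hg0 (by simpa using hy)
          simp [this]
      · have : g x = 1 := hg1 (Set.mem_singleton x)
        simp [this, hct]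
  obtain ⟨A', hsub, hcount, hlub'⟩ := exists_countable_lowerSemicontinuous_isLUB
    (fun F hF => by
      obtain ⟨g, hg, -, -, rfl, -⟩ := hF
      exact (ENNReal.continuous_ofReal.comp hg).lowerSemicontinuous) hlub
  have h0 : (fun _ => 0 : Eu d → ℝ≥0∞) ∈ A :=
    ⟨fun _ => 0, continuous_const, HasCompactSupport.zero, fun _ => le_rfl, by simp,
      fun _ => zero_le⟩
  obtain ⟨F, hF⟩ := (hcount.insert (fun _ => 0)).exists_eq_range (Set.insert_nonempty _ _)
  have hmem : ∀ n, F n ∈ A := fun n => by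
    have : F n ∈ insert (fun _ => 0) A' := hF ▸ Set.mem_range_self n
    rcases this with h | h
    · rw [h]; exact h0
    · exact hsub h
  choose g hgc hgs hg0 hgF hgf using hmem
  have hsucc : ∀ n, partialSups g (n + 1) = partialSups g n ⊔ g (n + 1) := fun n =>
    partialSups_succ g n
  have hz : partialSups g 0 = g 0 := partialSups_zero g
  refine ⟨partialSups g, fun n => ?_, fun n => ?_, fun n x => ?_, (partialSups g).monotone,
    fun x => le_antisymm (iSup_le fun n => ?_) ?_⟩
  · induction n with
    | zero => rw [hz]; exact hgc 0
    | succ n ih => rw [hsucc]; exact ih.sup (hgc _)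
  · induction n with
    | zero => rw [hz]; exact hgs 0
    | succ n ih =>
      rw [hsucc]
      exact ih.comp₂_left (hgs _) (m := fun u v => u ⊔ v) (by simp)
  · exact (hg0 0 x).trans (hz ▸ (partialSups g).monotone (Nat.zero_le n) x)
  · induction n with
    | zero => rw [hz]; have := hgf 0 x; rwa [hgF] at this
    | succ n ih =>
      rw [hsucc, Pi.sup_apply, ENNReal.ofReal_max]
      have := hgf (n + 1) x
      rw [hgF] at this
      exact max_le ih this
  · have hx := (isLUB_pi.mp hlub' x).2
    refine hx ?_
    rintro _ ⟨G, hG, rfl⟩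
    obtain ⟨n, rfl⟩ : G ∈ Set.range F := hF ▸ Set.mem_insert_of_mem _ hG
    rw [Function.eval, hgF n]
    exact le_iSup_of_le n (ENNReal.ofReal_le_ofReal (le_partialSups g n x))

/-- Approximation of compactly supported continuous functions by Schwartz functions. -/
lemma exists_schwartz_approx {h : Eu d → ℝ} (hc : Continuous h) (hs : HasCompactSupport h)
    (h0 : ∀ x, 0 ≤ h x) :
    ∃ (φ : ℕ → 𝓢(Eu d, ℂ)) (M : ℝ), (∀ n x, ‖φ n x‖ ≤ M) ∧
      (∀ x, Tendsto (fun n => φ n x) atTop (𝓝 (h x : ℂ))) ∧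
      Tendsto (fun n => ∫⁻ x, ‖φ n x‖ₑ ^ 2) atTop (𝓝 (∫⁻ x, ENNReal.ofReal (h x) ^ 2)) ∧
      ∫⁻ x, ENNReal.ofReal (h x) ^ 2 ≠ ∞ := by
  obtain ⟨R, hR⟩ := hs.isCompact.isBounded.subset_closedBall (0 : Eu d)
  set R' := max R 1 with hR'
  have hR1 : 0 < R' := lt_max_of_lt_right one_pos
  have hsupp : ∀ x, h x ≠ 0 → x ∈ Metric.closedBall (0 : Eu d) R' := fun x hx =>
    Metric.closedBall_subset_closedBall (le_max_left _ _) (hR (subset_tsupport _ hx))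
  -- The cut-off χ is 1 on the support of h, so multiplying the smooth uniform approximants by χ
  -- gives them compact support without increasing the error.
  let χ : ContDiffBump (0 : Eu d) := ⟨R', R' + 1, hR1, by linarith⟩
  have hχh : ∀ x, χ x * h x = h x := fun x => by
    by_cases hx : h x = 0
    · simp [hx]
    · rw [χ.one_of_mem_closedBall (hsupp x hx), one_mul]
  obtain ⟨B, hB⟩ := hs.exists_bound_of_continuous hc
  choose g hg hgh using fun n : ℕ => (hs.uniformContinuous_of_continuous hc).exists_contDiff_dist_le
    (ε := 1 / ((n : ℝ) + 1)) (by positivity)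
  have hcs : ∀ n, HasCompactSupport (fun x => ((χ x * g n x : ℝ) : ℂ)) := fun n =>
    (χ.hasCompactSupport.mul_right (f' := g n)).comp_left (g := Complex.ofReal) rfl
  have hcd : ∀ n, ContDiff ℝ ((⊤ : ℕ∞) : WithTop ℕ∞) (fun x => ((χ x * g n x : ℝ) : ℂ)) := fun n =>
    Complex.ofRealCLM.contDiff.comp (χ.contDiff.mul (hg n))
  set φ : ℕ → 𝓢(Eu d, ℂ) := fun n => (hcs n).toSchwartzMap (hcd n) with hφ
  have hφa : ∀ n x, φ n x = ((χ x * g n x : ℝ) : ℂ) := fun n x => rfl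
  have hdist : ∀ n x, |χ x * g n x - h x| ≤ 1 / ((n : ℝ) + 1) := fun n x => by
    have e : χ x * g n x - h x = χ x * (g n x - h x) := by rw [mul_sub, hχh]
    rw [e, abs_mul, abs_of_nonneg χ.nonneg]
    have := (hgh n x).le
    rw [Real.dist_eq] at this
    exact (mul_le_of_le_one_left (abs_nonneg _) χ.le_one).trans this
  have hbd : ∀ n x, ‖φ n x‖ ≤ B + 1 := fun n x => by
    rw [hφa, Complex.norm_real, Real.norm_eq_abs]
    have h1 : (1 : ℝ) / ((n : ℝ) + 1) ≤ 1 := by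
      rw [div_le_one (by positivity)]; linarith [(Nat.cast_nonneg n : (0 : ℝ) ≤ n)]
    have h2 := hB x
    rw [Real.norm_eq_abs] at h2
    have h3 := abs_sub_abs_le_abs_sub (χ x * g n x) (h x)
    linarith [hdist n x]
  have hlim : ∀ x, Tendsto (fun n => φ n x) atTop (𝓝 (h x : ℂ)) := fun x => by
    simp only [hφa]
    refine (Complex.continuous_ofReal.tendsto _).comp ?_
    rw [tendsto_iff_dist_tendsto_zero]
    refine squeeze_zero (fun _ => dist_nonneg) (fun n => ?_) tendsto_one_div_add_atTop_nhds_zero_nat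
    rw [Real.dist_eq]
    exact hdist n x
  set bd : Eu d → ℝ≥0∞ := (Metric.closedBall 0 (R' + 1)).indicator
    fun _ => ENNReal.ofReal (B + 1) ^ 2 with hbdd
  have hbi : ∫⁻ x, bd x ≠ ∞ := by
    rw [hbdd, lintegral_indicator measurableSet_closedBall, setLIntegral_const]
    exact ENNReal.mul_ne_top (by finiteness) measure_closedBall_lt_top.ne
  have hle : ∀ n x, ‖φ n x‖ₑ ^ 2 ≤ bd x := fun n x => by
    by_cases hx : x ∈ Metric.closedBall (0 : Eu d) (R' + 1)
    · rw [hbdd, Set.indicator_of_mem hx, ← ofReal_norm]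
      gcongr
      exact hbd n x
    · have h0 : χ x = 0 := χ.zero_of_le_dist (by
        rw [Metric.mem_closedBall, not_le] at hx; exact hx.le)
      rw [hφa, h0]; simp
  have henorm : ∀ x, ‖(h x : ℂ)‖ₑ ^ 2 = ENNReal.ofReal (h x) ^ 2 := fun x => by
    rw [← ofReal_norm, Complex.norm_real, Real.norm_of_nonneg (h0 x)]
  have hpt : ∀ x, Tendsto (fun n => ‖φ n x‖ₑ ^ 2) atTop (𝓝 (ENNReal.ofReal (h x) ^ 2)) := fun x => by
    rw [← henorm]
    exact (ENNReal.continuous_pow 2).continuousAt.tendsto.comp (hlim x).enorm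
  refine ⟨φ, B + 1, hbd, hlim, tendsto_lintegral_of_dominated_convergence bd
    (fun n => (φ n).continuous.measurable.enorm.pow_const 2)
    (fun n => Eventually.of_forall (hle n)) hbi (Eventually.of_forall hpt), ?_⟩
  exact ne_top_of_le_ne_top hbi (lintegral_mono fun x => le_of_tendsto' (hpt x) fun n => hle n x)

end Approximation

/-! ### Measurable majorants for averages of square-integrable functions -/

section Majorant

variable {d : ℕ}

/-- Even for uncountable E, a supremum of continuous functions is lower semicontinuous, hence
measurable. -/
lemma measurable_maximalFunction {E : Set ℝ} {G : ℝ → Eu d → ℂ} (hG : ∀ t, Continuous (G t)) :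
    Measurable (maximalFunction E G) :=
  (lowerSemicontinuous_biSup fun t _ => (hG t).enorm.lowerSemicontinuous).measurable

lemma continuous_triangleAverage {f g : Eu d → ℂ} (hf : Continuous f) (hg : Continuous g) {M N : ℝ}
    (hM : ∀ x, ‖f x‖ ≤ M) (hN : ∀ x, ‖g x‖ ≤ N) (t : ℝ) : Continuous (triangleAverage f g t) := by
  have := (isTriangleInvariant_pairMeasure d).finite
  have h : triangleAverage f g t =
      fun x => ∫ p, f (x - t • p.1) * g (x - t • p.2) ∂(pairMeasure d) :=
    funext (triangleAverage_eq f g t)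
  have hM0 : 0 ≤ M := (norm_nonneg _).trans (hM 0)
  rw [h]
  refine continuous_of_dominated (bound := fun _ => M * N)
    (fun x => Continuous.aestronglyMeasurable (by fun_prop)) (fun x => Eventually.of_forall fun p => ?_)
    (integrable_const _) (Eventually.of_forall fun p => by fun_prop)
  rw [norm_mul]
  exact mul_le_mul (hM _) (hN _) (norm_nonneg _) hM0

lemma tendsto_triangleAverage {f g : Eu d → ℂ} {φ ψ : ℕ → Eu d → ℂ} (hφ : ∀ n, Continuous (φ n))
    (hψ : ∀ n, Continuous (ψ n)) {M N : ℝ} (hM : ∀ n x, ‖φ n x‖ ≤ M) (hN : ∀ n x, ‖ψ n x‖ ≤ N)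
    (hf : ∀ x, Tendsto (fun n => φ n x) atTop (𝓝 (f x)))
    (hg : ∀ x, Tendsto (fun n => ψ n x) atTop (𝓝 (g x))) (t : ℝ) (x : Eu d) :
    Tendsto (fun n => triangleAverage (φ n) (ψ n) t x) atTop (𝓝 (triangleAverage f g t x)) := by
  have := (isTriangleInvariant_pairMeasure d).finite
  have hM0 : 0 ≤ M := (norm_nonneg _).trans (hM 0 0)
  simp only [triangleAverage_eq]
  refine tendsto_integral_of_dominated_convergence (fun _ => M * N)
    (fun n => ?_) (integrable_const _) (fun n => Eventually.of_forall fun p => ?_)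
    (Eventually.of_forall fun p => (hf _).mul (hg _))
  · have h1 := hφ n
    have h2 := hψ n
    exact Continuous.aestronglyMeasurable (by fun_prop)
  · rw [norm_mul]
    exact mul_le_mul (hM n _) (hN n _) (norm_nonneg _) hM0

lemma iSup_sq_le {ι : Type*} {a : ι → ℝ≥0∞} {b : ℝ≥0∞} (h : ∀ i, a i ^ 2 ≤ b) : (⨆ i, a i) ^ 2 ≤ b := by
  have hpow : ∀ z : ℝ≥0∞, (z ^ 2) ^ (1 / 2 : ℝ) = z := fun z => by
    rw [← ENNReal.rpow_natCast, ← ENNReal.rpow_mul]; norm_num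
  have h1 : ⨆ i, a i ≤ b ^ (1 / 2 : ℝ) := iSup_le fun i => by
    rw [← hpow (a i)]
    exact ENNReal.rpow_le_rpow (h i) (by norm_num)
  refine (pow_le_pow_left' h1 2).trans_eq ?_
  rw [← ENNReal.rpow_natCast, ← ENNReal.rpow_mul]; norm_num

lemma maximalFunction_sq_le {E : Set ℝ} {G : ℝ → Eu d → ℂ} {x : Eu d} {b : ℝ≥0∞}
    (h : ∀ t ∈ E, ‖G t x‖ₑ ^ 2 ≤ b) : maximalFunction E G x ^ 2 ≤ b := by
  rw [maximalFunction, iSup_subtype']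
  exact iSup_sq_le fun t => h t.1 t.2

lemma negSobolevSq_zero_fourier_le (φ : 𝓢(Eu d, ℂ)) :
    negSobolevSq 0 (𝓕 φ : 𝓢(Eu d, ℂ)) ≤ ∫⁻ x, ‖φ x‖ₑ ^ 2 := by
  have h := lintegral_fourierInv_sq_le φ.integrable φ.continuous.measurable
  refine le_trans (le_of_eq ?_) h
  rw [negSobolevSq, ← lintegral_neg_eq_self]
  refine lintegral_congr fun ξ => ?_
  rw [neg_zero, Real.rpow_zero, ENNReal.ofReal_one, one_mul, SchwartzMap.fourier_coe,
    Real.fourierInv_eq_fourier_neg]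

lemma iSup_mul_iSup_of_monotone {u v : ℕ → ℝ≥0∞} (hu : Monotone u) (hv : Monotone v) :
    (⨆ n, u n) * ⨆ n, v n = ⨆ n, u n * v n := by
  refine le_antisymm ?_ (iSup_le fun n => mul_le_mul' (le_iSup u n) (le_iSup v n))
  rw [ENNReal.iSup_mul]
  refine iSup_le fun m => ?_
  rw [ENNReal.mul_iSup]
  refine iSup_le fun n => le_iSup_of_le (max m n) ?_
  exact mul_le_mul' (hu (le_max_left _ _)) (hv (le_max_right _ _))

/-- The averages of nonnegative functions. -/
noncomputable def posAverage (d : ℕ) (f g : Eu d → ℝ≥0∞) (t : ℝ) (x : Eu d) : ℝ≥0∞ :=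
  ∫⁻ p, f (x - t • p.1) * g (x - t • p.2) ∂(pairMeasure d)

lemma posAverage_ofReal {h k : Eu d → ℝ} (hc : Continuous h) (kc : Continuous k) (h0 : ∀ x, 0 ≤ h x)
    (k0 : ∀ x, 0 ≤ k x) {M N : ℝ} (hM : ∀ x, ‖h x‖ ≤ M) (kN : ∀ x, ‖k x‖ ≤ N) (t : ℝ) (x : Eu d) :
    posAverage d (fun x => ENNReal.ofReal (h x)) (fun x => ENNReal.ofReal (k x)) t x =
      ‖triangleAverage (fun x => (h x : ℂ)) (fun x => (k x : ℂ)) t x‖ₑ := by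
  have := (isTriangleInvariant_pairMeasure d).finite
  have hM0 : 0 ≤ M := (norm_nonneg _).trans (hM 0)
  have e : ∀ p : Eu d × Eu d, (h (x - t • p.1) : ℂ) * (k (x - t • p.2) : ℂ) =
      ((h (x - t • p.1) * k (x - t • p.2) : ℝ) : ℂ) := fun p => by push_cast; rfl
  rw [triangleAverage_eq, posAverage]
  simp_rw [e]
  rw [integral_complex_ofReal, ← ofReal_norm, Complex.norm_real, Real.norm_of_nonneg
    (integral_nonneg fun p => mul_nonneg (h0 _) (k0 _)), ofReal_integral_eq_lintegral_ofReal]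
  · refine lintegral_congr fun p => ?_
    rw [ENNReal.ofReal_mul (h0 _)]
  · refine (integrable_const (M * N)).mono' (Continuous.aestronglyMeasurable
      ((hc.comp (by fun_prop)).mul (kc.comp (by fun_prop))))
      (Eventually.of_forall fun p => ?_)
    rw [norm_mul]
    exact mul_le_mul (hM _) (kN _) (norm_nonneg _) hM0
  · exact Eventually.of_forall fun p => mul_nonneg (h0 _) (k0 _)

variable {E : Set ℝ} {C : NNReal}

/-- Passage from Schwartz functions to compactly supported continuous functions. -/
lemma lintegral_maximal_sq_le_of_hasCompactSupport
    (hC : ∀ φ ψ : 𝓢(Eu d, ℂ), ∫⁻ x, triangleMaximal E φ ψ x ^ 2 ≤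
      C * negSobolevSq 0 (𝓕 φ : 𝓢(Eu d, ℂ)) * negSobolevSq 0 (𝓕 ψ : 𝓢(Eu d, ℂ)))
    {h k : Eu d → ℝ} (hc : Continuous h) (kc : Continuous k) (hs : HasCompactSupport h)
    (ks : HasCompactSupport k) (h0 : ∀ x, 0 ≤ h x) (k0 : ∀ x, 0 ≤ k x) :
    ∫⁻ x, triangleMaximal E (fun x => (h x : ℂ)) (fun x => (k x : ℂ)) x ^ 2 ≤
      C * (∫⁻ x, ENNReal.ofReal (h x) ^ 2) * ∫⁻ x, ENNReal.ofReal (k x) ^ 2 := by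
  obtain ⟨φ, M, hM, hφ, hφi, hhi⟩ := exists_schwartz_approx hc hs h0
  obtain ⟨ψ, N, hN, hψ, hψi, hki⟩ := exists_schwartz_approx kc ks k0
  have hmeas : ∀ n, Measurable fun x => triangleMaximal E (φ n) (ψ n) x ^ 2 := fun n =>
    (measurable_maximalFunction (continuous_triangleAverage (φ n).continuous (ψ n).continuous
      (hM n) (hN n))).pow_const 2
  calc ∫⁻ x, triangleMaximal E (fun x => (h x : ℂ)) (fun x => (k x : ℂ)) x ^ 2
      ≤ ∫⁻ x, liminf (fun n => triangleMaximal E (φ n) (ψ n) x ^ 2) atTop := by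
        -- For each fixed t the averages converge pointwise, so the maximal function of the limit is
        -- at most the liminf of the maximal functions; Fatou's lemma then applies.
        refine lintegral_mono fun x => maximalFunction_sq_le fun t ht => ?_
        have h1 : Tendsto (fun n => ‖triangleAverage (φ n) (ψ n) t x‖ₑ ^ 2) atTop
            (𝓝 (‖triangleAverage (fun x => (h x : ℂ)) (fun x => (k x : ℂ)) t x‖ₑ ^ 2)) :=
          (ENNReal.continuous_pow 2).continuousAt.tendsto.comp
            (tendsto_triangleAverage (fun n => (φ n).continuous) (fun n => (ψ n).continuous)
              hM hN hφ hψ t x).enorm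
        rw [← h1.liminf_eq]
        refine liminf_le_liminf (Eventually.of_forall fun n => ?_)
        exact pow_le_pow_left' (le_iSup₂ (f := fun t (_ : t ∈ E) =>
          ‖triangleAverage (φ n) (ψ n) t x‖ₑ) t ht) 2
    _ ≤ liminf (fun n => ∫⁻ x, triangleMaximal E (φ n) (ψ n) x ^ 2) atTop :=
        lintegral_liminf_le hmeas
    _ ≤ liminf (fun n => C * (∫⁻ x, ‖φ n x‖ₑ ^ 2) * ∫⁻ x, ‖ψ n x‖ₑ ^ 2) atTop := by
        refine liminf_le_liminf (Eventually.of_forall fun n => (hC _ _).trans ?_)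
        gcongr
        · exact negSobolevSq_zero_fourier_le _
        · exact negSobolevSq_zero_fourier_le _
    _ = _ := by
        refine Tendsto.liminf_eq (ENNReal.Tendsto.mul (ENNReal.Tendsto.const_mul hφi
          (Or.inr ENNReal.coe_ne_top)) (Or.inr hki) hψi (Or.inr ?_))
        exact ENNReal.mul_ne_top ENNReal.coe_ne_top hhi

/-- The maximal estimate for lower semicontinuous nonnegative functions. -/
lemma lintegral_iSup_posAverage_sq_le
    (hC : ∀ φ ψ : 𝓢(Eu d, ℂ), ∫⁻ x, triangleMaximal E φ ψ x ^ 2 ≤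
      C * negSobolevSq 0 (𝓕 φ : 𝓢(Eu d, ℂ)) * negSobolevSq 0 (𝓕 ψ : 𝓢(Eu d, ℂ)))
    {f g : Eu d → ℝ≥0∞} (hf : LowerSemicontinuous f) (hg : LowerSemicontinuous g) :
    Measurable (fun x => ⨆ t ∈ E, posAverage d f g t x) ∧
      ∫⁻ x, (⨆ t ∈ E, posAverage d f g t x) ^ 2 ≤ C * (∫⁻ x, f x ^ 2) * ∫⁻ x, g x ^ 2 := by
  obtain ⟨h, hc, hs, h0, hmono, hsup⟩ := hf.exists_monotone_seq
  obtain ⟨k, kc, ks, k0, kmono, ksup⟩ := hg.exists_monotone_seq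
  choose M hM using fun n => (hs n).exists_bound_of_continuous (hc n)
  choose N hN using fun n => (ks n).exists_bound_of_continuous (kc n)
  set H : ℕ → Eu d → ℝ≥0∞ := fun n =>
    triangleMaximal E (fun x => (h n x : ℂ)) (fun x => (k n x : ℂ)) with hH
  have hHm : ∀ n, Measurable (H n) := fun n => by
    have c1 : Continuous fun x => (h n x : ℂ) := Complex.continuous_ofReal.comp (hc n)
    have c2 : Continuous fun x => (k n x : ℂ) := Complex.continuous_ofReal.comp (kc n)
    exact measurable_maximalFunction (continuous_triangleAverage c1 c2 (M := M n) (N := N n)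
      (fun x => by rw [Complex.norm_real]; exact hM n x)
      (fun x => by rw [Complex.norm_real]; exact hN n x))
  have hHpos : ∀ n x, H n x = ⨆ t ∈ E, posAverage d (fun x => ENNReal.ofReal (h n x))
      (fun x => ENNReal.ofReal (k n x)) t x := fun n x => by
    refine iSup_congr fun t => iSup_congr fun _ => ?_
    rw [posAverage_ofReal (hc n) (kc n) (h0 n) (k0 n) (hM n) (hN n)]
  have hmh : ∀ x, Monotone fun n => ENNReal.ofReal (h n x) := fun x m n hmn =>
    ENNReal.ofReal_le_ofReal (hmono hmn x)
  have hmk : ∀ x, Monotone fun n => ENNReal.ofReal (k n x) := fun x m n hmn =>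
    ENNReal.ofReal_le_ofReal (kmono hmn x)
  have hpos : ∀ t x, posAverage d f g t x = ⨆ n, posAverage d (fun x => ENNReal.ofReal (h n x))
      (fun x => ENNReal.ofReal (k n x)) t x := fun t x => by
    simp only [posAverage]
    rw [← lintegral_iSup]
    · refine lintegral_congr fun p => ?_
      rw [← hsup, ← ksup, iSup_mul_iSup_of_monotone (hmh _) (hmk _)]
    · intro n
      have c1 := hc n
      have c2 := kc n
      exact (c1.measurable.ennreal_ofReal.comp (Continuous.measurable (by fun_prop))).mul
        (c2.measurable.ennreal_ofReal.comp (Continuous.measurable (by fun_prop)))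
    · intro m n hmn p
      exact mul_le_mul' (hmh _ hmn) (hmk _ hmn)
  have hHmono : Monotone H := fun m n hmn x => by
    rw [hHpos, hHpos]
    refine iSup₂_mono fun t _ => lintegral_mono fun p => mul_le_mul' (hmh _ hmn) (hmk _ hmn)
  -- Monotone convergence has turned each average into a supremum over n. Exchanging the suprema
  -- writes the maximal function as a countable supremum, which yields measurability and a second
  -- use of monotone convergence.
  have hsupH : ∀ x, ⨆ t ∈ E, posAverage d f g t x = ⨆ n, H n x := fun x => by
    simp only [hHpos, hpos]
    rw [iSup_comm]
    refine iSup_congr fun n => ?_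
    rw [iSup_comm]
  refine ⟨by simp only [hsupH]; exact Measurable.iSup hHm, ?_⟩
  calc ∫⁻ x, (⨆ t ∈ E, posAverage d f g t x) ^ 2 ≤ ∫⁻ x, ⨆ n, H n x ^ 2 := by
        refine lintegral_mono fun x => ?_
        rw [hsupH]
        exact iSup_sq_le fun n => le_iSup (fun n => H n x ^ 2) n
    _ = ⨆ n, ∫⁻ x, H n x ^ 2 := lintegral_iSup (fun n => (hHm n).pow_const 2)
        fun m n hmn x => pow_le_pow_left' (hHmono hmn x) 2
    _ ≤ _ := by
        refine iSup_le fun n => (lintegral_maximal_sq_le_of_hasCompactSupport hC (hc n) (kc n)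
          (hs n) (ks n) (h0 n) (k0 n)).trans ?_
        gcongr with x x
        · rw [← hsup]; exact le_iSup (fun n => ENNReal.ofReal (h n x)) n
        · rw [← ksup]; exact le_iSup (fun n => ENNReal.ofReal (k n x)) n

/-- A lower semicontinuous majorant with almost the same `L²` norm. -/
lemma exists_lowerSemicontinuous_majorant {f : Eu d → ℂ} (hf : AEStronglyMeasurable f volume)
    {ε : ℝ≥0∞} (hε : ε ≠ 0) :
    ∃ g : Eu d → ℝ≥0∞, LowerSemicontinuous g ∧ (∀ x, ‖f x‖ₑ ≤ g x) ∧
      ∫⁻ x, g x ^ 2 ≤ (∫⁻ x, ‖f x‖ₑ ^ 2) + ε := by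
  -- The Vitali–Carathéodory theorem is applied to |f|²; the square root preserves lower
  -- semicontinuity.
  obtain ⟨g, hfg, hg, hgi⟩ := exists_lt_lowerSemicontinuous_lintegral_ge_of_aemeasurable
    (volume : Measure (Eu d)) (fun x => ‖f x‖₊ ^ 2) (hf.nnnorm.aemeasurable.pow_const 2) hε
  have hpow : ∀ z : ℝ≥0∞, (z ^ 2) ^ (1 / 2 : ℝ) = z := fun z => by
    rw [← ENNReal.rpow_natCast, ← ENNReal.rpow_mul]; norm_num
  refine ⟨fun x => g x ^ (1 / 2 : ℝ), ?_, fun x => ?_, ?_⟩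
  · exact Continuous.comp_lowerSemicontinuous ENNReal.continuous_rpow_const hg
      (ENNReal.monotone_rpow_of_nonneg (by norm_num))
  · rw [← hpow ‖f x‖ₑ]
    refine ENNReal.rpow_le_rpow ?_ (by norm_num)
    have := (hfg x).le
    rwa [ENNReal.coe_pow] at this
  · have e : ∀ z : ℝ≥0∞, (z ^ (1 / 2 : ℝ)) ^ 2 = z := fun z => by
      rw [← ENNReal.rpow_natCast, ← ENNReal.rpow_mul]; norm_num
    simp only [e]
    refine hgi.trans_eq ?_
    simp only [ENNReal.coe_pow]
    rfl

/-- A measurable majorant for the maximal function of absolute values. -/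
lemma exists_majorant
    (hC : ∀ φ ψ : 𝓢(Eu d, ℂ), ∫⁻ x, triangleMaximal E φ ψ x ^ 2 ≤
      C * negSobolevSq 0 (𝓕 φ : 𝓢(Eu d, ℂ)) * negSobolevSq 0 (𝓕 ψ : 𝓢(Eu d, ℂ)))
    {f g : Eu d → ℂ} (hf : AEStronglyMeasurable f volume) (hg : AEStronglyMeasurable g volume)
    {ε : ℝ≥0∞} (hε : ε ≠ 0) :
    ∃ H : Eu d → ℝ≥0∞, Measurable H ∧
      (∀ t ∈ E, ∀ x, posAverage d (fun x => ‖f x‖ₑ) (fun x => ‖g x‖ₑ) t x ≤ H x) ∧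
      ∫⁻ x, H x ^ 2 ≤ C * ((∫⁻ x, ‖f x‖ₑ ^ 2) + ε) * ((∫⁻ x, ‖g x‖ₑ ^ 2) + ε) := by
  obtain ⟨f', hf', hff', hfi⟩ := exists_lowerSemicontinuous_majorant hf hε
  obtain ⟨g', hg', hgg', hgi⟩ := exists_lowerSemicontinuous_majorant hg hε
  obtain ⟨hm, hi⟩ := lintegral_iSup_posAverage_sq_le hC hf' hg'
  refine ⟨_, hm, fun t ht x => ?_, hi.trans (by gcongr)⟩
  refine le_iSup₂_of_le t ht (lintegral_mono fun p => ?_)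
  exact mul_le_mul' (hff' _) (hgg' _)

end Majorant

/-! ### Sobolev norms of tempered distributions -/

section SobolevNorm

variable {d : ℕ} {σ : ℝ}

/-- The weight `(1 + |ξ|²)^{σ/2}`. -/
noncomputable def sobolevWeight (d : ℕ) (σ : ℝ) (ξ : Eu d) : ℂ :=
  (((1 + ‖ξ‖ ^ 2) ^ (σ / 2) : ℝ) : ℂ)

lemma hasTemperateGrowth_sobolevWeight (d : ℕ) (σ : ℝ) : (sobolevWeight d σ).HasTemperateGrowth := by
  unfold sobolevWeight
  fun_prop

/-- `h` represents `(1 + |ξ|²)^{σ/2} û`. -/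
def SobolevRep (σ : ℝ) (u : 𝓢'(Eu d, ℂ)) (h : Lp ℂ 2 (volume : Measure (Eu d))) : Prop :=
  TemperedDistribution.smulLeftCLM ℂ (sobolevWeight d σ) (𝓕 u) = (h : 𝓢'(Eu d, ℂ))

/-- The embedding of L² into tempered distributions is injective, so the infimum defining
`sobolevENorm` runs over at most one element. -/
lemma SobolevRep.unique {u : 𝓢'(Eu d, ℂ)} {h k : Lp ℂ 2 (volume : Measure (Eu d))}
    (hh : SobolevRep σ u h) (hk : SobolevRep σ u k) : h = k := by
  have h1 := LinearMap.ker_eq_bot.mp (Lp.ker_toTemperedDistributionCLM_eq_bot (F := ℂ)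
    (μ := (volume : Measure (Eu d))) (p := 2))
  exact h1 (hh.symm.trans hk)

lemma SobolevRep.enorm_eq {u : 𝓢'(Eu d, ℂ)} {h : Lp ℂ 2 (volume : Measure (Eu d))}
    (hh : SobolevRep σ u h) : sobolevENorm σ u = ‖h‖ₑ := by
  refine le_antisymm (iInf₂_le h hh) (le_iInf₂ fun k hk => ?_)
  rw [hh.unique hk]

lemma exists_sobolevRep {u : 𝓢'(Eu d, ℂ)} (hu : sobolevENorm σ u < ∞) : ∃ h, SobolevRep σ u h := by
  by_contra! h
  have : sobolevENorm σ u = ∞ := by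
    refine iInf₂_eq_top.mpr fun k hk => absurd hk (h k)
  exact hu.ne this

lemma SobolevRep.sub {u v : 𝓢'(Eu d, ℂ)} {h k : Lp ℂ 2 (volume : Measure (Eu d))}
    (hh : SobolevRep σ u h) (hk : SobolevRep σ v k) : SobolevRep σ (u - v) (h - k) := by
  have h1 : 𝓕 (u - v) = 𝓕 u - 𝓕 v := (FourierTransform.fourierCLM ℂ 𝓢'(Eu d, ℂ)).map_sub u v
  have h2 : ((h - k : Lp ℂ 2 (volume : Measure (Eu d))) : 𝓢'(Eu d, ℂ)) = h - k :=
    (Lp.toTemperedDistributionCLM ℂ (volume : Measure (Eu d)) 2).map_sub h k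
  rw [SobolevRep, h1, map_sub, hh, hk, h2]

lemma sobolevENorm_sub_le (u v w : 𝓢'(Eu d, ℂ)) :
    sobolevENorm σ (u - v) ≤ sobolevENorm σ (u - w) + sobolevENorm σ (v - w) := by
  by_cases h1 : sobolevENorm σ (u - w) < ∞
  · by_cases h2 : sobolevENorm σ (v - w) < ∞
    · obtain ⟨h, hh⟩ := exists_sobolevRep h1
      obtain ⟨k, hk⟩ := exists_sobolevRep h2
      have h3 := hh.sub hk
      rw [sub_sub_sub_cancel_right] at h3
      rw [h3.enorm_eq, hh.enorm_eq, hk.enorm_eq]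
      exact enorm_sub_le
    · rw [not_lt, top_le_iff] at h2
      rw [h2, add_top]; exact le_top
  · rw [not_lt, top_le_iff] at h1
    rw [h1, top_add]; exact le_top

lemma sobolevENorm_zero : sobolevENorm σ (0 : 𝓢'(Eu d, ℂ)) = 0 := by
  have h : SobolevRep σ (0 : 𝓢'(Eu d, ℂ)) (0 : Lp ℂ 2 (volume : Measure (Eu d))) := by
    have h1 : 𝓕 (0 : 𝓢'(Eu d, ℂ)) = 0 := (FourierTransform.fourierCLM ℂ 𝓢'(Eu d, ℂ)).map_zero
    have h2 : ((0 : Lp ℂ 2 (volume : Measure (Eu d))) : 𝓢'(Eu d, ℂ)) = 0 :=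
      (Lp.toTemperedDistributionCLM ℂ (volume : Measure (Eu d)) 2).map_zero
    rw [SobolevRep, h1, map_zero, h2]
  rw [h.enorm_eq, enorm_zero]

lemma sobolevENorm_neg (u : 𝓢'(Eu d, ℂ)) : sobolevENorm σ (-u) ≤ sobolevENorm σ u := by
  have h := sobolevENorm_sub_le (σ := σ) 0 u 0
  simpa [sobolevENorm_zero] using h

lemma sobolevENorm_le_add (u v : 𝓢'(Eu d, ℂ)) :
    sobolevENorm σ u ≤ sobolevENorm σ v + sobolevENorm σ (u - v) := by
  have h := sobolevENorm_sub_le (σ := σ) u 0 v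
  rw [sub_zero, zero_sub, add_comm] at h
  exact h.trans (by gcongr; exact sobolevENorm_neg v)

lemma smulLeftCLM_schwartz {g : Eu d → ℂ} (hg : g.HasTemperateGrowth) (a : 𝓢(Eu d, ℂ)) :
    TemperedDistribution.smulLeftCLM ℂ g (a : 𝓢'(Eu d, ℂ)) =
      (SchwartzMap.smulLeftCLM ℂ g a : 𝓢(Eu d, ℂ)) := by
  ext φ
  simp only [TemperedDistribution.smulLeftCLM_apply_apply,
    SchwartzMap.toTemperedDistributionCLM_apply_apply, SchwartzMap.smulLeftCLM_apply_apply hg,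
    smul_eq_mul]
  refine integral_congr_ae (Eventually.of_forall fun x => ?_)
  simp only
  ring

lemma sobolevRep_schwartz (σ : ℝ) (φ : 𝓢(Eu d, ℂ)) :
    SobolevRep σ (φ : 𝓢'(Eu d, ℂ))
      ((SchwartzMap.smulLeftCLM ℂ (sobolevWeight d σ) (𝓕 φ : 𝓢(Eu d, ℂ))).toLp 2 volume) := by
  rw [SobolevRep, TemperedDistribution.fourier_toTemperedDistributionCLM_eq,
    smulLeftCLM_schwartz (hasTemperateGrowth_sobolevWeight d σ),
    Lp.toTemperedDistribution_toLp_eq]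

lemma negSobolevSq_eq (s : ℝ) (φ : 𝓢(Eu d, ℂ)) :
    negSobolevSq s (𝓕 φ : 𝓢(Eu d, ℂ)) = sobolevENorm (-s) (φ : 𝓢'(Eu d, ℂ)) ^ 2 := by
  rw [(sobolevRep_schwartz (-s) φ).enorm_eq, Lp.enorm_def,
    eLpNorm_congr_ae (SchwartzMap.coeFn_toLp _ 2 volume),
    eLpNorm_eq_lintegral_rpow_enorm_toReal (by norm_num) (by norm_num), ← ENNReal.rpow_natCast,
    ← ENNReal.rpow_mul]
  norm_num
  refine lintegral_congr fun ξ => ?_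
  rw [SchwartzMap.smulLeftCLM_apply_apply (hasTemperateGrowth_sobolevWeight d (-s)), enorm_smul,
    mul_pow, sobolevWeight]
  congr 1
  have e : ((1 + ‖ξ‖ ^ 2) ^ (-s / 2) : ℝ) ^ 2 = (1 + ‖ξ‖ ^ 2) ^ (-s) := by
    rw [← Real.rpow_mul_natCast (by positivity)]
    congr 1
    push_cast; ring
  rw [← ofReal_norm, Complex.norm_real, Real.norm_of_nonneg (by positivity),
    ← ENNReal.ofReal_pow (by positivity), e]

lemma exists_schwartz_toLp_sub_lt (h : Lp ℂ 2 (volume : Measure (Eu d))) {ε : ℝ≥0∞} (hε : ε ≠ 0) :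
    ∃ χ : 𝓢(Eu d, ℂ), ‖χ.toLp 2 volume - h‖ₑ < ε := by
  have hd := SchwartzMap.denseRange_toLpCLM (E := Eu d) (F := ℂ) (p := 2) (μ := volume)
    ENNReal.ofNat_ne_top
  obtain ⟨y, hy⟩ := hd.exists_mem_open (Metric.isOpen_eball (x := h) (ε := ε))
    ⟨h, Metric.mem_eball_self (pos_iff_ne_zero.mpr hε)⟩
  refine ⟨y, ?_⟩
  rw [Metric.mem_eball, edist_eq_enorm_sub] at hy
  exact hy

/-- Schwartz functions are dense in `H^σ`. -/
lemma exists_schwartz_tendsto {u : 𝓢'(Eu d, ℂ)} (hu : sobolevENorm σ u < ∞) {ε : ℝ≥0∞} (hε : ε ≠ 0) :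
    ∃ φ : 𝓢(Eu d, ℂ), sobolevENorm σ ((φ : 𝓢'(Eu d, ℂ)) - u) < ε := by
  obtain ⟨h, hh⟩ := exists_sobolevRep hu
  obtain ⟨χ, hχ⟩ := exists_schwartz_toLp_sub_lt h hε
  -- The L² representative of u is approximated by a Schwartz function χ. Multiplying χ by the
  -- inverse weight, which has temperate growth, and transforming back gives a Schwartz function
  -- represented exactly by χ.
  set w := SchwartzMap.smulLeftCLM ℂ (sobolevWeight d (-σ)) χ with hw
  refine ⟨𝓕⁻ w, ?_⟩
  have h1 := sobolevRep_schwartz σ (𝓕⁻ w)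
  have h2 : 𝓕 (𝓕⁻ w) = w := FourierTransform.fourier_fourierInv_eq w
  have h3 : SchwartzMap.smulLeftCLM ℂ (sobolevWeight d σ) w = χ := by
    ext ξ
    rw [hw, SchwartzMap.smulLeftCLM_apply_apply (hasTemperateGrowth_sobolevWeight d _),
      SchwartzMap.smulLeftCLM_apply_apply (hasTemperateGrowth_sobolevWeight d _), smul_smul,
      sobolevWeight, sobolevWeight, ← Complex.ofReal_mul, ← Real.rpow_add (by positivity)]
    simp [neg_div]
  rw [h2, h3] at h1
  rw [(h1.sub hh).enorm_eq]
  exact hχ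

/-- Square-integrable functions belong to `H^{-s}` for `s ≥ 0`. -/
lemma sobolevENorm_neg_toLp_le {s : ℝ} (hs : 0 ≤ s) (f : Lp ℂ 2 (volume : Measure (Eu d))) :
    sobolevENorm (-s) (f : 𝓢'(Eu d, ℂ)) ≤ ‖f‖ₑ := by
  have hw1 : ∀ ξ, ‖sobolevWeight d (-s) ξ‖ ≤ 1 := fun ξ => by
    rw [sobolevWeight, Complex.norm_real, Real.norm_of_nonneg (by positivity)]
    exact Real.rpow_le_one_of_one_le_of_nonpos (by nlinarith [sq_nonneg ‖ξ‖]) (by linarith)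
  have hm : MemLp (sobolevWeight d (-s)) ∞ volume :=
    memLp_top_of_bound (hasTemperateGrowth_sobolevWeight d (-s)).1.continuous.aestronglyMeasurable 1
      (Eventually.of_forall hw1)
  have hrep : SobolevRep (-s) (f : 𝓢'(Eu d, ℂ)) ((hm.toLp _) • (𝓕 f : Lp ℂ 2 volume)) := by
    rw [SobolevRep, Lp.fourier_toTemperedDistribution_eq]
    exact (Lp.toTemperedDistribution_smul_eq (hasTemperateGrowth_sobolevWeight d (-s)) hm _).symm
  rw [hrep.enorm_eq]
  have h1 : ‖(𝓕 f : Lp ℂ 2 (volume : Measure (Eu d)))‖ₑ = ‖f‖ₑ := by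
    rw [← ofReal_norm, Lp.norm_fourier_eq, ofReal_norm]
  rw [← h1, Lp.enorm_def, Lp.enorm_def]
  refine eLpNorm_mono_ae ?_
  filter_upwards [Lp.coeFn_lpSMul (r := 2) (hm.toLp _) (𝓕 f : Lp ℂ 2 (volume : Measure (Eu d))),
    hm.coeFn_toLp] with ξ h2 h3
  rw [h2, Pi.smul_apply', h3, norm_smul]
  exact mul_le_of_le_one_left (norm_nonneg _) (hw1 ξ)

end SobolevNorm

/-! ### Limits in the norm of the maximal function -/

section MaximalFunction

variable {d : ℕ} {E : Set ℝ}

lemma eLpNorm_two_sq {α : Type*} [MeasurableSpace α] {μ : Measure α} (h : α → ℝ≥0∞) :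
    eLpNorm h 2 μ ^ 2 = ∫⁻ x, h x ^ 2 ∂μ := by
  rw [eLpNorm_eq_lintegral_rpow_enorm_toReal (by norm_num) (by norm_num), ← ENNReal.rpow_natCast,
    ← ENNReal.rpow_mul]
  norm_num

lemma eLpNorm_two_le_of_sq_le {α : Type*} [MeasurableSpace α] {μ : Measure α} {h : α → ℝ≥0∞}
    {b : ℝ≥0∞} (hb : ∫⁻ x, h x ^ 2 ∂μ ≤ b ^ 2) : eLpNorm h 2 μ ≤ b := by
  rw [← eLpNorm_two_sq] at hb
  exact (ENNReal.pow_le_pow_left_iff two_ne_zero).mp hb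

/-- Minkowski's inequality for the partial sums, followed by monotone convergence. -/
lemma eLpNorm_two_tsum_le {α : Type*} [MeasurableSpace α] {μ : Measure α} {D : ℕ → α → ℝ≥0∞}
    (hD : ∀ n, Measurable (D n)) :
    eLpNorm (fun x => ∑' n, D n x) 2 μ ≤ ∑' n, eLpNorm (D n) 2 μ := by
  refine eLpNorm_two_le_of_sq_le ?_
  calc ∫⁻ x, (∑' n, D n x) ^ 2 ∂μ ≤ ∫⁻ x, ⨆ N, (∑ n ∈ Finset.range N, D n x) ^ 2 ∂μ := by
        refine lintegral_mono fun x => ?_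
        rw [ENNReal.tsum_eq_iSup_nat]
        exact iSup_sq_le fun N => le_iSup (fun N => (∑ n ∈ Finset.range N, D n x) ^ 2) N
    _ = ⨆ N, ∫⁻ x, (∑ n ∈ Finset.range N, D n x) ^ 2 ∂μ := by
        refine lintegral_iSup
          (fun N => (Finset.measurable_fun_sum _ fun n _ => hD n).pow_const 2) ?_
        intro m n hmn x
        exact pow_le_pow_left' (Finset.sum_le_sum_of_subset (Finset.range_mono hmn)) 2
    _ ≤ _ := by
        refine iSup_le fun N => ?_
        rw [← eLpNorm_two_sq]
        gcongr
        have h := eLpNorm_sum_le (p := 2) (μ := μ) (f := D) (s := Finset.range N)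
          (fun n _ => (hD n).aestronglyMeasurable) (by norm_num)
        have e : (fun x => ∑ n ∈ Finset.range N, D n x) = ∑ n ∈ Finset.range N, D n := by
          ext x; simp
        rw [e]
        exact h.trans (ENNReal.sum_le_tsum _)

lemma maximalFunction_sub_le (F G H : ℝ → Eu d → ℂ) (x : Eu d) :
    maximalFunction E (F - H) x ≤ maximalFunction E (F - G) x + maximalFunction E (G - H) x := by
  refine iSup₂_le fun t ht => ?_
  have e : (F - H) t x = (F - G) t x + (G - H) t x := by simp
  rw [e]
  refine (enorm_add_le _ _).trans (add_le_add ?_ ?_)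
  · exact le_iSup₂ (f := fun t (_ : t ∈ E) => ‖(F - G) t x‖ₑ) t ht
  · exact le_iSup₂ (f := fun t (_ : t ∈ E) => ‖(G - H) t x‖ₑ) t ht

lemma maximalFunction_sub_comm (F G : ℝ → Eu d → ℂ) (x : Eu d) :
    maximalFunction E (F - G) x = maximalFunction E (G - F) x := by
  refine iSup_congr fun t => iSup_congr fun _ => ?_
  have e : (F - G) t x = -((G - F) t x) := by simp
  rw [e, enorm_neg]

/-- Measurability of a maximal function passes to limits. -/
lemma aemeasurable_maximalFunction_of_tendsto {F G : ℝ → Eu d → ℂ} {T : ℕ → ℝ → Eu d → ℂ}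
    (hm : ∀ k, Measurable (maximalFunction E (G - T k)))
    (hT : ∀ᵐ x, Tendsto (fun k => maximalFunction E (T k - F) x) atTop (𝓝 0)) :
    AEMeasurable (maximalFunction E (G - F)) volume := by
  refine aemeasurable_of_tendsto_metrizable_ae atTop (fun k => (hm k).aemeasurable) ?_
  filter_upwards [hT] with x hx
  have h1 : Tendsto (fun k => maximalFunction E (G - F) x - maximalFunction E (T k - F) x) atTop
      (𝓝 (maximalFunction E (G - F) x)) := by
    have := ENNReal.Tendsto.sub (tendsto_const_nhds (x := maximalFunction E (G - F) x)) hx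
      (Or.inr ENNReal.zero_ne_top)
    rwa [tsub_zero] at this
  have h2 : Tendsto (fun k => maximalFunction E (G - F) x + maximalFunction E (T k - F) x) atTop
      (𝓝 (maximalFunction E (G - F) x)) := by
    have := (tendsto_const_nhds (x := maximalFunction E (G - F) x) (f := atTop)).add hx
    rwa [add_zero] at this
  refine tendsto_of_tendsto_of_tendsto_of_le_of_le h1 h2 (fun k => ?_) fun k => ?_
  · exact tsub_le_iff_right.mpr (maximalFunction_sub_le G (T k) F x)
  · refine (maximalFunction_sub_le G F (T k) x).trans ?_
    rw [maximalFunction_sub_comm F (T k)]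

/-- The telescoping limit of a sequence of families of functions. -/
lemma exists_maximal_limit {T : ℕ → ℝ → Eu d → ℂ}
    (hm : ∀ n, Measurable (maximalFunction E (T (n + 1) - T n)))
    (hs : ∑' n, eLpNorm (maximalFunction E (T (n + 1) - T n)) 2 volume ≠ ∞) :
    ∃ F : ℝ → Eu d → ℂ, (∀ᵐ x, Tendsto (fun k => maximalFunction E (T k - F) x) atTop (𝓝 0)) ∧
      Tendsto (fun k => eLpNorm (maximalFunction E (T k - F)) 2 volume) atTop (𝓝 0) := by
  set D : ℕ → Eu d → ℝ≥0∞ := fun n => maximalFunction E (T (n + 1) - T n) with hD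
  -- Where ∑ D n x is finite, the series converges for all t ∈ E at once and its tails are bounded
  -- by those of D. Elsewhere the bound is ∞, so the default value of a divergent `tsum` is
  -- harmless.
  set F : ℝ → Eu d → ℂ := fun t x => T 0 t x + ∑' n, (T (n + 1) t x - T n t x) with hF
  have hle : ∀ k x, maximalFunction E (T k - F) x ≤ ∑' n, D (n + k) x := fun k x => by
    by_cases htop : ∑' n, D (n + k) x = ∞
    · rw [htop]; exact le_top
    refine iSup₂_le fun t ht => ?_
    have hDt : ∀ n, ‖T (n + k + 1) t x - T (n + k) t x‖ₑ ≤ D (n + k) x := fun n =>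
      le_iSup₂ (f := fun t (_ : t ∈ E) => ‖(T (n + k + 1) - T (n + k)) t x‖ₑ) t ht
    have hsum' : Summable fun n => T (n + k + 1) t x - T (n + k) t x :=
      Summable.of_enorm (ne_top_of_le_ne_top htop (ENNReal.tsum_le_tsum hDt))
    have hsum : Summable fun n => T (n + 1) t x - T n t x :=
      (summable_nat_add_iff (f := fun n => T (n + 1) t x - T n t x) k).mp hsum'
    have e : (T k - F) t x = -∑' n, (T (n + k + 1) t x - T (n + k) t x) := by
      have h1 := hsum.sum_add_tsum_nat_add k
      rw [Finset.sum_range_sub (fun n => T n t x)] at h1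
      simp only [Pi.sub_apply, hF]
      rw [← h1]
      ring
    rw [e, enorm_neg]
    exact enorm_tsum_le_tsum_enorm.trans (ENNReal.tsum_le_tsum hDt)
  have hfin : ∀ᵐ x, ∑' n, D n x < ∞ := by
    have h1 : ∫⁻ x, (∑' n, D n x) ^ 2 ≠ ∞ := by
      rw [← eLpNorm_two_sq]
      exact ENNReal.pow_ne_top (ne_top_of_le_ne_top hs (eLpNorm_two_tsum_le hm))
    filter_upwards [ae_lt_top ((Measurable.tsum hm).pow_const 2) h1] with x (hx : (∑' n, D n x) ^ 2 < ∞)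
    by_contra h
    rw [not_lt, top_le_iff] at h
    exact hx.ne (by rw [h, ENNReal.top_pow two_ne_zero])
  refine ⟨F, ?_, ?_⟩
  · filter_upwards [hfin] with x hx
    exact tendsto_of_tendsto_of_tendsto_of_le_of_le tendsto_const_nhds
      (ENNReal.tendsto_sum_nat_add (fun n => D n x) hx.ne) (fun _ => zero_le) fun k => hle k x
  · refine tendsto_of_tendsto_of_tendsto_of_le_of_le tendsto_const_nhds
      (ENNReal.tendsto_sum_nat_add (fun n => eLpNorm (D n) 2 volume) hs) (fun _ => zero_le)
      fun k => ?_
    exact (eLpNorm_mono_enorm fun x => hle k x).trans (eLpNorm_two_tsum_le fun n => hm _)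

end MaximalFunction

/-! ### Extension by continuity to negative Sobolev spaces -/

section Extension

variable {d : ℕ} {E : Set ℝ} {C : NNReal} {s₁ s₂ : ℝ}

lemma SchwartzMap.exists_norm_le (φ : 𝓢(Eu d, ℂ)) : ∃ M : ℝ, ∀ x, ‖φ x‖ ≤ M :=
  ⟨_, SchwartzMap.norm_le_seminorm ℂ φ⟩

lemma continuous_triangleAverage_schwartz (φ ψ : 𝓢(Eu d, ℂ)) (t : ℝ) :
    Continuous (triangleAverage φ ψ t) := by
  obtain ⟨M, hM⟩ := φ.exists_norm_le
  obtain ⟨N, hN⟩ := ψ.exists_norm_le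
  exact continuous_triangleAverage φ.continuous ψ.continuous hM hN t

lemma triangleAverage_sub_schwartz (φ ψ φ' ψ' : 𝓢(Eu d, ℂ)) (t : ℝ) (x : Eu d) :
    triangleAverage φ' ψ' t x - triangleAverage φ ψ t x =
      triangleAverage (φ' - φ : 𝓢(Eu d, ℂ)) ψ' t x +
        triangleAverage φ (ψ' - ψ : 𝓢(Eu d, ℂ)) t x := by
  have := (isTriangleInvariant_pairMeasure d).finite
  have hi : ∀ f g : 𝓢(Eu d, ℂ), Integrable (fun p : Eu d × Eu d =>
      f (x - t • p.1) * g (x - t • p.2)) (pairMeasure d) := fun f g => by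
    obtain ⟨M, hM⟩ := f.exists_norm_le
    obtain ⟨N, hN⟩ := g.exists_norm_le
    have hf := f.continuous
    have hg := g.continuous
    refine (integrable_const (M * N)).mono' (Continuous.aestronglyMeasurable (by fun_prop))
      (Eventually.of_forall fun p => ?_)
    rw [norm_mul]
    exact mul_le_mul (hM _) (hN _) (norm_nonneg _) ((norm_nonneg _).trans (hM 0))
  simp only [triangleAverage_eq]
  rw [← integral_sub (hi _ _) (hi _ _), ← integral_add (hi _ _) (hi _ _)]
  refine integral_congr_ae (Eventually.of_forall fun p => ?_)
  simp only [sub_apply]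
  ring

/-- Bilinearity: T(φ', ψ') - T(φ, ψ) = T(φ' - φ, ψ') + T(φ, ψ' - ψ), and the maximal estimate is
applied to each term. -/
lemma eLpNorm_triangleMaximal_sub_le
    (hC : ∀ φ ψ : 𝓢(Eu d, ℂ), eLpNorm (triangleMaximal E φ ψ) 2 volume ≤
      C * sobolevENorm (-s₁) (φ : 𝓢'(Eu d, ℂ)) * sobolevENorm (-s₂) (ψ : 𝓢'(Eu d, ℂ)))
    (φ ψ φ' ψ' : 𝓢(Eu d, ℂ)) :
    eLpNorm (maximalFunction E (triangleAverage φ' ψ' - triangleAverage φ ψ)) 2 volume ≤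
      C * sobolevENorm (-s₁) ((φ' : 𝓢'(Eu d, ℂ)) - (φ : 𝓢'(Eu d, ℂ))) * sobolevENorm (-s₂) (ψ' : 𝓢'(Eu d, ℂ)) +
      C * sobolevENorm (-s₁) (φ : 𝓢'(Eu d, ℂ)) *
        sobolevENorm (-s₂) ((ψ' : 𝓢'(Eu d, ℂ)) - (ψ : 𝓢'(Eu d, ℂ))) := by
  have h1 := hC (φ' - φ) ψ'
  have h2 := hC φ (ψ' - ψ)
  have e : ∀ f g : 𝓢(Eu d, ℂ), ((f - g : 𝓢(Eu d, ℂ)) : 𝓢'(Eu d, ℂ)) = (f : 𝓢'(Eu d, ℂ)) - (g : 𝓢'(Eu d, ℂ)) :=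
    fun f g => map_sub (SchwartzMap.toTemperedDistributionCLM (Eu d) ℂ volume) f g
  rw [e] at h1 h2
  refine le_trans ?_ (add_le_add h1 h2)
  have hm : ∀ f g : 𝓢(Eu d, ℂ), Measurable (triangleMaximal E f g) := fun f g =>
    measurable_maximalFunction (continuous_triangleAverage_schwartz f g)
  refine le_trans (eLpNorm_mono_enorm (g := triangleMaximal E (φ' - φ : 𝓢(Eu d, ℂ)) ψ' +
    triangleMaximal E φ (ψ' - ψ : 𝓢(Eu d, ℂ))) fun x => ?_)
    (eLpNorm_add_le (hm _ _).aestronglyMeasurable (hm _ _).aestronglyMeasurable (by norm_num))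
  refine iSup₂_le fun t ht => ?_
  rw [Pi.sub_apply, Pi.sub_apply, triangleAverage_sub_schwartz]
  refine (enorm_add_le _ _).trans (add_le_add ?_ ?_)
  · exact le_iSup₂ (f := fun t (_ : t ∈ E) =>
      ‖triangleAverage (φ' - φ : 𝓢(Eu d, ℂ)) ψ' t x‖ₑ) t ht
  · exact le_iSup₂ (f := fun t (_ : t ∈ E) =>
      ‖triangleAverage φ (ψ' - ψ : 𝓢(Eu d, ℂ)) t x‖ₑ) t ht

/-- Convergence in the negative Sobolev norms makes the maximal functions of the differences
converge. -/
lemma tendsto_eLpNorm_triangleMaximal_sub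
    (hC : ∀ φ ψ : 𝓢(Eu d, ℂ), eLpNorm (triangleMaximal E φ ψ) 2 volume ≤
      C * sobolevENorm (-s₁) (φ : 𝓢'(Eu d, ℂ)) * sobolevENorm (-s₂) (ψ : 𝓢'(Eu d, ℂ)))
    {u v : 𝓢'(Eu d, ℂ)} (hu : sobolevENorm (-s₁) u < ∞) (hv : sobolevENorm (-s₂) v < ∞)
    {φ ψ φ' ψ' : ℕ → 𝓢(Eu d, ℂ)}
    (hφ : Tendsto (fun n => sobolevENorm (-s₁) ((φ n : 𝓢'(Eu d, ℂ)) - u)) atTop (𝓝 0))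
    (hψ : Tendsto (fun n => sobolevENorm (-s₂) ((ψ n : 𝓢'(Eu d, ℂ)) - v)) atTop (𝓝 0))
    (hφ' : Tendsto (fun n => sobolevENorm (-s₁) ((φ' n : 𝓢'(Eu d, ℂ)) - u)) atTop (𝓝 0))
    (hψ' : Tendsto (fun n => sobolevENorm (-s₂) ((ψ' n : 𝓢'(Eu d, ℂ)) - v)) atTop (𝓝 0)) :
    Tendsto (fun n => eLpNorm (maximalFunction E
      (triangleAverage (φ' n) (ψ' n) - triangleAverage (φ n) (ψ n))) 2 volume) atTop (𝓝 0) := by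
  have hlim : Tendsto (fun n =>
      C * (sobolevENorm (-s₁) ((φ' n : 𝓢'(Eu d, ℂ)) - u) +
        sobolevENorm (-s₁) ((φ n : 𝓢'(Eu d, ℂ)) - u)) *
        (sobolevENorm (-s₂) v + sobolevENorm (-s₂) ((ψ' n : 𝓢'(Eu d, ℂ)) - v)) +
      C * (sobolevENorm (-s₁) u + sobolevENorm (-s₁) ((φ n : 𝓢'(Eu d, ℂ)) - u)) *
        (sobolevENorm (-s₂) ((ψ' n : 𝓢'(Eu d, ℂ)) - v) +
          sobolevENorm (-s₂) ((ψ n : 𝓢'(Eu d, ℂ)) - v))) atTop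
      (𝓝 (C * (0 + 0) * (sobolevENorm (-s₂) v + 0) + C * (sobolevENorm (-s₁) u + 0) * (0 + 0))) := by
    refine Tendsto.add (ENNReal.Tendsto.mul (ENNReal.Tendsto.const_mul (hφ'.add hφ) ?_) ?_
      (tendsto_const_nhds.add hψ') ?_) (ENNReal.Tendsto.mul (ENNReal.Tendsto.const_mul
      (tendsto_const_nhds.add hφ) ?_) ?_ (hψ'.add hψ) ?_)
    all_goals right
    all_goals simp [ENNReal.mul_eq_top, hu.ne, hv.ne]
  simp only [add_zero, mul_zero, zero_mul] at hlim
  refine tendsto_of_tendsto_of_tendsto_of_le_of_le tendsto_const_nhds hlim (fun _ => zero_le)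
    fun n => (eLpNorm_triangleMaximal_sub_le hC _ _ _ _).trans ?_
  gcongr
  · exact sobolevENorm_sub_le _ _ _
  · exact sobolevENorm_le_add _ _
  · exact sobolevENorm_le_add _ _
  · exact sobolevENorm_sub_le _ _ _

/-- The extension by continuity of the triangle averages, with the maximal estimate. -/
lemma exists_extension
    (hC : ∀ φ ψ : 𝓢(Eu d, ℂ), eLpNorm (triangleMaximal E φ ψ) 2 volume ≤
      C * sobolevENorm (-s₁) (φ : 𝓢'(Eu d, ℂ)) * sobolevENorm (-s₂) (ψ : 𝓢'(Eu d, ℂ)))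
    {u v : 𝓢'(Eu d, ℂ)} (hu : sobolevENorm (-s₁) u < ∞) (hv : sobolevENorm (-s₂) v < ∞) :
    ∃ F : ℝ → Eu d → ℂ,
      (∀ φ ψ : ℕ → 𝓢(Eu d, ℂ),
        Tendsto (fun n => sobolevENorm (-s₁) ((φ n : 𝓢'(Eu d, ℂ)) - u)) atTop (𝓝 0) →
        Tendsto (fun n => sobolevENorm (-s₂) ((ψ n : 𝓢'(Eu d, ℂ)) - v)) atTop (𝓝 0) →
        (∀ n, AEMeasurable (maximalFunction E (triangleAverage (φ n) (ψ n) - F)) volume) ∧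
        Tendsto (fun n => eLpNorm
          (maximalFunction E (triangleAverage (φ n) (ψ n) - F)) 2 volume) atTop (𝓝 0)) ∧
      AEMeasurable (maximalFunction E F) volume ∧
      eLpNorm (maximalFunction E F) 2 volume ≤
        C * sobolevENorm (-s₁) u * sobolevENorm (-s₂) v := by
  have hε : ∀ n : ℕ, (2⁻¹ : ℝ≥0∞) ^ n ≠ 0 := fun n => by simp
  choose φ hφ using fun n => exists_schwartz_tendsto hu (hε n)
  choose ψ hψ using fun n => exists_schwartz_tendsto hv (hε n)
  have hε0 : Tendsto (fun n : ℕ => (2⁻¹ : ℝ≥0∞) ^ n) atTop (𝓝 0) :=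
    ENNReal.tendsto_pow_atTop_nhds_zero_of_lt_one (by norm_num)
  have hφ0 : Tendsto (fun n => sobolevENorm (-s₁) ((φ n : 𝓢'(Eu d, ℂ)) - u)) atTop (𝓝 0) :=
    tendsto_of_tendsto_of_tendsto_of_le_of_le tendsto_const_nhds hε0 (fun _ => zero_le)
      fun n => (hφ n).le
  have hψ0 : Tendsto (fun n => sobolevENorm (-s₂) ((ψ n : 𝓢'(Eu d, ℂ)) - v)) atTop (𝓝 0) :=
    tendsto_of_tendsto_of_tendsto_of_le_of_le tendsto_const_nhds hε0 (fun _ => zero_le)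
      fun n => (hψ n).le
  set T : ℕ → ℝ → Eu d → ℂ := fun n => triangleAverage (φ n) (ψ n) with hT
  have hm : ∀ {G : ℝ → Eu d → ℂ}, (∀ t, Continuous (G t)) → ∀ n,
      Measurable (maximalFunction E (G - T n)) := fun hG n =>
    measurable_maximalFunction fun t => (hG t).sub (continuous_triangleAverage_schwartz _ _ t)
  have hε1 : ∀ n : ℕ, (2⁻¹ : ℝ≥0∞) ^ n ≤ 1 := fun n => pow_le_one' (by norm_num) n
  have hε2 : ∀ n : ℕ, (2⁻¹ : ℝ≥0∞) ^ (n + 1) ≤ 2⁻¹ ^ n := fun n =>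
    pow_le_pow_right_of_le_one' (by norm_num) n.le_succ
  -- The approximations have errors below 2^{-n}, so consecutive averages differ by O(2^{-n}) in the
  -- norm of the maximal function.
  have hsum : ∑' n, eLpNorm (maximalFunction E (T (n + 1) - T n)) 2 volume ≠ ∞ := by
    set K : ℝ≥0∞ := C * (1 + 1) * (sobolevENorm (-s₂) v + 1) +
      C * (sobolevENorm (-s₁) u + 1) * (1 + 1) with hK
    have hKt : K ≠ ∞ := by simp [hK, ENNReal.mul_eq_top, hu.ne, hv.ne]
    have hb : ∀ n, eLpNorm (maximalFunction E (T (n + 1) - T n)) 2 volume ≤ K * 2⁻¹ ^ n := fun n => by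
      refine (eLpNorm_triangleMaximal_sub_le hC _ _ _ _).trans ?_
      calc _ ≤ C * (2⁻¹ ^ n + 2⁻¹ ^ n) * (sobolevENorm (-s₂) v + 1) +
            C * (sobolevENorm (-s₁) u + 1) * (2⁻¹ ^ n + 2⁻¹ ^ n) := by
            gcongr
            · exact (sobolevENorm_sub_le _ _ u).trans
                (add_le_add ((hφ (n + 1)).le.trans (hε2 n)) (hφ n).le)
            · exact (sobolevENorm_le_add _ v).trans (by gcongr; exact (hψ (n + 1)).le.trans (hε1 _))
            · exact (sobolevENorm_le_add _ u).trans (by gcongr; exact (hφ n).le.trans (hε1 _))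
            · exact (sobolevENorm_sub_le _ _ v).trans
                (add_le_add ((hψ (n + 1)).le.trans (hε2 n)) (hψ n).le)
        _ = _ := by rw [hK]; ring
    refine ne_top_of_le_ne_top ?_ (ENNReal.tsum_le_tsum hb)
    rw [ENNReal.tsum_mul_left, ENNReal.tsum_geometric]
    exact ENNReal.mul_ne_top hKt (by simp)
  obtain ⟨F, hFae, hFL⟩ := exists_maximal_limit (E := E) (T := T)
    (fun n => hm (continuous_triangleAverage_schwartz _ _) n) hsum
  have hmF : ∀ {G : ℝ → Eu d → ℂ}, (∀ t, Continuous (G t)) →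
      AEMeasurable (maximalFunction E (G - F)) volume := fun hG =>
    aemeasurable_maximalFunction_of_tendsto (hm hG) hFae
  -- The measurability result concerns G - F with continuous G; the choice G = 0 covers F itself.
  have hFneg : maximalFunction E F = maximalFunction E (0 - F) := by
    funext x
    refine iSup_congr fun t => iSup_congr fun _ => ?_
    simp
  refine ⟨F, fun φ' ψ' hφ' hψ' =>
    ⟨fun n => hmF (continuous_triangleAverage_schwartz _ _), ?_⟩, ?_, ?_⟩
  · have h1 := tendsto_eLpNorm_triangleMaximal_sub hC hu hv hφ0 hψ0 hφ' hψ'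
    have h2 := h1.add hFL
    rw [add_zero] at h2
    refine tendsto_of_tendsto_of_tendsto_of_le_of_le tendsto_const_nhds h2 (fun _ => zero_le)
      fun n => ?_
    refine le_trans (eLpNorm_mono_enorm (g := maximalFunction E
      (triangleAverage (φ' n) (ψ' n) - T n) + maximalFunction E (T n - F))
      fun x => maximalFunction_sub_le _ (T n) _ x) (eLpNorm_add_le ?_ ?_ (by norm_num))
    · exact (hm (continuous_triangleAverage_schwartz _ _) n).aestronglyMeasurable
    · exact (hmF (continuous_triangleAverage_schwartz _ _)).aestronglyMeasurable
  · rw [hFneg]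
    exact hmF fun t => continuous_const
  · have hlim : Tendsto (fun n =>
        C * (sobolevENorm (-s₁) u + sobolevENorm (-s₁) ((φ n : 𝓢'(Eu d, ℂ)) - u)) *
          (sobolevENorm (-s₂) v + sobolevENorm (-s₂) ((ψ n : 𝓢'(Eu d, ℂ)) - v)) +
        eLpNorm (maximalFunction E (T n - F)) 2 volume) atTop
        (𝓝 (C * (sobolevENorm (-s₁) u + 0) * (sobolevENorm (-s₂) v + 0) + 0)) := by
      refine Tendsto.add (ENNReal.Tendsto.mul (ENNReal.Tendsto.const_mul
        (tendsto_const_nhds.add hφ0) ?_) ?_ (tendsto_const_nhds.add hψ0) ?_) hFL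
      all_goals right
      all_goals simp [ENNReal.mul_eq_top, hu.ne, hv.ne]
    simp only [add_zero] at hlim
    refine ge_of_tendsto' hlim fun n => ?_
    have hTm : Measurable (maximalFunction E (T n)) :=
      measurable_maximalFunction (continuous_triangleAverage_schwartz _ _)
    refine le_trans (eLpNorm_mono_enorm (g := maximalFunction E (T n) + maximalFunction E (T n - F))
      fun x => ?_) ((eLpNorm_add_le hTm.aestronglyMeasurable
        (hmF (continuous_triangleAverage_schwartz _ _)).aestronglyMeasurable (by norm_num)).trans
        (add_le_add ((hC _ _).trans ?_) le_rfl))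
    · have h := maximalFunction_sub_le (E := E) 0 (T n) F x
      have e : maximalFunction E (0 - T n) x = maximalFunction E (T n) x :=
        iSup_congr fun t => iSup_congr fun _ => by simp
      rw [e] at h
      change maximalFunction E F x ≤ maximalFunction E (T n) x + maximalFunction E (T n - F) x
      rw [hFneg]
      exact h
    · gcongr
      · exact sobolevENorm_le_add _ _
      · exact sobolevENorm_le_add _ _

end Extension

/-! ### Square-integrable functions: the extension is given by integrals -/

section SquareIntegrable

variable {d : ℕ} {E : Set ℝ} {A : NNReal}

/-- Measurability of m is not required: m lies below the infimum of the K n, whose square has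
integral zero. -/
lemma ae_eq_zero_of_le_of_tendsto {α : Type*} [MeasurableSpace α] {μ : Measure α} {m : α → ℝ≥0∞}
    {K : ℕ → α → ℝ≥0∞} (hK : ∀ n, AEMeasurable (K n) μ) (hle : ∀ n, ∀ᵐ x ∂μ, m x ≤ K n x)
    (h : Tendsto (fun n => ∫⁻ x, K n x ^ 2 ∂μ) atTop (𝓝 0)) : ∀ᵐ x ∂μ, m x = 0 := by
  have h0 : ∫⁻ x, (⨅ n, K n x) ^ 2 ∂μ = 0 := by
    refine le_antisymm (ge_of_tendsto' h fun n => lintegral_mono fun x => ?_) zero_le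
    exact pow_le_pow_left' (iInf_le _ n) 2
  rw [lintegral_eq_zero_iff' ((AEMeasurable.iInf hK).pow_const 2)] at h0
  filter_upwards [h0, ae_all_iff.mpr hle] with x hx hx'
  have h1 : ⨅ n, K n x = 0 := by simpa using hx
  exact le_antisymm ((le_iInf hx').trans_eq h1) zero_le

/-- As the product of the norms vanishes, the majorants with ε = 2^{-n} tend to zero in L². -/
lemma ae_posAverage_eq_zero
    (hA : ∀ φ ψ : 𝓢(Eu d, ℂ), ∫⁻ x, triangleMaximal E φ ψ x ^ 2 ≤
      A * negSobolevSq 0 (𝓕 φ : 𝓢(Eu d, ℂ)) * negSobolevSq 0 (𝓕 ψ : 𝓢(Eu d, ℂ)))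
    {f g : Eu d → ℂ} (hf : AEStronglyMeasurable f volume) (hg : AEStronglyMeasurable g volume)
    (hf2 : ∫⁻ x, ‖f x‖ₑ ^ 2 ≠ ∞) (hg2 : ∫⁻ x, ‖g x‖ₑ ^ 2 ≠ ∞)
    (h0 : (∫⁻ x, ‖f x‖ₑ ^ 2) * ∫⁻ x, ‖g x‖ₑ ^ 2 = 0) :
    ∀ᵐ x, ∀ t ∈ E, posAverage d (fun x => ‖f x‖ₑ) (fun x => ‖g x‖ₑ) t x = 0 := by
  have hε : ∀ n : ℕ, (2⁻¹ : ℝ≥0∞) ^ n ≠ 0 := fun n => by simp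
  have hε0 : Tendsto (fun n : ℕ => (2⁻¹ : ℝ≥0∞) ^ n) atTop (𝓝 0) :=
    ENNReal.tendsto_pow_atTop_nhds_zero_of_lt_one (by norm_num)
  choose H hHm hH hHi using fun n => exists_majorant hA hf hg (hε n)
  have hlim := ENNReal.Tendsto.mul (ENNReal.Tendsto.const_mul (a := (A : ℝ≥0∞))
    ((tendsto_const_nhds (x := ∫⁻ x, ‖f x‖ₑ ^ 2)).add hε0) (Or.inr ENNReal.coe_ne_top))
    (Or.inr (by simpa using hg2)) ((tendsto_const_nhds (x := ∫⁻ x, ‖g x‖ₑ ^ 2)).add hε0)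
    (Or.inr (ENNReal.mul_ne_top ENNReal.coe_ne_top (by simpa using hf2)))
  rw [add_zero, add_zero, mul_assoc, h0, mul_zero] at hlim
  have hz := ae_eq_zero_of_le_of_tendsto (μ := volume)
    (m := fun x => ⨆ t ∈ E, posAverage d (fun x => ‖f x‖ₑ) (fun x => ‖g x‖ₑ) t x)
    (fun n => (hHm n).aemeasurable)
    (fun n => Eventually.of_forall fun x => iSup₂_le fun t ht => hH n t ht x)
    (tendsto_of_tendsto_of_tendsto_of_le_of_le tendsto_const_nhds hlim (fun _ => zero_le) hHi)
  filter_upwards [hz] with x hx t ht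
  refine le_antisymm (le_trans ?_ hx.le) zero_le
  exact le_iSup₂ (f := fun t (_ : t ∈ E) =>
    posAverage d (fun x => ‖f x‖ₑ) (fun x => ‖g x‖ₑ) t x) t ht

/-- Null sets are not seen by the averages, simultaneously for all radii in `E`. -/
lemma ae_forall_ae_comp_eq
    (hA : ∀ φ ψ : 𝓢(Eu d, ℂ), ∫⁻ x, triangleMaximal E φ ψ x ^ 2 ≤
      A * negSobolevSq 0 (𝓕 φ : 𝓢(Eu d, ℂ)) * negSobolevSq 0 (𝓕 ψ : 𝓢(Eu d, ℂ)))
    {f f' : Eu d → ℂ} (hff' : f =ᵐ[volume] f') :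
    ∀ᵐ x, ∀ t ∈ E, (∀ᵐ p ∂(pairMeasure d), f (x - t • p.1) = f' (x - t • p.1)) ∧
      ∀ᵐ p ∂(pairMeasure d), f (x - t • p.2) = f' (x - t • p.2) := by
  obtain ⟨N, hsub, hNm, hN0⟩ := exists_measurable_superset_of_null (ae_iff.mp hff')
  -- The bilinear estimate needs a second function. The root k of w is square integrable and
  -- vanishes nowhere, so if the average of the indicator of N against k is zero, then almost no
  -- triangle has the vertex in question in N.
  obtain ⟨w, hw0, hwm, hwi⟩ := exists_pos_lintegral_lt_of_sigmaFinite (volume : Measure (Eu d))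
    one_ne_zero
  set k : Eu d → ℂ := fun x => ((NNReal.sqrt (w x) : ℝ) : ℂ) with hk
  set n : Eu d → ℂ := N.indicator fun _ => 1 with hn
  have hkm : Measurable k := Complex.measurable_ofReal.comp
    ((NNReal.continuous_sqrt.measurable.comp hwm).coe_nnreal_real)
  have hnm : Measurable n := measurable_const.indicator hNm
  have hk0 : ∀ x, ‖k x‖ₑ ≠ 0 := fun x => by
    have := hw0 x
    simp [hk, this.ne']
  have hk2 : ∫⁻ x, ‖k x‖ₑ ^ 2 ≠ ∞ := by
    refine ne_top_of_le_ne_top hwi.ne_top (lintegral_mono fun x => le_of_eq ?_)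
    have : ‖k x‖ₑ = (NNReal.sqrt (w x) : ℝ≥0∞) := by
      rw [hk, ← ofReal_norm, Complex.norm_real, Real.norm_of_nonneg (NNReal.coe_nonneg _),
        ENNReal.ofReal_coe_nnreal]
    rw [this, ← ENNReal.coe_pow, NNReal.sq_sqrt]
  have hn2 : ∫⁻ x, ‖n x‖ₑ ^ 2 = 0 := by
    rw [lintegral_eq_zero_iff (hnm.enorm.pow_const 2)]
    filter_upwards [measure_eq_zero_iff_ae_notMem.mp hN0] with x hx
    simp [hn, hx]
  have h1 := ae_posAverage_eq_zero hA hnm.aestronglyMeasurable hkm.aestronglyMeasurable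
    (by simp [hn2]) hk2 (by rw [hn2, zero_mul])
  have h2 := ae_posAverage_eq_zero hA hkm.aestronglyMeasurable hnm.aestronglyMeasurable
    hk2 (by simp [hn2]) (by rw [hn2, mul_zero])
  have hmem : ∀ y, ‖n y‖ₑ = 0 → f y = f' y := fun y hy => by
    by_contra hne
    have : y ∈ N := hsub hne
    simp [hn, this] at hy
  filter_upwards [h1, h2] with x hx1 hx2 t ht
  have m1 : Measurable fun p : Eu d × Eu d => x - t • p.1 := by fun_prop
  have m2 : Measurable fun p : Eu d × Eu d => x - t • p.2 := by fun_prop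
  constructor
  · have h := hx1 t ht
    rw [posAverage] at h
    filter_upwards [(lintegral_eq_zero_iff ((hnm.comp m1).enorm.mul (hkm.comp m2).enorm)).mp h]
      with p hp
    exact hmem _ ((mul_eq_zero.mp hp).resolve_right (hk0 _))
  · have h := hx2 t ht
    rw [posAverage] at h
    filter_upwards [(lintegral_eq_zero_iff ((hkm.comp m1).enorm.mul (hnm.comp m2).enorm)).mp h]
      with p hp
    exact hmem _ ((mul_eq_zero.mp hp).resolve_left (hk0 _))

lemma lintegral_enorm_sq_ne_top {f : Eu d → ℂ} (hf : MemLp f 2 volume) :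
    ∫⁻ x, ‖f x‖ₑ ^ 2 ≠ ∞ := by
  have h := eLpNorm_two_sq (μ := (volume : Measure (Eu d))) fun x => ‖f x‖ₑ
  rw [eLpNorm_enorm] at h
  rw [← h]
  exact ENNReal.pow_ne_top hf.2.ne

/-- Where the majorant is finite, it bounds the integrals of the absolute values for all t ∈ E at
once. For measurability, f and g are replaced by strongly measurable representatives, which for
almost every x changes no average with t ∈ E. -/
lemma ae_integrable_pairMeasure
    (hA : ∀ φ ψ : 𝓢(Eu d, ℂ), ∫⁻ x, triangleMaximal E φ ψ x ^ 2 ≤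
      A * negSobolevSq 0 (𝓕 φ : 𝓢(Eu d, ℂ)) * negSobolevSq 0 (𝓕 ψ : 𝓢(Eu d, ℂ)))
    {f g : Eu d → ℂ} (hf : MemLp f 2 volume) (hg : MemLp g 2 volume) :
    ∀ᵐ x, ∀ t ∈ E, Integrable (fun p => f (x - t • p.1) * g (x - t • p.2)) (pairMeasure d) := by
  obtain ⟨H, hHm, hH, hHi⟩ := exists_majorant hA hf.1 hg.1 one_ne_zero
  have hfin : ∫⁻ x, H x ^ 2 ≠ ∞ := by
    refine ne_top_of_le_ne_top ?_ hHi
    have h1 := lintegral_enorm_sq_ne_top hf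
    have h2 := lintegral_enorm_sq_ne_top hg
    finiteness
  filter_upwards [ae_lt_top (hHm.pow_const 2) hfin, ae_forall_ae_comp_eq hA hf.1.ae_eq_mk,
    ae_forall_ae_comp_eq hA hg.1.ae_eq_mk] with x hx hxf hxg t ht
  have m1 : Measurable fun p : Eu d × Eu d => x - t • p.1 := by fun_prop
  have m2 : Measurable fun p : Eu d × Eu d => x - t • p.2 := by fun_prop
  refine ⟨⟨fun p => hf.1.mk f (x - t • p.1) * hg.1.mk g (x - t • p.2),
    (hf.1.stronglyMeasurable_mk.comp_measurable m1).mul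
      (hg.1.stronglyMeasurable_mk.comp_measurable m2), ?_⟩, ?_⟩
  · filter_upwards [(hxf t ht).1, (hxg t ht).2] with p h1 h2
    rw [h1, h2]
  · have h1 := hH t ht x
    rw [posAverage] at h1
    rw [HasFiniteIntegral]
    simp only [enorm_mul]
    refine h1.trans_lt ?_
    by_contra h
    rw [not_lt, top_le_iff] at h
    rw [h, ENNReal.top_pow two_ne_zero] at hx
    exact lt_irrefl _ hx

/-- The averages of square-integrable functions depend continuously on the functions,
uniformly in the radius. -/
lemma exists_majorant_sub
    (hA : ∀ φ ψ : 𝓢(Eu d, ℂ), ∫⁻ x, triangleMaximal E φ ψ x ^ 2 ≤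
      A * negSobolevSq 0 (𝓕 φ : 𝓢(Eu d, ℂ)) * negSobolevSq 0 (𝓕 ψ : 𝓢(Eu d, ℂ)))
    {f g φ ψ : Eu d → ℂ} (hf : MemLp f 2 volume) (hg : MemLp g 2 volume)
    (hφ : MemLp φ 2 volume) (hψ : MemLp ψ 2 volume) {ε : ℝ≥0∞} (hε : ε ≠ 0) :
    ∃ H : Eu d → ℝ≥0∞, Measurable H ∧
      (∀ᵐ x, maximalFunction E (triangleAverage f g - triangleAverage φ ψ) x ≤ H x) ∧
      ∫⁻ x, H x ^ 2 ≤
        2 * (A * ((∫⁻ x, ‖f x - φ x‖ₑ ^ 2) + ε) * ((∫⁻ x, ‖g x‖ₑ ^ 2) + ε)) +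
        2 * (A * (2 * (∫⁻ x, ‖f x - φ x‖ₑ ^ 2) + 2 * (∫⁻ x, ‖f x‖ₑ ^ 2) + ε) *
          ((∫⁻ x, ‖g x - ψ x‖ₑ ^ 2) + ε)) := by
  obtain ⟨H, hHm, hH, hHi⟩ := exists_majorant hA (hf.sub hφ).1 hg.1 hε
  obtain ⟨K, hKm, hK, hKi⟩ := exists_majorant hA hφ.1 (hg.sub hψ).1 hε
  -- The norm of φ is expressed through f and the error f - φ, so that the final bound visibly tends
  -- to zero along approximations.
  have hφ2 : ∫⁻ x, ‖φ x‖ₑ ^ 2 ≤ 2 * (∫⁻ x, ‖f x - φ x‖ₑ ^ 2) + 2 * ∫⁻ x, ‖f x‖ₑ ^ 2 := by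
    rw [← lintegral_const_mul' _ _ (by norm_num), ← lintegral_const_mul' _ _ (by norm_num),
      ← lintegral_add_right' _ ((hf.1.enorm.pow_const 2).const_mul 2)]
    refine lintegral_mono fun x => le_trans ?_ (add_sq_le_two_mul _ _)
    gcongr
    have e : φ x = -(f x - φ x) + f x := by ring
    calc ‖φ x‖ₑ = ‖-(f x - φ x) + f x‖ₑ := by rw [← e]
      _ ≤ _ := (enorm_add_le _ _).trans_eq (by rw [enorm_neg])
  refine ⟨fun x => H x + K x, hHm.add hKm, ?_, ?_⟩
  · filter_upwards [ae_integrable_pairMeasure hA hf hg, ae_integrable_pairMeasure hA hφ hg,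
      ae_integrable_pairMeasure hA hφ hψ] with x h1 h2 h3
    refine iSup₂_le fun t ht => ?_
    have e : (triangleAverage f g - triangleAverage φ ψ) t x =
        ∫ p, (f - φ) (x - t • p.1) * g (x - t • p.2) ∂(pairMeasure d) +
        ∫ p, φ (x - t • p.1) * (g - ψ) (x - t • p.2) ∂(pairMeasure d) := by
      have e1 : ∀ p : Eu d × Eu d, (f - φ) (x - t • p.1) * g (x - t • p.2) =
        f (x - t • p.1) * g (x - t • p.2) - φ (x - t • p.1) * g (x - t • p.2) := fun p => by
          simp only [Pi.sub_apply]; ring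
      have e2 : ∀ p : Eu d × Eu d, φ (x - t • p.1) * (g - ψ) (x - t • p.2) =
        φ (x - t • p.1) * g (x - t • p.2) - φ (x - t • p.1) * ψ (x - t • p.2) := fun p => by
          simp only [Pi.sub_apply]; ring
      simp_rw [e1, e2]
      rw [integral_sub (h1 t ht) (h2 t ht), integral_sub (h2 t ht) (h3 t ht), Pi.sub_apply,
        Pi.sub_apply, triangleAverage_eq, triangleAverage_eq]
      ring
    rw [e]
    refine (enorm_add_le _ _).trans (add_le_add ?_ ?_)
    · refine (enorm_integral_le_lintegral_enorm _).trans (le_trans (le_of_eq ?_) (hH t ht x))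
      simp only [enorm_mul, posAverage]
    · refine (enorm_integral_le_lintegral_enorm _).trans (le_trans (le_of_eq ?_) (hK t ht x))
      simp only [enorm_mul, posAverage]
  · calc ∫⁻ x, (H x + K x) ^ 2 ≤ ∫⁻ x, (2 * H x ^ 2 + 2 * K x ^ 2) :=
          lintegral_mono fun x => add_sq_le_two_mul _ _
      _ = 2 * (∫⁻ x, H x ^ 2) + 2 * ∫⁻ x, K x ^ 2 := by
          rw [lintegral_add_left ((hHm.pow_const 2).const_mul 2),
            lintegral_const_mul' _ _ (by norm_num), lintegral_const_mul' _ _ (by norm_num)]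
      _ ≤ _ := by
          gcongr
          · exact hHi
          · exact hKi.trans (by gcongr; exact le_rfl)

lemma schwartz_toLp_sub_toLp_sq {f : Eu d → ℂ} (hf : MemLp f 2 volume) (φ : 𝓢(Eu d, ℂ)) :
    ∫⁻ x, ‖f x - φ x‖ₑ ^ 2 = ‖φ.toLp 2 volume - hf.toLp f‖ₑ ^ 2 := by
  rw [← eLpNorm_two_sq, eLpNorm_enorm, Lp.enorm_def]
  congr 1
  refine eLpNorm_congr_norm_ae ?_
  filter_upwards [Lp.coeFn_sub (φ.toLp 2 volume) (hf.toLp f), φ.coeFn_toLp 2 volume,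
    hf.coeFn_toLp] with x h1 h2 h3
  rw [h1, Pi.sub_apply, h2, h3, norm_sub_rev]

/-- On square-integrable functions the extension by continuity is given by the integrals. -/
lemma eLpNorm_triangleMaximal_le {C : NNReal} {s₁ s₂ : ℝ} (hs₁ : 0 ≤ s₁) (hs₂ : 0 ≤ s₂)
    (hA : ∀ φ ψ : 𝓢(Eu d, ℂ), ∫⁻ x, triangleMaximal E φ ψ x ^ 2 ≤
      A * negSobolevSq 0 (𝓕 φ : 𝓢(Eu d, ℂ)) * negSobolevSq 0 (𝓕 ψ : 𝓢(Eu d, ℂ)))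
    (hC : ∀ φ ψ : 𝓢(Eu d, ℂ), eLpNorm (triangleMaximal E φ ψ) 2 volume ≤
      C * sobolevENorm (-s₁) (φ : 𝓢'(Eu d, ℂ)) * sobolevENorm (-s₂) (ψ : 𝓢'(Eu d, ℂ)))
    {f g : Eu d → ℂ} (hf : MemLp f 2 volume) (hg : MemLp g 2 volume) :
    AEMeasurable (triangleMaximal E f g) volume ∧ eLpNorm (triangleMaximal E f g) 2 volume ≤
      C * sobolevENorm (-s₁) (hf.toLp f : 𝓢'(Eu d, ℂ)) *
        sobolevENorm (-s₂) (hg.toLp g : 𝓢'(Eu d, ℂ)) := by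
  have hfin : ∀ {s : ℝ}, 0 ≤ s → ∀ h : Lp ℂ 2 (volume : Measure (Eu d)),
      sobolevENorm (-s) (h : 𝓢'(Eu d, ℂ)) < ∞ := fun hs h =>
    (sobolevENorm_neg_toLp_le hs h).trans_lt enorm_lt_top
  obtain ⟨F, hF, hFm, hFi⟩ := exists_extension hC (hfin hs₁ (hf.toLp f)) (hfin hs₂ (hg.toLp g))
  have hε : ∀ n : ℕ, (2⁻¹ : ℝ≥0∞) ^ n ≠ 0 := fun n => by simp
  have hε0 : Tendsto (fun n : ℕ => (2⁻¹ : ℝ≥0∞) ^ n) atTop (𝓝 0) :=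
    ENNReal.tendsto_pow_atTop_nhds_zero_of_lt_one (by norm_num)
  choose φ hφ using fun n => exists_schwartz_toLp_sub_lt (hf.toLp f) (hε n)
  choose ψ hψ using fun n => exists_schwartz_toLp_sub_lt (hg.toLp g) (hε n)
  have hconv : ∀ {s : ℝ}, 0 ≤ s → ∀ {h : Lp ℂ 2 (volume : Measure (Eu d))} {χ : ℕ → 𝓢(Eu d, ℂ)},
      (∀ n, ‖(χ n).toLp 2 volume - h‖ₑ < 2⁻¹ ^ n) →
      Tendsto (fun n => sobolevENorm (-s) ((χ n : 𝓢'(Eu d, ℂ)) - (h : 𝓢'(Eu d, ℂ)))) atTop (𝓝 0) := by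
    intro s hs h χ hχ
    refine tendsto_of_tendsto_of_tendsto_of_le_of_le tendsto_const_nhds hε0 (fun _ => zero_le)
      fun n => le_trans ?_ (hχ n).le
    have e : (χ n : 𝓢'(Eu d, ℂ)) - (h : 𝓢'(Eu d, ℂ)) =
        (((χ n).toLp 2 volume - h : Lp ℂ 2 (volume : Measure (Eu d))) : 𝓢'(Eu d, ℂ)) := by
      rw [← Lp.toTemperedDistribution_toLp_eq (p := 2) (μ := volume) (f := χ n)]
      exact (map_sub (Lp.toTemperedDistributionCLM ℂ (volume : Measure (Eu d)) 2) _ _).symm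
    rw [e]
    exact sobolevENorm_neg_toLp_le hs _
  obtain ⟨hTm, hTF⟩ := hF φ ψ (hconv hs₁ hφ) (hconv hs₂ hψ)
  choose H hHm hH hHi using fun n => exists_majorant_sub hA hf hg ((φ n).memLp 2 volume)
    ((ψ n).memLp 2 volume) (hε n)
  have hlim : Tendsto (fun n => ∫⁻ x, H n x ^ 2) atTop (𝓝 0) := by
    have hsq : ∀ {f : Eu d → ℂ} (hf : MemLp f 2 volume) {χ : ℕ → 𝓢(Eu d, ℂ)},
        (∀ n, ‖(χ n).toLp 2 volume - hf.toLp f‖ₑ < 2⁻¹ ^ n) →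
        Tendsto (fun n => ∫⁻ x, ‖f x - χ n x‖ₑ ^ 2) atTop (𝓝 0) := by
      intro f hf χ hχ
      simp only [schwartz_toLp_sub_toLp_sq hf]
      have h1 : Tendsto (fun n => ‖(χ n).toLp 2 volume - hf.toLp f‖ₑ) atTop (𝓝 0) :=
        tendsto_of_tendsto_of_tendsto_of_le_of_le tendsto_const_nhds hε0 (fun _ => zero_le)
          fun n => (hχ n).le
      have h2 := (ENNReal.continuous_pow 2).continuousAt.tendsto.comp h1
      rwa [zero_pow two_ne_zero] at h2
    have hf2 := lintegral_enorm_sq_ne_top hf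
    have hg2 := lintegral_enorm_sq_ne_top hg
    have h1 : Tendsto (fun n =>
        2 * (A * ((∫⁻ x, ‖f x - φ n x‖ₑ ^ 2) + 2⁻¹ ^ n) * ((∫⁻ x, ‖g x‖ₑ ^ 2) + 2⁻¹ ^ n)) +
        2 * (A * (2 * (∫⁻ x, ‖f x - φ n x‖ₑ ^ 2) + 2 * (∫⁻ x, ‖f x‖ₑ ^ 2) + 2⁻¹ ^ n) *
          ((∫⁻ x, ‖g x - ψ n x‖ₑ ^ 2) + 2⁻¹ ^ n))) atTop
        (𝓝 (2 * (A * (0 + 0) * ((∫⁻ x, ‖g x‖ₑ ^ 2) + 0)) +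
          2 * (A * (2 * 0 + 2 * (∫⁻ x, ‖f x‖ₑ ^ 2) + 0) * (0 + 0)))) := by
      refine Tendsto.add
        (ENNReal.Tendsto.const_mul (ENNReal.Tendsto.mul (ENNReal.Tendsto.const_mul
          ((hsq hf hφ).add hε0) ?_) ?_ (tendsto_const_nhds.add hε0) ?_) ?_)
        (ENNReal.Tendsto.const_mul (ENNReal.Tendsto.mul (ENNReal.Tendsto.const_mul
          (((ENNReal.Tendsto.const_mul (hsq hf hφ) ?_).add tendsto_const_nhds).add hε0) ?_) ?_
          ((hsq hg hψ).add hε0) ?_) ?_)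
      all_goals right
      all_goals simp [ENNReal.mul_eq_top, hf2, hg2]
    simp only [add_zero, mul_zero, zero_mul] at h1
    exact tendsto_of_tendsto_of_tendsto_of_le_of_le tendsto_const_nhds h1 (fun _ => zero_le) hHi
  -- The integrals and the extension F are both limits of the same Schwartz averages in the norm of
  -- the maximal function. Hence they coincide for almost every x, simultaneously for all t ∈ E.
  have hz := ae_eq_zero_of_le_of_tendsto (μ := volume)
    (m := maximalFunction E (triangleAverage f g - F))
    (K := fun n x => H n x + maximalFunction E (triangleAverage (φ n) (ψ n) - F) x)
    (fun n => (hHm n).aemeasurable.add (hTm n))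
    (fun n => by
      filter_upwards [hH n] with x hx
      exact (maximalFunction_sub_le _ (triangleAverage (φ n) (ψ n)) _ x).trans (by gcongr))
    (by
      have hT2 := (ENNReal.continuous_pow 2).continuousAt.tendsto.comp hTF
      simp only [Function.comp_def, eLpNorm_two_sq] at hT2
      rw [zero_pow two_ne_zero] at hT2
      have h1 := (ENNReal.Tendsto.const_mul hlim (a := 2) (Or.inr (by norm_num))).add
        (ENNReal.Tendsto.const_mul hT2 (a := 2) (Or.inr (by norm_num)))
      rw [mul_zero, add_zero] at h1
      refine tendsto_of_tendsto_of_tendsto_of_le_of_le tendsto_const_nhds h1 (fun _ => zero_le)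
        fun n => ?_
      rw [← lintegral_const_mul' _ _ (by norm_num), ← lintegral_const_mul' _ _ (by norm_num),
        ← lintegral_add_left (((hHm n).pow_const 2).const_mul 2)]
      exact lintegral_mono fun x => add_sq_le_two_mul _ _)
  have heq : triangleMaximal E f g =ᵐ[volume] maximalFunction E F := by
    filter_upwards [hz] with x hx
    refine iSup_congr fun t => iSup_congr fun ht => ?_
    have h1 : ‖(triangleAverage f g - F) t x‖ₑ ≤ 0 := hx ▸
      le_iSup₂ (f := fun t (_ : t ∈ E) => ‖(triangleAverage f g - F) t x‖ₑ) t ht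
    rw [nonpos_iff_eq_zero, enorm_eq_zero] at h1
    rw [sub_eq_zero.mp h1]
  exact ⟨hFm.congr heq.symm, (eLpNorm_congr_ae heq).trans_le hFi⟩

end SquareIntegrable

theorem theorem1p3 (d : ℕ) (E : Set ℝ) (hE : E ⊆ Set.Icc 1 2) (β : ℝ)
    (hβ : upperMinkowskiDim E = (β : EReal)) (hd : 4 + β < (d : ℝ))
    (s₁ s₂ : ℝ) (hs₁ : 0 ≤ s₁) (hs₂ : 0 ≤ s₂) (hs : s₁ + s₂ < ((d : ℝ) - 4 - β) / 2) :
    ∃ C : NNReal,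
      -- the estimate for square-integrable functions, where the averages are genuine integrals
      (∀ (f g : EuclideanSpace ℝ (Fin d) → ℂ) (hf : MemLp f 2 volume) (hg : MemLp g 2 volume),
        (∀ᵐ x ∂(volume : Measure (EuclideanSpace ℝ (Fin d))), ∀ t ∈ E,
          Integrable (fun p => f (x - t • p.fst) * g (x - t • p.snd)) (triangleMeasure d)) ∧
        AEMeasurable (triangleMaximal E f g) volume ∧
        eLpNorm (triangleMaximal E f g) 2 volume ≤
          C * sobolevENorm (-s₁) (hf.toLp f : 𝓢'(EuclideanSpace ℝ (Fin d), ℂ)) *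
            sobolevENorm (-s₂) (hg.toLp g : 𝓢'(EuclideanSpace ℝ (Fin d), ℂ))) ∧
      -- the estimate on all of `H^{-s₁} × H^{-s₂}`, where `F t` is the extension by continuity
      -- of the average of radius `t`
      (∀ u v : 𝓢'(EuclideanSpace ℝ (Fin d), ℂ),
        sobolevENorm (-s₁) u < ∞ → sobolevENorm (-s₂) v < ∞ →
        ∃ F : ℝ → EuclideanSpace ℝ (Fin d) → ℂ,
          (∀ φ ψ : ℕ → 𝓢(EuclideanSpace ℝ (Fin d), ℂ),
            Tendsto (fun n => sobolevENorm (-s₁)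
              ((φ n : 𝓢'(EuclideanSpace ℝ (Fin d), ℂ)) - u)) atTop (𝓝 0) →
            Tendsto (fun n => sobolevENorm (-s₂)
              ((ψ n : 𝓢'(EuclideanSpace ℝ (Fin d), ℂ)) - v)) atTop (𝓝 0) →
            (∀ n, AEMeasurable
              (maximalFunction E (triangleAverage (φ n) (ψ n) - F)) volume) ∧
            Tendsto (fun n => eLpNorm
              (maximalFunction E (triangleAverage (φ n) (ψ n) - F)) 2 volume) atTop (𝓝 0)) ∧
          AEMeasurable (maximalFunction E F) volume ∧
          eLpNorm (maximalFunction E F) 2 volume ≤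
            C * sobolevENorm (-s₁) u * sobolevENorm (-s₂) v) := by
  have hA0 : (0 : ℝ) + 0 < ((d : ℝ) - 4 - β) / 2 := by linarith
  -- The orders s₁ = s₂ = 0 are admissible because d > 4 + β. This case gives absolute convergence
  -- and the identification on L²; the constant of the theorem comes only from B, with a square root
  -- because B bounds the squared norm.
  obtain ⟨A, hA⟩ := exists_schwartz_maximal_le hE hβ hd le_rfl le_rfl hA0
  obtain ⟨B, hB⟩ := exists_schwartz_maximal_le hE hβ hd hs₁ hs₂ hs
  have hC : ∀ φ ψ : 𝓢(Eu d, ℂ), eLpNorm (triangleMaximal E φ ψ) 2 volume ≤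
      (NNReal.sqrt B : NNReal) * sobolevENorm (-s₁) (φ : 𝓢'(Eu d, ℂ)) *
        sobolevENorm (-s₂) (ψ : 𝓢'(Eu d, ℂ)) := fun φ ψ => by
    refine eLpNorm_two_le_of_sq_le ((hB φ ψ).trans_eq ?_)
    rw [negSobolevSq_eq, negSobolevSq_eq, mul_pow, mul_pow, ← ENNReal.coe_pow, NNReal.sq_sqrt]
  refine ⟨NNReal.sqrt B, fun f g hf hg => ⟨?_, eLpNorm_triangleMaximal_le hs₁ hs₂ hA hC hf hg⟩,
    fun u v hu hv => exists_extension hC hu hv⟩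
  filter_upwards [ae_integrable_pairMeasure hA hf hg] with x hx t ht
  exact ((pairEquiv d).measurableEmbedding.integrable_map_iff).mp (hx t ht)
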